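/- **Definitions.** *Matchings.* A matching of length $n$ is a partition of $\{1,\dots,2n\}$ into $n$ pairs (arcs) $[a,b]$, $a<b$, with opener $a$ and closer $b$. It is a *Stoimenow matching* if it has no two nested arcs $a<c<d<b$ (with $[a,b],[c,d]$ arcs) such that $c=a+1$ or $b=d+1$. It contains a pattern (a smaller matching) if deleting some arcs and relabelling the remaining points in order gives that pattern; otherwise it avoids it. Let $P_1=\{[1,3],[2,7],[4,5],[6,8]\}$ and $P_2=\{[1,3],[2,5],[4,7],[6,8]\}$, and let $\mathcal M(P_i)$ be the set of Stoimenow matchings of all lengths $n\ge 0$ that avoid $P_i$. A crossing of $M$ is a nonempty set of arcs with $a_1<\dots<a_k<b_1<\dots<b_k$. $\mathsf{fcr}(M)$ is the size of the first maximal crossing, i.e. of the inclusion-maximal crossing that contains the arc starting at $1$ (and $0$ for the empty matching). $\mathsf{bl}(M)$ is the number of irreducible blocks, i.e. the number of $i\in\{1,\dots,n\}$ such that $\{1,\dots,2i\}$ contains as many openers as closers. *Posets.* $\mathcal P(\mathbf{3+1})$ and $\mathcal P(\mathbf N)$ are the sets of isomorphism classes of finite posets without an induced subposet $\mathbf{2+2}$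 (two disjoint 2-element chains) and without an induced $\mathbf{3+1}$ (disjoint union of a 3-element chain and a point), respectively $\mathbf N$ (elements $a,b,c,d$ with relations $a<c$, $a<d$, $b<d$). For a poset $P$, $\mathsf{min}(P)$ is the number of minimal elements, $\mathsf{smc}(P)$ is the size of the shortest maximal chain, and $\mathsf{ssd}(P)$ is the number of summands in the decomposition of $P$ as an ordinal sum of irreducible posets (nonempty posets that are not ordinal sums of two nonempty posets). *Ascent sequences.* $\mathcal A(101)$ is the set of sequences $(\alpha_1,\dots,\alpha_n)$, $n\ge0$, of nonnegative integers with $\alpha_1=0$ and $\alpha_i\le 1+\#\{j<i-1:\alpha_j<\alpha_{j+1}\}$ for $2\le i\le n$, having no subsequence order-isomorphic to $101$. $\mathsf{zero}(\alpha)$ is the number of zeros and $\mathsf{rmin}(\alpha)=\#\{i:\alpha_i<\alpha_j\text{ for all }j>i\}$. *Fishburn permutations.* $\mathcal F(3142)$ is the set of permutations $\pi$ of $\{1,\dots,n\}$, $n\ge0$, for which there are no $i,j$ with $j>i+1$ and $\pi_j+1=\pi_i<\pi_{i+1}$, and which have no subsequence order-isomorphic to $3142$. $\mathsf{idr}(\pi)$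 is the length of the initial descending run and $\mathsf{lmax}(\pi)=\#\{i:\pi_i>\pi_j\text{ for all }j<i\}$. The size $|\cdot|$ of an object is its $n$ (number of arcs, elements, or entries). **Theorem.** As formal power series in $t$ with coefficients in $\mathbb Q[y,z]$, $$\begin{aligned} &\sum_{M\in\mathcal M(P_1)}y^{\mathsf{fcr}(M)}z^{\mathsf{bl}(M)}t^{|M|} =\sum_{M\in\mathcal M(P_2)}y^{\mathsf{fcr}(M)}z^{\mathsf{bl}(M)}t^{|M|} =\sum_{P\in\mathcal P(\mathbf{3+1})}y^{\mathsf{min}(P)}z^{\mathsf{ssd}(P)}t^{|P|}\\ &=\sum_{P\in\mathcal P(\mathbf N)}y^{\mathsf{min}(P)}z^{\mathsf{smc}(P)}t^{|P|} =\sum_{\alpha\in\mathcal A(101)}y^{\mathsf{zero}(\alpha)}z^{\mathsf{rmin}(\alpha)}t^{|\alpha|} =\sum_{\pi\in\mathcal F(3142)}y^{\mathsf{idr}(\pi)}z^{\mathsf{lmax}(\pi)}t^{|\pi|}\\ &=1+\frac{4t^2\,yzt}{\bigl(2t-yt(1-\sqrt{1-4t})\bigr)\bigl(2t-zt(1-\sqrt{1-4t})\bigr)}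 =1+yzt\,C(y,t)\,C(z,t), \end{aligned}$$ where $C(x,t)=\dfrac1{1-xt\,C(t)}$, $C(t)=\sum_{n\ge0}\frac1{n+1}\binom{2n}{n}t^n$. The fraction is understood in the field of fractions of $\mathbb Q[y,z][[t]]$, where its denominator is nonzero. The series $C(x,t)$ is the generating function of the ballot numbers $T(n,k)=\frac{n-k+1}{n+1}\binom{n+k}{k}$, $0\le k\le n$: $$C(x,t)=1+\sum_{n\ge0}\sum_{k=0}^{n}T(n,k)\,x^{\,n+1-k}\,t^{\,n+1}.$$ In particular, the joint distribution of $(\mathsf{fcr},\mathsf{bl})$ over $\mathcal M(P_1)$, and over $\mathcal M(P_2)$, is symmetric: the generating function is invariant under interchanging $y$ and $z$. -/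

import Mathlib

namespace Fishburn

/-! ### Matchings -/

/-- A matching on `2 * n` points in a line (a partition of the points into `n` pairs), given by the
map that sends each point to the other point of its pair. -/
@[ext]
structure Matching (n : ℕ) where
  partner : Fin (2 * n) → Fin (2 * n)
  partner_partner : ∀ i, partner (partner i) = i
  partner_ne : ∀ i, partner i ≠ i

namespace Matching

variable {n : ℕ}

/-- `[a, b]` is an arc, with opener `a` and closer `b`. -/
def IsArc (M : Matching n) (a b : Fin (2 * n)) : Prop := a < b ∧ M.partner a = b

def IsOpener (M : Matching n) (a : Fin (2 * n)) : Prop := a < M.partner a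

def IsCloser (M : Matching n) (a : Fin (2 * n)) : Prop := M.partner a < a

/-- Neither two nested arcs with adjacent openers (Type I) nor two nested arcs with adjacent
closers (Type II). -/
def IsStoimenow (M : Matching n) : Prop :=
  (¬ ∃ i j k l : Fin (2 * n),
      M.IsArc i l ∧ M.IsArc j k ∧ (j : ℕ) = i + 1 ∧ k < l) ∧
  (¬ ∃ k l i j : Fin (2 * n),
      M.IsArc k j ∧ M.IsArc l i ∧ (j : ℕ) = i + 1 ∧ k < l)

/-- Some submatching of `M`, obtained by removing arcs, is isomorphic to the pattern `P`. -/
def Contains {k : ℕ} (M : Matching n) (P : Matching k) : Prop :=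
  ∃ f : Fin (2 * k) ↪o Fin (2 * n), ∀ i, M.partner (f i) = f (P.partner i)

/-- A `k`-crossing `a₁ < ⋯ < a_k < b₁ < ⋯ < b_k` with `k ≥ 1`, given by the set of the openers of
its arcs. -/
def IsCrossing (M : Matching n) (S : Finset (Fin (2 * n))) : Prop :=
  S.Nonempty ∧ (∀ a ∈ S, M.IsOpener a) ∧
    ∀ a ∈ S, ∀ b ∈ S, a < b → b < M.partner a ∧ M.partner a < M.partner b

/-- A crossing that is not contained in a larger one. -/
def IsMaximalCrossing (M : Matching n) (S : Finset (Fin (2 * n))) : Prop :=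
  Maximal M.IsCrossing S

/-- The size of the first maximal crossing, that is, of the maximal crossing that contains the
first arc (in a Stoimenow matching with at least one arc there is exactly one); it is `0` for the
empty matching. -/
noncomputable def fcr (M : Matching n) : ℕ :=
  sSup {k | ∃ S, M.IsMaximalCrossing S ∧ (∃ a ∈ S, (a : ℕ) = 0) ∧ S.card = k}

/-- The first `2 * i` points contain as many openers as closers. -/
def IsBalancedAt (M : Matching n) (i : ℕ) : Prop :=
  Nat.card {a : Fin (2 * n) // (a : ℕ) < 2 * i ∧ M.IsOpener a} =
    Nat.card {a : Fin (2 * n) // (a : ℕ) < 2 * i ∧ M.IsCloser a}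

/-- The number of irreducible blocks: the blocks end exactly at the points `2 * i`, `1 ≤ i ≤ n`,
such that the first `2 * i` points are balanced. -/
noncomputable def bl (M : Matching n) : ℕ :=
  Set.ncard {i : ℕ | 1 ≤ i ∧ i ≤ n ∧ M.IsBalancedAt i}

/-- On the points `0, …, 7`, the arcs `[0,2], [1,6], [3,4], [5,7]`. -/
def patternOne : Matching 4 where
  partner := ![2, 6, 0, 4, 3, 7, 1, 5]
  partner_partner := by decide
  partner_ne := by decide

/-- On the points `0, …, 7`, the arcs `[0,2], [1,4], [3,6], [5,7]`. -/
def patternTwo : Matching 4 where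
  partner := ![2, 4, 0, 6, 1, 7, 3, 5]
  partner_partner := by decide
  partner_ne := by decide

theorem partner_injective : Function.Injective (partner : Matching n → _) :=
  fun _ _ h => Matching.ext h

instance : Finite (Matching n) := Finite.of_injective _ partner_injective

end Matching

/-- Stoimenow matchings with `n` arcs that avoid the pattern `P`. -/
def StoimenowAvoiding {k : ℕ} (P : Matching k) (n : ℕ) : Type :=
  {M : Matching n // M.IsStoimenow ∧ ¬ M.Contains P}

instance {k : ℕ} (P : Matching k) (n : ℕ) : Finite (StoimenowAvoiding P n) :=
  inferInstanceAs (Finite (Subtype _))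

/-! ### Posets -/

section Poset

variable (α : Type) [PartialOrder α]

/-- The number of minimal elements. -/
noncomputable def minCount : ℕ := Nat.card {x : α // IsMin x}

/-- The size of the shortest maximal chain. -/
noncomputable def smc : ℕ :=
  sInf {k | ∃ s : Set α, IsMaxChain (· ≤ ·) s ∧ s.ncard = k}

/-- A nonempty poset that is not the ordinal sum of two nonempty posets. -/
def IsIrreducible : Prop :=
  Nonempty α ∧ ¬ ∃ D : Set α, D.Nonempty ∧ Dᶜ.Nonempty ∧ ∀ x ∈ D, ∀ y ∈ Dᶜ, x < y

variable {α} in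
/-- The fibres of `f` over `0, 1, …, k - 1` are the summands of a decomposition of the poset as an
ordinal sum of `k` irreducible posets. -/
def IsOrdinalSumDecomposition {k : ℕ} (f : α → Fin k) : Prop :=
  (∀ x y, f x < f y → x < y) ∧ ∀ i, IsIrreducible {x : α // f x = i}

/-- The number of subposets in the ordinal sum decomposition into irreducible posets. -/
noncomputable def ssd : ℕ :=
  sSup {k | ∃ f : α → Fin k, IsOrdinalSumDecomposition f}

/-- No induced subposet is isomorphic to `Q`. -/
def IsFreeOf (Q : Type) [PartialOrder Q] : Prop := IsEmpty (Q ↪o α)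

end Poset

/-- The disjoint union of two 2-element chains. -/
abbrev TwoPlusTwo : Type := Fin 2 ⊕ Fin 2

/-- The disjoint union of a 3-element chain and a 1-element chain. -/
abbrev ThreePlusOne : Type := Fin 3 ⊕ Fin 1

/-- The poset on `{a, b, c, d}` with the relations `a < c`, `a < d` and `b < d`. -/
inductive PosetN : Type
  | a | b | c | d

namespace PosetN

/-- The order relation: the reflexive closure of `a < c`, `a < d`, `b < d`. -/
inductive Rel : PosetN → PosetN → Prop
  | refl (x : PosetN) : Rel x x
  | ac : Rel a c
  | ad : Rel a d
  | bd : Rel b d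

instance : PartialOrder PosetN where
  le := Rel
  le_refl := Rel.refl
  le_trans := by
    intro x y z h₁ h₂
    cases h₁ <;> cases h₂ <;> constructor
  le_antisymm := by
    intro x y h₁ h₂
    cases h₁ <;> cases h₂ <;> rfl

end PosetN

section Invariance

variable {α β : Type} [PartialOrder α] [PartialOrder β]

theorem minCount_congr (e : α ≃o β) : minCount α = minCount β :=
  Nat.card_congr (e.toEquiv.subtypeEquiv fun x => (OrderIso.isMin_apply e (x := x)).symm)

theorem smc_congr (e : α ≃o β) : smc α = smc β := by
  have key : ∀ {γ δ : Type} [PartialOrder γ] [PartialOrder δ] (e : γ ≃o δ) (k : ℕ),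
      (∃ s : Set γ, IsMaxChain (· ≤ ·) s ∧ s.ncard = k) →
        ∃ s : Set δ, IsMaxChain (· ≤ ·) s ∧ s.ncard = k := by
    rintro γ δ _ _ e k ⟨s, hs, hk⟩
    exact ⟨e '' s, hs.image e, by rw [Set.ncard_image_of_injective _ e.injective, hk]⟩
  unfold smc
  congr 1
  ext k
  exact ⟨key e k, key e.symm k⟩

theorem IsIrreducible.congr (e : α ≃o β) (h : IsIrreducible α) : IsIrreducible β := by
  obtain ⟨⟨x⟩, h⟩ := h
  refine ⟨⟨e x⟩, ?_⟩
  rintro ⟨D, ⟨u, hu⟩, ⟨v, hv⟩, hD⟩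
  refine h ⟨e ⁻¹' D, ⟨e.symm u, by simpa using hu⟩, ⟨e.symm v, by simpa using hv⟩, ?_⟩
  intro p hp q hq
  exact e.lt_iff_lt.1 (hD _ hp _ hq)

theorem ssd_congr (e : α ≃o β) : ssd α = ssd β := by
  have key : ∀ {γ δ : Type} [PartialOrder γ] [PartialOrder δ] (e : γ ≃o δ) (k : ℕ),
      (∃ f : γ → Fin k, IsOrdinalSumDecomposition f) →
        ∃ f : δ → Fin k, IsOrdinalSumDecomposition f := by
    rintro γ δ _ _ e k ⟨f, hf, hi⟩
    refine ⟨f ∘ e.symm, fun x y h => e.symm.lt_iff_lt.1 (hf _ _ h), fun i => ?_⟩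
    refine (hi i).congr
      { toEquiv := e.toEquiv.subtypeEquiv fun x => by simp
        map_rel_iff' := ?_ }
    intro p q
    exact e.le_iff_le
  unfold ssd
  congr 1
  ext k
  exact ⟨key e k, key e.symm k⟩

theorem isFreeOf_congr (Q : Type) [PartialOrder Q] (e : α ≃o β) :
    IsFreeOf α Q = IsFreeOf β Q :=
  propext ⟨fun h => ⟨fun f => h.false (f.trans e.symm.toOrderEmbedding)⟩,
    fun h => ⟨fun f => h.false (f.trans e.toOrderEmbedding)⟩⟩

end Invariance

/-- Two partial orders on `Fin n` are equivalent if they are isomorphic as posets. -/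
instance posetSetoid (n : ℕ) : Setoid (PartialOrder (Fin n)) where
  r P Q := Nonempty (@OrderIso (Fin n) (Fin n) P.toLE Q.toLE)
  iseqv :=
    { refl := fun P => ⟨@OrderIso.refl (Fin n) P.toLE⟩
      symm := fun {P Q} h => h.map (@OrderIso.symm (Fin n) (Fin n) P.toLE Q.toLE)
      trans := fun {P Q R} h₁ h₂ =>
        h₁.elim fun e₁ => h₂.elim fun e₂ =>
          ⟨@OrderIso.trans (Fin n) (Fin n) (Fin n) P.toLE Q.toLE R.toLE e₁ e₂⟩ }

/-- (Unlabelled) posets with `n` elements, that is, posets up to isomorphism. -/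
def PosetClass (n : ℕ) : Type := Quotient (posetSetoid n)

namespace PosetClass

variable {n : ℕ}

noncomputable def minCount (p : PosetClass n) : ℕ :=
  Quotient.lift (fun P : PartialOrder (Fin n) => @Fishburn.minCount (Fin n) P)
    (fun P Q (h : Nonempty (@OrderIso (Fin n) (Fin n) P.toLE Q.toLE)) =>
      h.elim fun e => @minCount_congr (Fin n) (Fin n) P Q e) p

noncomputable def smc (p : PosetClass n) : ℕ :=
  Quotient.lift (fun P : PartialOrder (Fin n) => @Fishburn.smc (Fin n) P)
    (fun P Q (h : Nonempty (@OrderIso (Fin n) (Fin n) P.toLE Q.toLE)) =>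
      h.elim fun e => @smc_congr (Fin n) (Fin n) P Q e) p

noncomputable def ssd (p : PosetClass n) : ℕ :=
  Quotient.lift (fun P : PartialOrder (Fin n) => @Fishburn.ssd (Fin n) P)
    (fun P Q (h : Nonempty (@OrderIso (Fin n) (Fin n) P.toLE Q.toLE)) =>
      h.elim fun e => @ssd_congr (Fin n) (Fin n) P Q e) p

def IsFreeOf (p : PosetClass n) (Q : Type) [PartialOrder Q] : Prop :=
  Quotient.lift (fun P : PartialOrder (Fin n) => @Fishburn.IsFreeOf (Fin n) P Q _)
    (fun P P' (h : Nonempty (@OrderIso (Fin n) (Fin n) P.toLE P'.toLE)) =>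
      h.elim fun e => @isFreeOf_congr (Fin n) (Fin n) P P' Q _ e) p

instance : Finite (PartialOrder (Fin n)) :=
  Finite.of_injective (fun P : PartialOrder (Fin n) => P.le) fun _ _ h =>
    PartialOrder.ext fun x y => iff_of_eq (congrFun (congrFun h x) y)

instance : Finite (PosetClass n) := inferInstanceAs (Finite (Quotient _))

end PosetClass

/-- **(2+2)**-free posets with `n` elements, up to isomorphism, that are also `Q`-free. -/
def PosetAvoiding (Q : Type) [PartialOrder Q] (n : ℕ) : Type :=
  {p : PosetClass n // p.IsFreeOf TwoPlusTwo ∧ p.IsFreeOf Q}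

instance (Q : Type) [PartialOrder Q] (n : ℕ) : Finite (PosetAvoiding Q n) :=
  inferInstanceAs (Finite (Subtype _))

/-! ### Words: ascent sequences and permutations -/

section Word

variable {β : Type} [LinearOrder β] {n : ℕ}

/-- Some subsequence of the word `w` is order-isomorphic to the pattern `p`. -/
def ContainsPattern {m : ℕ} (w : Fin n → β) (p : Fin m → ℕ) : Prop :=
  ∃ f : Fin m ↪o Fin n, ∀ a b, p a < p b ↔ w (f a) < w (f b)

/-- The number of left-to-right maxima. -/
noncomputable def lmax (w : Fin n → β) : ℕ := Nat.card {i : Fin n // ∀ j < i, w j < w i}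

/-- The number of right-to-left minima. -/
noncomputable def rmin (w : Fin n → β) : ℕ := Nat.card {i : Fin n // ∀ j > i, w i < w j}

/-- The length of the initial descending run: the number of positions such that the word is
strictly decreasing up to this position. -/
noncomputable def idr (w : Fin n → β) : ℕ := Nat.card {i : Fin n // StrictAntiOn w (Set.Iic i)}

end Word

/-- The number of zeros. -/
noncomputable def zeroCount {n : ℕ} (w : Fin n → ℕ) : ℕ := Nat.card {i : Fin n // w i = 0}

/-- The number of ascents of the part of the word that strictly precedes position `i`. -/
noncomputable def ascBefore {n : ℕ} (w : Fin n → ℕ) (i : Fin n) : ℕ :=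
  Nat.card {k : Fin n // k < i ∧ ∃ j : Fin n, (k : ℕ) = j + 1 ∧ w j < w k}

/-- The first entry is `0`, and every later entry is at most one more than the number of ascents
before it. -/
def IsAscentSequence {n : ℕ} (w : Fin n → ℕ) : Prop :=
  ∀ i : Fin n, ((i : ℕ) = 0 → w i = 0) ∧ ((i : ℕ) ≠ 0 → w i ≤ 1 + ascBefore w i)

/-- Ascent sequences of length `n` that avoid the pattern `p`. -/
def AscentAvoiding {m : ℕ} (p : Fin m → ℕ) (n : ℕ) : Type :=
  {w : Fin n → ℕ // IsAscentSequence w ∧ ¬ ContainsPattern w p}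

instance {m : ℕ} (p : Fin m → ℕ) (n : ℕ) : Finite (AscentAvoiding p n) := by
  refine Set.Finite.subset (Set.finite_Iic (fun _ : Fin n => 1 + n)) ?_
  intro w hw i
  by_cases h : (i : ℕ) = 0
  · simp [(hw.1 i).1 h]
  · refine ((hw.1 i).2 h).trans (Nat.add_le_add_left ?_ 1)
    refine (Finite.card_subtype_le _).trans ?_
    simp

/-- No occurrence of the Fishburn pattern, that is, no `i` and `j > i + 1` such that
`π j + 1 = π i < π (i + 1)`. -/
def IsFishburn {n : ℕ} (π : Equiv.Perm (Fin n)) : Prop :=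
  ¬ ∃ i i' j : Fin n, (i' : ℕ) = i + 1 ∧ i' < j ∧ (π j : ℕ) + 1 = π i ∧ π i < π i'

/-- Fishburn permutations of length `n` that avoid the classical pattern `p`. -/
def FishburnAvoiding {m : ℕ} (p : Fin m → ℕ) (n : ℕ) : Type :=
  {π : Equiv.Perm (Fin n) // IsFishburn π ∧ ¬ ContainsPattern π p}

instance {m : ℕ} (p : Fin m → ℕ) (n : ℕ) : Finite (FishburnAvoiding p n) :=
  inferInstanceAs (Finite (Subtype _))

/-! ### Generating functions -/

/-- The polynomial ring `ℚ[y, z]`. -/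
abbrev Coeffs : Type := MvPolynomial (Fin 2) ℚ

/-- The ring `ℚ[y, z]⟦t⟧`. -/
abbrev Series : Type := PowerSeries Coeffs

noncomputable def varY : Coeffs := MvPolynomial.X 0

noncomputable def varZ : Coeffs := MvPolynomial.X 1

/-- `y` as a power series in `t`. -/
noncomputable def serY : Series := PowerSeries.C varY

/-- `z` as a power series in `t`. -/
noncomputable def serZ : Series := PowerSeries.C varZ

/-- `t` as a power series in `t`. -/
noncomputable def serT : Series := PowerSeries.X

/-- The generating function `∑ y ^ f(x) * z ^ g(x) * t ^ |x|` over all `x` in the union of the finite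
sets `T n`, where `|x| = n` for `x` in `T n`. -/
noncomputable def genFun (T : ℕ → Type) [∀ n, Finite (T n)] (f g : ∀ n, T n → ℕ) : Series :=
  PowerSeries.mk fun n =>
    letI := Fintype.ofFinite (T n)
    ∑ x : T n, varY ^ f n x * varZ ^ g n x

/-- The pair `(fcr, bl)` over the Stoimenow matchings that avoid the pattern `P`. -/
noncomputable def genMatching {k : ℕ} (P : Matching k) : Series :=
  genFun (StoimenowAvoiding P) (fun _ M => M.1.fcr) (fun _ M => M.1.bl)

/-- The pair `(min, ssd)` over the **(2+2, 3+1)**-free posets. -/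
noncomputable def genPosetThreePlusOne : Series :=
  genFun (PosetAvoiding ThreePlusOne) (fun _ p => p.1.minCount) (fun _ p => p.1.ssd)

/-- The pair `(min, smc)` over the **(2+2, N)**-free posets. -/
noncomputable def genPosetN : Series :=
  genFun (PosetAvoiding PosetN) (fun _ p => p.1.minCount) (fun _ p => p.1.smc)

/-- The pair `(zero, rmin)` over the ascent sequences that avoid `101`. -/
noncomputable def genAscent : Series :=
  genFun (AscentAvoiding ![1, 0, 1]) (fun _ w => zeroCount w.1) (fun _ w => rmin w.1)

/-- The pair `(idr, lmax)` over the Fishburn permutations that avoid `3142`. -/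
noncomputable def genFishburn : Series :=
  genFun (FishburnAvoiding ![3, 1, 4, 2]) (fun _ π => idr π.1) (fun _ π => lmax π.1)

/-- The generating function `C(t)` of the Catalan numbers. -/
noncomputable def catalanGF : Series :=
  PowerSeries.map (Nat.castRingHom Coeffs) PowerSeries.catalanSeries

/-- `C(x, t) = 1 / (1 - x t C(t))`. -/
noncomputable def ballotGF (x : Coeffs) : Series :=
  PowerSeries.invOfUnit (1 - PowerSeries.C x * PowerSeries.X * catalanGF) 1

theorem ballotGF_spec (x : Coeffs) :
    (1 - PowerSeries.C x * PowerSeries.X * catalanGF) * ballotGF x = 1 :=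
  PowerSeries.mul_invOfUnit _ _ (by simp)

/-- The ballot numbers `(n - k + 1) / (n + 1) * binom (n + k) k`, for `0 ≤ k ≤ n`. -/
def ballotNumber (n k : ℕ) : ℚ := ((n : ℚ) - k + 1) / (n + 1) * (n + k).choose k

/-- The power series `√(1 - 4 t)`, by the binomial series. -/
noncomputable def sqrtSeries : Series :=
  PowerSeries.rescale (-4) (PowerSeries.binomialSeries Coeffs (1 / 2 : ℚ))

theorem sqrtSeries_sq : sqrtSeries ^ 2 = 1 - 4 * PowerSeries.X := by
  rw [sqrtSeries, ← map_pow, sq, ← PowerSeries.binomialSeries_add]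
  have h : (1 / 2 + 1 / 2 : ℚ) = ((1 : ℕ) : ℚ) := by norm_num
  rw [h, PowerSeries.binomialSeries_nat]
  have h4 : (PowerSeries.C (4 : Coeffs) : Series) = 4 := map_ofNat PowerSeries.C 4
  simp [PowerSeries.rescale_X, h4]
  ring

/-- The field of fractions of `ℚ[y, z]⟦t⟧`. -/
abbrev SeriesFrac : Type := FractionRing Series

/-- The inclusion of `ℚ[y, z]⟦t⟧` into its field of fractions. -/
noncomputable def toFrac : Series →+* SeriesFrac := algebraMap Series SeriesFrac

/-- Interchange of `y` and `z`. -/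
noncomputable def swapYZ : Series →+* Series :=
  PowerSeries.map (MvPolynomial.rename (R := ℚ) (Equiv.swap (0 : Fin 2) 1)).toRingHom

end Fishburn

/-!
Matchings, posets and permutations of size `n` are encoded by functions `e` with `x < e x ≤ n` for
`x < n`: the elements above `x` in a poset without **2+2** are the `y ≥ e x`, the openers before
the closer of the `x`-th arc of a matching are the `y < e x`, and the inversions of a permutation
without `231` are the pairs `x < y < e x`. A labelling of a poset is determined up to the order of
the elements with the same strict down-set. Sorting them by decreasing up-sets turns the absence of
**3+1** into monotonicity of `e`, and sorting them by increasing up-sets turns the absence of **N**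
into the intervals `[x, e x)` being noncrossing. A Stoimenow matching is sorted in the first way, so
the matchings without the second pattern correspond to the **N**-free posets labelled in the other
order of ties. The ascent sequences without `101` are restricted growth functions.

The monotone codes, the noncrossing codes and the restricted growth functions without `101` are all
built like binary trees: a nonempty object is a unique pair `(A, B)` of smaller ones, its first
statistic is one more than that of `A`, and its second statistic is one more than that of `B`. Hence
`F(y,z) = 1 + y z t F(y,1) F(1,z)`, where `F(1,1) = C(t)` and `F(y,1) = 1 + y t F(y,1) C(t)`. Thus
`F(y,1) = C(y,t)`, and likewise `F(1,z) = C(z,t)`.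
-/

namespace Fishburn

/-! ### Catalan families and their generating functions -/

section CatalanFamily

variable {R : Type*} {T : ℕ → Type} [∀ n, Finite (T n)] {f g : ∀ n, T n → ℕ}

/-- The generating function `∑ a ^ f(x) * b ^ g(x) * t ^ |x|` of a family of finite sets with two
statistics, for weights `a` and `b` in any commutative semiring: `genFun` has the weights `y` and
`z`. -/
noncomputable def weightGF [CommSemiring R] (T : ℕ → Type) [∀ n, Finite (T n)]
    (f g : ∀ n, T n → ℕ) (a b : R) : PowerSeries R :=
  PowerSeries.mk fun n =>
    letI := Fintype.ofFinite (T n)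
    ∑ x : T n, a ^ f n x * b ^ g n x

/-- The objects of positive size are pairs of smaller objects, as for binary trees, such that `f`
and `g` count the nodes on the leftmost and on the rightmost branch. -/
structure IsCatalanPair (T : ℕ → Type) (f g : ∀ n, T n → ℕ) : Prop where
  zero : ∃ x : T 0, (∀ y, y = x) ∧ f 0 x = 0 ∧ g 0 x = 0
  succ : ∀ n, ∃ Φ : (Σ p : Finset.HasAntidiagonal.antidiagonal n, T p.1.1 × T p.1.2) → T (n + 1),
    Function.Bijective Φ ∧ ∀ q, f _ (Φ q) = f _ q.2.1 + 1 ∧ g _ (Φ q) = g _ q.2.2 + 1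

theorem IsCatalanPair.weightGF_eq [CommSemiring R] (h : IsCatalanPair T f g) (a b : R) :
    weightGF T f g a b = 1 + PowerSeries.X *
      (PowerSeries.C (a * b) * (weightGF T f g a 1 * weightGF T f g 1 b)) := by
  let _ : ∀ n, Fintype (T n) := fun n => Fintype.ofFinite (T n)
  ext1 n
  cases n with
  | zero =>
    obtain ⟨x, hx, hf, hg⟩ := h.zero
    have huniv : (Finset.univ : Finset (T 0)) = {x} := by ext y; simp [hx y]
    simp [weightGF, huniv, hf, hg]
  | succ n =>
    obtain ⟨Φ, hΦ, hstat⟩ := h.succ n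
    rw [map_add, PowerSeries.coeff_succ_X_mul, PowerSeries.coeff_C_mul, PowerSeries.coeff_mul,
      PowerSeries.coeff_one, if_neg n.succ_ne_zero, zero_add]
    simp only [weightGF, PowerSeries.coeff_mk]
    rw [← hΦ.sum_comp, Fintype.sum_sigma, Finset.mul_sum,
      ← Finset.sum_coe_sort (Finset.HasAntidiagonal.antidiagonal n)]
    refine Finset.sum_congr rfl fun p _ => ?_
    rw [Fintype.sum_prod_type, Finset.sum_mul_sum, Finset.mul_sum]
    refine Finset.sum_congr rfl fun u _ => ?_
    rw [Finset.mul_sum]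
    refine Finset.sum_congr rfl fun v _ => ?_
    rw [(hstat ⟨p, u, v⟩).1, (hstat ⟨p, u, v⟩).2]
    ring

theorem eq_of_eq_one_add_X_mul_sq [CommRing R] {F G : PowerSeries R}
    (hF : F = 1 + PowerSeries.X * F ^ 2) (hG : G = 1 + PowerSeries.X * G ^ 2) : F = G := by
  have hunit : IsUnit (1 - PowerSeries.X * (F + G)) :=
    PowerSeries.isUnit_iff_constantCoeff.2 (by simp)
  have h : (1 - PowerSeries.X * (F + G)) * (F - G) = 0 := by linear_combination hF - hG
  exact sub_eq_zero.1 (hunit.mul_right_eq_zero.1 h)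

theorem catalanGF_eq_one_add_X_mul_sq : catalanGF = 1 + PowerSeries.X * catalanGF ^ 2 := by
  have h := congrArg (PowerSeries.map (Nat.castRingHom Coeffs))
    PowerSeries.catalanSeries_sq_mul_X_add_one
  simp only [map_add, map_mul, map_pow, PowerSeries.map_X, map_one] at h
  rw [catalanGF]
  linear_combination -h

theorem eq_ballotGF {x : Coeffs} {F : Series}
    (hF : F = 1 + PowerSeries.X * (PowerSeries.C x * (F * catalanGF))) : F = ballotGF x := by
  linear_combination ballotGF x * hF - F * ballotGF_spec x

theorem IsCatalanPair.genFun_eq (h : IsCatalanPair T f g) :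
    genFun T f g = 1 + serY * serZ * serT * ballotGF varY * ballotGF varZ := by
  have hcatalan : weightGF T f g 1 1 = catalanGF := by
    refine eq_of_eq_one_add_X_mul_sq ?_ catalanGF_eq_one_add_X_mul_sq
    conv_lhs => rw [h.weightGF_eq]
    simp [sq]
  have hleft : weightGF T f g varY 1 = ballotGF varY := by
    refine eq_ballotGF ?_
    conv_lhs => rw [h.weightGF_eq, hcatalan]
    simp
  have hright : weightGF T f g 1 varZ = ballotGF varZ := by
    refine eq_ballotGF ?_
    conv_lhs => rw [h.weightGF_eq, hcatalan]
    simp [mul_comm]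
  change weightGF T f g varY varZ = _
  rw [h.weightGF_eq, hleft, hright, serY, serZ, serT, map_mul]
  ring

theorem genFun_congr {S : ℕ → Type} [∀ n, Finite (S n)] {f' g' : ∀ n, S n → ℕ}
    (φ : ∀ n, T n → S n) (hφ : ∀ n, Function.Bijective (φ n))
    (hf : ∀ n x, f' n (φ n x) = f n x) (hg : ∀ n x, g' n (φ n x) = g n x) :
    genFun T f g = genFun S f' g' := by
  ext1 n
  let _ := Fintype.ofFinite (T n)
  let _ := Fintype.ofFinite (S n)
  simp only [genFun, PowerSeries.coeff_mk]
  rw [← (hφ n).sum_comp]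
  exact Finset.sum_congr rfl fun x _ => by rw [hf, hg]

end CatalanFamily

/-! ### The closed forms -/

theorem constantCoeff_sqrtSeries : PowerSeries.constantCoeff sqrtSeries = 1 := by
  rw [sqrtSeries, ← PowerSeries.coeff_zero_eq_constantCoeff_apply, PowerSeries.coeff_rescale]
  simp [PowerSeries.binomialSeries_coeff]

theorem sqrtSeries_eq : sqrtSeries = 1 - 2 * (PowerSeries.X * catalanGF) := by
  have hsq : sqrtSeries ^ 2 = (1 - 2 * (PowerSeries.X * catalanGF)) ^ 2 := by
    linear_combination sqrtSeries_sq + 4 * PowerSeries.X * catalanGF_eq_one_add_X_mul_sq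
  refine (sq_eq_sq_iff_eq_or_eq_neg.1 hsq).resolve_right fun hneg => ?_
  have h := congrArg PowerSeries.constantCoeff hneg
  simp only [constantCoeff_sqrtSeries, map_neg, map_sub, map_one, map_mul,
    PowerSeries.constantCoeff_X, zero_mul, mul_zero, sub_zero] at h
  norm_num at h

theorem toFrac_injective : Function.Injective toFrac :=
  IsFractionRing.injective Series SeriesFrac

theorem denominator_eq (x : Coeffs) :
    2 * toFrac serT - toFrac (PowerSeries.C x) * toFrac serT * (1 - toFrac sqrtSeries) =
      2 * toFrac serT * toFrac (1 - PowerSeries.C x * PowerSeries.X * catalanGF) := by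
  have h : 2 * serT - PowerSeries.C x * serT * (1 - sqrtSeries) =
      2 * serT * (1 - PowerSeries.C x * PowerSeries.X * catalanGF) := by
    rw [sqrtSeries_eq, serT]
    ring
  simpa only [map_sub, map_mul, map_one, map_ofNat] using congrArg toFrac h

theorem toFrac_mul_toFrac_ballotGF (x : Coeffs) :
    toFrac (1 - PowerSeries.C x * PowerSeries.X * catalanGF) * toFrac (ballotGF x) = 1 := by
  rw [← map_mul, ballotGF_spec, map_one]

theorem denominator_ne_zero (x : Coeffs) :
    2 * toFrac serT - toFrac (PowerSeries.C x) * toFrac serT * (1 - toFrac sqrtSeries) ≠ 0 := by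
  have h2 : (2 : SeriesFrac) ≠ 0 := by
    rw [← map_ofNat toFrac 2, map_ne_zero_iff _ toFrac_injective]
    exact fun h => two_ne_zero ((map_ofNat _ 2).symm.trans (congrArg PowerSeries.constantCoeff h))
  have ht : toFrac serT ≠ 0 :=
    (map_ne_zero_iff _ toFrac_injective).2 PowerSeries.X_ne_zero
  rw [denominator_eq]
  exact mul_ne_zero (mul_ne_zero h2 ht)
    (left_ne_zero_of_mul_eq_one (toFrac_mul_toFrac_ballotGF x))

theorem toFrac_ballotGF_product_eq_div :
    let y := toFrac serY
    let z := toFrac serZ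
    let t := toFrac serT
    let s := toFrac sqrtSeries
    (2 * t - y * t * (1 - s)) * (2 * t - z * t * (1 - s)) ≠ 0 ∧
      toFrac (1 + serY * serZ * serT * ballotGF varY * ballotGF varZ) =
        1 + (4 * t ^ 2 * y * z * t) / ((2 * t - y * t * (1 - s)) * (2 * t - z * t * (1 - s))) := by
  intro y z t s
  have hne : (2 * t - y * t * (1 - s)) * (2 * t - z * t * (1 - s)) ≠ 0 :=
    mul_ne_zero (denominator_ne_zero varY) (denominator_ne_zero varZ)
  refine ⟨hne, ?_⟩
  have hy := denominator_eq varY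
  have hz := denominator_eq varZ
  change 2 * t - y * t * (1 - s) = _ at hy
  change 2 * t - z * t * (1 - s) = _ at hz
  rw [map_add, map_one, add_right_inj, eq_div_iff hne, hy, hz]
  simp only [map_mul]
  linear_combination (4 * t ^ 3 * y * z) *
    (toFrac (1 - PowerSeries.C varZ * PowerSeries.X * catalanGF) * toFrac (ballotGF varZ) *
      toFrac_mul_toFrac_ballotGF varY + toFrac_mul_toFrac_ballotGF varZ)

theorem swapYZ_C (x : Coeffs) :
    swapYZ (PowerSeries.C x) = PowerSeries.C (MvPolynomial.rename (Equiv.swap 0 1) x) := by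
  simp [swapYZ]

theorem swapYZ_X : swapYZ PowerSeries.X = PowerSeries.X := by
  simp [swapYZ]

theorem swapYZ_catalanGF : swapYZ catalanGF = catalanGF := by
  refine eq_of_eq_one_add_X_mul_sq ?_ catalanGF_eq_one_add_X_mul_sq
  conv_lhs => rw [catalanGF_eq_one_add_X_mul_sq]
  simp only [map_add, map_one, map_mul, map_pow, swapYZ_X]

theorem swapYZ_ballotGF (x : Coeffs) :
    swapYZ (ballotGF x) = ballotGF (MvPolynomial.rename (Equiv.swap 0 1) x) := by
  have h := congrArg swapYZ (ballotGF_spec x)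
  simp only [map_mul, map_sub, map_one, swapYZ_catalanGF, swapYZ_C, swapYZ_X] at h
  exact eq_ballotGF (by linear_combination h)

theorem swapYZ_ballotGF_product :
    swapYZ (1 + serY * serZ * serT * ballotGF varY * ballotGF varZ) =
      1 + serY * serZ * serT * ballotGF varY * ballotGF varZ := by
  simp only [map_add, map_mul, map_one, swapYZ_ballotGF, serY, serZ, serT, varY, varZ, swapYZ_C,
    swapYZ_X, MvPolynomial.rename_X, Equiv.swap_apply_left, Equiv.swap_apply_right]
  ring

/-! ### Ballot numbers -/

theorem ballotNumber_zero (n : ℕ) : ballotNumber n 0 = 1 := by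
  have : (n : ℚ) + 1 ≠ 0 := by positivity
  simp [ballotNumber, this]

theorem ballotNumber_succ_right (n : ℕ) : ballotNumber n (n + 1) = 0 := by
  simp [ballotNumber]

theorem ballotNumber_succ_succ (n k : ℕ) :
    ballotNumber (n + 1) (k + 1) = ballotNumber (n + 1) k + ballotNumber n (k + 1) := by
  have hpascal : ((n + 1 + (k + 1)).choose (k + 1) : ℚ) =
      (n + k + 1).choose k + (n + k + 1).choose (k + 1) := by
    rw [show n + 1 + (k + 1) = (n + k + 1) + 1 by ring, Nat.choose_succ_succ, Nat.cast_add]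
  have hratio : ((n + k + 1).choose (k + 1) : ℚ) * (k + 1) = (n + k + 1).choose k * (n + 1) := by
    have := Nat.choose_succ_right_eq (n + k + 1) k
    rw [show n + k + 1 - k = n + 1 by omega] at this
    exact_mod_cast this
  have hn : (n : ℚ) + 1 ≠ 0 := by positivity
  have hn' : (n : ℚ) + 1 + 1 ≠ 0 := by positivity
  simp only [ballotNumber]
  rw [hpascal, show n + 1 + k = n + k + 1 by ring, show n + (k + 1) = n + k + 1 by ring]
  push_cast
  field_simp
  linear_combination hratio

theorem ballotNumber_self (n : ℕ) : ballotNumber n n = catalan n := by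
  have hn : (n : ℚ) + 1 ≠ 0 := by positivity
  have h : ((n : ℚ) + 1) * catalan n = (n + n).choose n := by
    rw [← two_mul]
    exact_mod_cast succ_mul_catalan_eq_centralBinom n
  rw [ballotNumber, ← h]
  field_simp
  ring

/-- The polynomial `∑ T(n, k) * x ^ (n - k)` in the `n`-th row of ballot numbers. -/
noncomputable def ballotPoly (x : Coeffs) (n : ℕ) : Coeffs :=
  ∑ k ∈ Finset.range (n + 1), MvPolynomial.C (ballotNumber n k) * x ^ (n - k)

theorem sum_mul_pow_succ_sub {R : Type*} [CommSemiring R] (u : ℕ → R) (x : R) (n : ℕ) :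
    ∑ k ∈ Finset.range (n + 1), u k * x ^ (n + 1 - k) =
      x * ∑ k ∈ Finset.range (n + 1), u k * x ^ (n - k) := by
  rw [Finset.mul_sum]
  refine Finset.sum_congr rfl fun k hk => ?_
  rw [Nat.succ_sub (Nat.lt_succ_iff.1 (Finset.mem_range.1 hk)), pow_succ]
  ring

theorem ballotPoly_succ (x : Coeffs) (n : ℕ) :
    (1 - x) * ballotPoly x (n + 1) + x ^ 2 * ballotPoly x n = catalan (n + 1) := by
  have hlast : ballotPoly x (n + 1) =
      (∑ k ∈ Finset.range (n + 1), MvPolynomial.C (ballotNumber (n + 1) k) * x ^ (n + 1 - k)) +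
        catalan (n + 1) := by
    rw [ballotPoly, Finset.sum_range_succ, ballotNumber_self]
    simp
  rw [sum_mul_pow_succ_sub] at hlast
  have hfirst : ballotPoly x (n + 1) = x ^ (n + 1) +
      (∑ k ∈ Finset.range (n + 1), MvPolynomial.C (ballotNumber (n + 1) k) * x ^ (n - k)) +
      ∑ k ∈ Finset.range (n + 1), MvPolynomial.C (ballotNumber n (k + 1)) * x ^ (n - k) := by
    rw [ballotPoly, Finset.sum_range_succ', ballotNumber_zero]
    simp only [ballotNumber_succ_succ, map_add, add_mul, Finset.sum_add_distrib,
      Nat.add_sub_add_right, map_one, one_mul, Nat.sub_zero]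
    ring
  have hrow : x * ballotPoly x n = x ^ (n + 1) +
      ∑ k ∈ Finset.range (n + 1), MvPolynomial.C (ballotNumber n (k + 1)) * x ^ (n - k) := by
    have h := Finset.sum_range_succ'
      (fun k => MvPolynomial.C (ballotNumber n k) * x ^ (n + 1 - k)) (n + 1)
    rw [Finset.sum_range_succ, ballotNumber_succ_right, ballotNumber_zero] at h
    simp only [Nat.add_sub_add_right, map_zero, zero_mul, add_zero, map_one, one_mul,
      Nat.sub_zero] at h
    rw [ballotPoly, ← sum_mul_pow_succ_sub, h, add_comm]
  linear_combination hlast - x * hfirst + x * hrow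

theorem one_sub_C_add_C_sq_mul_X_ne_zero {R : Type*} [CommRing R] [Nontrivial R] (x : R) :
    (1 - PowerSeries.C x + PowerSeries.C (x ^ 2) * PowerSeries.X : PowerSeries R) ≠ 0 := by
  intro h
  have h0 : 1 - x = 0 := by simpa using congrArg (PowerSeries.coeff 0) h
  have h1 : x ^ 2 = 0 := by
    simpa [PowerSeries.coeff_one, PowerSeries.coeff_C] using congrArg (PowerSeries.coeff 1) h
  rw [← sub_eq_zero.1 h0, one_pow] at h1
  exact one_ne_zero h1

theorem coeff_catalanGF (n : ℕ) : PowerSeries.coeff n catalanGF = catalan n := by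
  rw [catalanGF, PowerSeries.coeff_map, PowerSeries.catalanSeries_coeff]
  rfl

theorem mk_ballotPoly_kernel (x : Coeffs) :
    (1 - PowerSeries.C x + PowerSeries.C (x ^ 2) * PowerSeries.X) * PowerSeries.mk (ballotPoly x) =
      catalanGF - PowerSeries.C x := by
  have h : PowerSeries.C (1 - x) * PowerSeries.mk (ballotPoly x) +
      PowerSeries.X * (PowerSeries.C (x ^ 2) * PowerSeries.mk (ballotPoly x)) =
      catalanGF - PowerSeries.C x := by
    ext1 n
    cases n with
    | zero =>
      rw [map_add, PowerSeries.coeff_C_mul, map_sub, PowerSeries.coeff_zero_X_mul,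
        PowerSeries.coeff_mk, PowerSeries.coeff_zero_C, coeff_catalanGF]
      simp [ballotPoly, ballotNumber_zero]
    | succ n =>
      rw [map_add, PowerSeries.coeff_C_mul, map_sub, PowerSeries.coeff_succ_X_mul,
        PowerSeries.coeff_C_mul, PowerSeries.coeff_mk, PowerSeries.coeff_mk, ballotPoly_succ,
        coeff_catalanGF, PowerSeries.coeff_succ_C, sub_zero]
  rw [← h, map_sub, map_one]
  ring

theorem ballotGF_eq (x : Coeffs) :
    ballotGF x = 1 + serT * PowerSeries.mk fun n =>
      ∑ k ∈ Finset.range (n + 1), MvPolynomial.C (ballotNumber n k) * x ^ (n + 1 - k) := by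
  have hmk : (PowerSeries.mk fun n =>
      ∑ k ∈ Finset.range (n + 1), MvPolynomial.C (ballotNumber n k) * x ^ (n + 1 - k)) =
      PowerSeries.C x * PowerSeries.mk (ballotPoly x) := by
    ext1 n
    rw [PowerSeries.coeff_C_mul, PowerSeries.coeff_mk, PowerSeries.coeff_mk, ballotPoly,
      sum_mul_pow_succ_sub]
  rw [hmk, serT]
  refine mul_left_cancel₀ (one_sub_C_add_C_sq_mul_X_ne_zero x) ?_
  have hpoly := mk_ballotPoly_kernel x
  rw [map_pow] at hpoly ⊢
  linear_combination
    (1 - PowerSeries.C x + PowerSeries.C x * PowerSeries.X * catalanGF) * ballotGF_spec x -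
    PowerSeries.C x ^ 2 * PowerSeries.X * ballotGF x * catalanGF_eq_one_add_X_mul_sq -
    PowerSeries.X * PowerSeries.C x * hpoly

/-! ### Codes and their decompositions -/

/-- A sequence of length `n`, extended by zero to all of `ℕ`, with `x < e x ≤ n` for all `x < n`.
The point `x` stands for the interval `[x, e x)`. -/
def IsCode (n : ℕ) (e : ℕ → ℕ) : Prop :=
  (∀ x < n, x < e x ∧ e x ≤ n) ∧ ∀ x, n ≤ x → e x = 0

/-- The monotone codes, a form of the Dyck paths. -/
def IsMonotoneCode (n : ℕ) (e : ℕ → ℕ) : Prop :=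
  IsCode n e ∧ ∀ x y, x < y → y < n → e x ≤ e y

/-- The codes such that no two of the intervals `[x, e x)` cross: they encode the ordered forests,
where `e x` is the end of the subtree with root `x` in preorder. -/
def IsNoncrossingCode (n : ℕ) (e : ℕ → ℕ) : Prop :=
  IsCode n e ∧ ∀ x y, x < y → y < e x → e y ≤ e x

/-- The restricted growth functions of length `n` that avoid `101`, extended by zero to `ℕ`. -/
def IsRGFAvoiding101 (n : ℕ) (α : ℕ → ℕ) : Prop :=
  (∀ x < n, ∀ v < α x, ∃ y < x, α y = v) ∧
    (∀ x y z, x < y → y < z → z < n → α x = α z → α x ≤ α y) ∧ ∀ x, n ≤ x → α x = 0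

/-- The number of points below all values of a code, which becomes the number of minimal elements
of a poset. -/
def bottomCount (n : ℕ) (e : ℕ → ℕ) : ℕ :=
  ((Finset.range n).filter fun y => ∀ x < n, y < e x).card

/-- The number of points `i` that no interval `[y, e y)` with `y < i` of a code contains. -/
def cutCount (n : ℕ) (e : ℕ → ℕ) : ℕ :=
  ((Finset.range n).filter fun i => ∀ y < i, e y ≤ i).card

/-- The number of zeros among the first `n` terms, the counterpart of `zeroCount`. -/
def zeroNumber (n : ℕ) (α : ℕ → ℕ) : ℕ := ((Finset.range n).filter fun x => α x = 0).card

/-- The number of right-to-left minima among the first `n` terms, the counterpart of `rmin`. -/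
def rminNumber (n : ℕ) (α : ℕ → ℕ) : ℕ :=
  ((Finset.range n).filter fun x => ∀ y < n, x < y → α x < α y).card

section Glue

variable {P : ℕ → (ℕ → ℕ) → Prop}

theorem isCatalanPair_of_glue [∀ n, Finite {e // P n e}] {f g : ℕ → (ℕ → ℕ) → ℕ}
    (glue : ℕ → ℕ → (ℕ → ℕ) → (ℕ → ℕ) → ℕ → ℕ)
    (hzero : ∀ e, P 0 e ↔ e = 0) (hf_zero : f 0 0 = 0) (hg_zero : g 0 0 = 0)
    (hglue : ∀ k m A B, P k A → P m B → P (k + m + 1) (glue k m A B))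
    (hf : ∀ k m A B, P k A → P m B → f (k + m + 1) (glue k m A B) = f k A + 1)
    (hg : ∀ k m A B, P k A → P m B → g (k + m + 1) (glue k m A B) = g m B + 1)
    (hsize : ∀ k m A B k' m' A' B', P k A → P m B → P k' A' → P m' B' → k + m = k' + m' →
      glue k m A B = glue k' m' A' B' → k = k')
    (hinj : ∀ k m A B A' B', P k A → P m B → P k A' → P m B' →
      glue k m A B = glue k m A' B' → A = A' ∧ B = B')
    (hsurj : ∀ n e, P (n + 1) e → ∃ k m A B, k + m = n ∧ P k A ∧ P m B ∧ glue k m A B = e) :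
    IsCatalanPair (fun n => {e // P n e}) (fun n e => f n e.1) (fun n e => g n e.1) where
  zero := ⟨⟨0, (hzero 0).2 rfl⟩, fun y => Subtype.ext ((hzero _).1 y.2), hf_zero, hg_zero⟩
  succ n := by
    have hn : ∀ p : Finset.HasAntidiagonal.antidiagonal n, p.1.1 + p.1.2 = n := fun p =>
      Finset.HasAntidiagonal.mem_antidiagonal.1 p.2
    refine ⟨fun q => ⟨glue q.1.1.1 q.1.1.2 q.2.1.1 q.2.2.1, ?_⟩, ⟨?_, ?_⟩, fun q => ⟨?_, ?_⟩⟩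
    · simpa only [hn] using hglue _ _ _ _ q.2.1.2 q.2.2.2
    · rintro ⟨p, ⟨A, hA⟩, ⟨B, hB⟩⟩ ⟨p', ⟨A', hA'⟩, ⟨B', hB'⟩⟩ h
      have hfst : p.1.1 = p'.1.1 := hsize _ _ _ _ _ _ _ _ hA hB hA' hB'
        ((hn p).trans (hn p').symm) (congrArg Subtype.val h)
      obtain rfl : p = p' :=
        Subtype.ext ((Finset.HasAntidiagonal.antidiagonal_congr p.2 p'.2).2 hfst)
      obtain ⟨rfl, rfl⟩ := hinj _ _ _ _ _ _ hA hB hA' hB' (congrArg Subtype.val h)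
      rfl
    · rintro ⟨e, he⟩
      obtain ⟨k, m, A, B, hkm, hA, hB, rfl⟩ := hsurj n e he
      exact ⟨⟨⟨(k, m), Finset.HasAntidiagonal.mem_antidiagonal.2 hkm⟩, ⟨A, hA⟩, ⟨B, hB⟩⟩, rfl⟩
    · simpa only [hn] using hf _ _ _ _ q.2.1.2 q.2.2.2
    · simpa only [hn] using hg _ _ _ _ q.2.1.2 q.2.2.2

end Glue

theorem finite_subtype_of_bounded (n : ℕ) {P : (ℕ → ℕ) → Prop}
    (h : ∀ e, P e → (∀ x < n, e x ≤ n) ∧ ∀ x, n ≤ x → e x = 0) : Finite {e // P e} := by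
  refine Finite.of_injective (fun (e : {e // P e}) (x : Fin n) =>
    (⟨e.1 x, Nat.lt_succ_of_le ((h _ e.2).1 x x.2)⟩ : Fin (n + 1))) ?_
  intro e e' he
  ext x
  by_cases hx : x < n
  · exact congrArg Fin.val (congrFun he ⟨x, hx⟩)
  · rw [(h _ e.2).2 x (not_lt.1 hx), (h _ e'.2).2 x (not_lt.1 hx)]

theorem card_eq_card_add_one {s t : Finset ℕ} {a b : ℕ} (ha : a < b)
    (h : ∀ x, x ∈ s ↔ x = a ∨ ∃ y ∈ t, y + b = x) : s.card = t.card + 1 := by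
  have hs : s = insert a (t.image (· + b)) := by
    ext x; simp [h]
  rw [hs, Finset.card_insert_of_notMem, Finset.card_image_of_injective _ (add_left_injective b)]
  simp only [Finset.mem_image, not_exists, not_and]
  omega

section ShiftAppend

variable {k m c : ℕ} {u u' B B' e : ℕ → ℕ}

/-- The sequence `u 0, …, u k, B 0 + c, …, B (m - 1) + c`, extended by zero. In all three
decompositions the right part is attached to the rest in this way. -/
def shiftAppend (k m c : ℕ) (u B : ℕ → ℕ) (i : ℕ) : ℕ :=
  if i ≤ k then u i else if i ≤ k + m then B (i - (k + 1)) + c else 0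

/-- The right part `B` of a sequence `e` of the form `shiftAppend k m c u B`. -/
def shiftDrop (k m c : ℕ) (e : ℕ → ℕ) (i : ℕ) : ℕ := if i < m then e (i + (k + 1)) - c else 0

theorem shiftAppend_of_le {i : ℕ} (hi : i ≤ k) : shiftAppend k m c u B i = u i := if_pos hi

theorem shiftAppend_add {i : ℕ} (hi : i < m) : shiftAppend k m c u B (i + (k + 1)) = B i + c := by
  rw [shiftAppend, if_neg (by omega), if_pos (by omega), Nat.add_sub_cancel]

theorem shiftAppend_of_lt {i : ℕ} (hi : k + m < i) : shiftAppend k m c u B i = 0 := by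
  rw [shiftAppend, if_neg (by omega), if_neg (by omega)]

theorem shiftAppend_right_inj (hB : ∀ x, m ≤ x → B x = 0) (hB' : ∀ x, m ≤ x → B' x = 0)
    (h : shiftAppend k m c u B = shiftAppend k m c u' B') : B = B' := by
  funext x
  rcases lt_or_ge x m with hx | hx
  · have := congrFun h (x + (k + 1))
    rw [shiftAppend_add hx, shiftAppend_add hx] at this
    exact Nat.add_right_cancel this
  · rw [hB x hx, hB' x hx]

theorem shiftAppend_shiftDrop (hhead : ∀ i ≤ k, u i = e i)
    (htail : ∀ i, k < i → i ≤ k + m → c ≤ e i) (hzero : ∀ i, k + m < i → e i = 0) :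
    shiftAppend k m c u (shiftDrop k m c e) = e := by
  funext i
  rcases le_or_gt i k with hi | hi
  · rw [shiftAppend_of_le hi, hhead i hi]
  rcases le_or_gt i (k + m) with him | him
  · obtain ⟨j, rfl⟩ : ∃ j, i = j + (k + 1) := ⟨i - (k + 1), by omega⟩
    have hj : j < m := by omega
    rw [shiftAppend_add hj, shiftDrop, if_pos hj, Nat.sub_add_cancel (htail _ hi him)]
  · rw [shiftAppend_of_lt him, hzero i him]

theorem IsCode.shiftAppend (hu : ∀ i ≤ k, i < u i ∧ u i ≤ k + 1) (hB : IsCode m B) :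
    IsCode (k + m + 1) (shiftAppend k m (k + 1) u B) := by
  refine ⟨fun x hx => ?_, fun x hx => shiftAppend_of_lt hx⟩
  rcases le_or_gt x k with hxk | hxk
  · have := hu x hxk
    rw [shiftAppend_of_le hxk]
    omega
  · obtain ⟨y, rfl⟩ : ∃ y, x = y + (k + 1) := ⟨x - (k + 1), by omega⟩
    have hy : y < m := by omega
    have := hB.1 y hy
    rw [shiftAppend_add hy]
    omega

theorem IsCode.shiftDrop (he : IsCode (k + m + 1) e) : IsCode m (shiftDrop k m (k + 1) e) := by
  refine ⟨fun x hx => ?_, fun x hx => if_neg hx.not_gt⟩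
  have := he.1 (x + (k + 1)) (by omega)
  rw [Fishburn.shiftDrop, if_pos hx]
  omega

theorem cutCount_shiftAppend (hu : ∀ i ≤ k, u i ≤ k + 1)
    (hcover : ∀ x, 0 < x → x ≤ k → ∃ y < x, x < u y) :
    cutCount (k + m + 1) (shiftAppend k m (k + 1) u B) = cutCount m B + 1 := by
  refine card_eq_card_add_one (a := 0) (b := k + 1) k.succ_pos fun x => ?_
  simp only [Finset.mem_filter, Finset.mem_range]
  constructor
  · rintro ⟨hx, hcut⟩
    refine or_iff_not_imp_left.2 fun hx0 => ?_
    have hkx : k < x := by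
      by_contra! hxk
      obtain ⟨y, hy, hxy⟩ := hcover x (Nat.pos_of_ne_zero hx0) hxk
      have := hcut y hy
      rw [shiftAppend_of_le (by omega)] at this
      omega
    refine ⟨x - (k + 1), ⟨by omega, fun y hy => ?_⟩, by omega⟩
    have := hcut (y + (k + 1)) (by omega)
    rw [shiftAppend_add (by omega)] at this
    omega
  · rintro (rfl | ⟨z, ⟨hz, hcut⟩, rfl⟩)
    · exact ⟨by omega, fun y hy => absurd hy y.not_lt_zero⟩
    refine ⟨by omega, fun y hy => ?_⟩
    rcases le_or_gt y k with hyk | hyk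
    · rw [shiftAppend_of_le hyk]
      exact (hu y hyk).trans (by omega)
    · obtain ⟨w, rfl⟩ : ∃ w, y = w + (k + 1) := ⟨y - (k + 1), by omega⟩
      rw [shiftAppend_add (by omega)]
      exact Nat.add_le_add_right (hcut w (by omega)) _

end ShiftAppend

theorem isCode_zero_iff {e : ℕ → ℕ} : IsCode 0 e ↔ e = 0 :=
  ⟨fun h => funext fun x => h.2 x x.zero_le, by rintro rfl; simp [IsCode]⟩

theorem IsCode.apply_le {n x : ℕ} {e : ℕ → ℕ} (he : IsCode n e) : e x ≤ n := by
  rcases lt_or_ge x n with hx | hx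
  · exact (he.1 x hx).2
  · rw [he.2 x hx]
    exact n.zero_le

/-! ### Monotone codes -/

namespace IsMonotoneCode

variable {n k m : ℕ} {e A B A' B' : ℕ → ℕ}

instance finite (n : ℕ) : Finite {e // IsMonotoneCode n e} :=
  finite_subtype_of_bounded n fun _ h => ⟨fun _ _ => h.1.apply_le, h.1.2⟩

theorem zero_iff : IsMonotoneCode 0 e ↔ e = 0 := by
  refine ⟨fun h => isCode_zero_iff.1 h.1, fun h => ⟨isCode_zero_iff.2 h, ?_⟩⟩
  exact fun x y _ hy => absurd hy y.not_lt_zero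

theorem bottomCount_eq (he : IsMonotoneCode n e) : bottomCount n e = e 0 := by
  rcases n.eq_zero_or_pos with rfl | hn
  · simp [bottomCount, he.1.2 0 le_rfl]
  suffices h : ((Finset.range n).filter fun y => ∀ x < n, y < e x) = Finset.range (e 0) by
    rw [bottomCount, h, Finset.card_range]
  ext y
  simp only [Finset.mem_filter, Finset.mem_range]
  refine ⟨fun h => h.2 0 hn, fun hy => ⟨hy.trans_le he.1.apply_le, fun x hx => ?_⟩⟩
  rcases x.eq_zero_or_pos with rfl | hx0
  · exact hy
  · exact hy.trans_le (he.2 0 x hx0 hx)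

/-- The first `k + 1` terms of the code glued from `A` and another part: as a Dyck path, `A` raised
by one, with a step up before it and a step down after it. -/
def head (k : ℕ) (A : ℕ → ℕ) (i : ℕ) : ℕ := if i < k then A i + 1 else k + 1

/-- The Dyck path that first returns to the axis after `A` raised by one, and continues with
`B`. -/
def glue (k m : ℕ) (A B : ℕ → ℕ) : ℕ → ℕ := shiftAppend k m (k + 1) (head k A) B

theorem lt_head_and_head_le (hA : IsCode k A) {i : ℕ} (hi : i ≤ k) :
    i < head k A i ∧ head k A i ≤ k + 1 := by
  have := hA.1 i
  rw [head]
  split_ifs <;> omega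

theorem glue_mem (hA : IsMonotoneCode k A) (hB : IsMonotoneCode m B) :
    IsMonotoneCode (k + m + 1) (glue k m A B) := by
  refine ⟨IsCode.shiftAppend (fun i => lt_head_and_head_le hA.1) hB.1, fun x y hxy hy => ?_⟩
  have hhead : x ≤ k → head k A x ≤ k + 1 := fun hx => (lt_head_and_head_le hA.1 hx).2
  have hleft : y ≤ k → head k A x ≤ head k A y := by
    have := hA.2 x y hxy
    have := hA.1.1 x
    simp only [head]
    split_ifs <;> omega
  have hright := hB.2 (x - (k + 1)) (y - (k + 1))
  simp only [glue, shiftAppend]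
  split_ifs <;> omega

theorem bottomCount_glue (hA : IsMonotoneCode k A) (hB : IsMonotoneCode m B) :
    bottomCount (k + m + 1) (glue k m A B) = bottomCount k A + 1 := by
  rw [(glue_mem hA hB).bottomCount_eq, hA.bottomCount_eq, glue, shiftAppend_of_le k.zero_le, head]
  have := hA.1.2 0
  split_ifs <;> omega

theorem cutCount_glue (hA : IsMonotoneCode k A) :
    cutCount (k + m + 1) (glue k m A B) = cutCount m B + 1 := by
  refine cutCount_shiftAppend (fun i hi => (lt_head_and_head_le hA.1 hi).2) fun x hx hxk => ?_
  have := hA.1.1 (x - 1) (by omega)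
  refine ⟨x - 1, by omega, ?_⟩
  rw [head, if_pos (by omega)]
  omega

theorem eq_of_glue_eq_glue {k' m' : ℕ} (hA : IsCode k A) (hA' : IsCode k' A')
    (hkm : k + m = k' + m') (h : glue k m A B = glue k' m' A' B') : k = k' := by
  have hfirst : ∀ {k m k' m' A B A' B'}, IsCode k' A' → k + m = k' + m' →
      glue k m A B = glue k' m' A' B' → ¬ k < k' := by
    intro k m k' m' A B A' B' hA' hkm h hlt
    have h := congrFun h k
    rw [glue, glue, shiftAppend_of_le le_rfl, shiftAppend_of_le hlt.le, head, head,
      if_neg (lt_irrefl k), if_pos hlt] at h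
    have := hA'.1 k hlt
    omega
  exact le_antisymm (not_lt.1 (hfirst hA hkm.symm h.symm)) (not_lt.1 (hfirst hA' hkm h))

theorem glue_inj (hA : IsCode k A) (hB : IsCode m B) (hA' : IsCode k A') (hB' : IsCode m B')
    (h : glue k m A B = glue k m A' B') : A = A' ∧ B = B' := by
  refine ⟨funext fun x => ?_, shiftAppend_right_inj hB.2 hB'.2 h⟩
  rcases lt_or_ge x k with hx | hx
  · have := congrFun h x
    rw [glue, glue, shiftAppend_of_le hx.le, shiftAppend_of_le hx.le, head, head, if_pos hx,
      if_pos hx] at this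
    exact Nat.add_right_cancel this
  · rw [hA.2 x hx, hA'.2 x hx]

theorem exists_eq_glue (he : IsMonotoneCode (n + 1) e) : ∃ k m A B,
    k + m = n ∧ IsMonotoneCode k A ∧ IsMonotoneCode m B ∧ glue k m A B = e := by
  obtain ⟨k, hkn, hk, hfirst⟩ : ∃ k ≤ n, e k = k + 1 ∧ ∀ x < k, e x ≠ x + 1 := by
    have hreturn : ∃ k, k ≤ n ∧ e k = k + 1 := ⟨n, le_rfl, by have := he.1.1 n; omega⟩
    classical
    exact ⟨Nat.find hreturn, (Nat.find_spec hreturn).1, (Nat.find_spec hreturn).2,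
      fun x hx h => Nat.find_min hreturn hx ⟨hx.le.trans (Nat.find_spec hreturn).1, h⟩⟩
  obtain ⟨m, rfl⟩ := Nat.exists_eq_add_of_le hkn
  refine ⟨k, m, fun i => if i < k then e i - 1 else 0, shiftDrop k m (k + 1) e, rfl,
    ⟨⟨fun x hx => ?_, fun x hx => if_neg hx.not_gt⟩, fun x y hxy hy => ?_⟩,
    ⟨IsCode.shiftDrop he.1, fun x y hxy hy => ?_⟩,
    shiftAppend_shiftDrop (fun i hi => ?_) (fun i hi him => ?_) fun i hi => he.1.2 i hi⟩
  · have := he.1.1 x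
    have := hfirst x hx
    have := he.2 x k hx
    simp only [if_pos hx]
    omega
  · have := he.2 x y hxy
    simp only [if_pos hy, if_pos (hxy.trans hy)]
    omega
  · have := he.2 (x + (k + 1)) (y + (k + 1))
    rw [shiftDrop, shiftDrop, if_pos hy, if_pos (hxy.trans hy)]
    omega
  · rcases hi.lt_or_eq with hi | rfl
    · have := he.1.1 i
      simp only [head, if_pos hi]
      omega
    · rw [head, if_neg (lt_irrefl i), hk]
  · have := he.1.1 i
    omega

theorem isCatalanPair :
    IsCatalanPair (fun n => {e // IsMonotoneCode n e}) (fun n e => bottomCount n e.1)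
      (fun n e => cutCount n e.1) :=
  isCatalanPair_of_glue glue (fun _ => zero_iff) rfl rfl (fun _ _ _ _ => glue_mem)
    (fun _ _ _ _ => bottomCount_glue) (fun _ _ _ _ hA _ => cutCount_glue hA)
    (fun _ _ _ _ _ _ _ _ hA _ hA' _ => eq_of_glue_eq_glue hA.1 hA'.1)
    (fun _ _ _ _ _ _ hA hB hA' hB' => glue_inj hA.1 hB.1 hA'.1 hB'.1) fun _ _ => exists_eq_glue

end IsMonotoneCode

/-! ### Noncrossing codes -/

namespace IsNoncrossingCode

variable {n k m : ℕ} {e A B A' B' : ℕ → ℕ}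

instance finite (n : ℕ) : Finite {e // IsNoncrossingCode n e} :=
  finite_subtype_of_bounded n fun _ h => ⟨fun _ _ => h.1.apply_le, h.1.2⟩

theorem zero_iff : IsNoncrossingCode 0 e ↔ e = 0 := by
  refine ⟨fun h => isCode_zero_iff.1 h.1, ?_⟩
  rintro rfl
  exact ⟨isCode_zero_iff.2 rfl, fun x y _ hy => absurd hy y.not_lt_zero⟩

/-- The first `k + 1` terms of the code glued from `A` and another part: the tree obtained by adding
a root to the forest `A`. -/
def head (k : ℕ) (A : ℕ → ℕ) (i : ℕ) : ℕ := if i = 0 then k + 1 else A (i - 1) + 1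

/-- The forest whose first tree is `A` with a root added, followed by the forest `B`. -/
def glue (k m : ℕ) (A B : ℕ → ℕ) : ℕ → ℕ := shiftAppend k m (k + 1) (head k A) B

theorem lt_head_and_head_le (hA : IsCode k A) {i : ℕ} (hi : i ≤ k) :
    i < head k A i ∧ head k A i ≤ k + 1 := by
  have := hA.1 (i - 1)
  rw [head]
  split_ifs <;> omega

theorem glue_zero : glue k m A B 0 = k + 1 := by
  rw [glue, shiftAppend_of_le k.zero_le, head, if_pos rfl]

theorem glue_add_one {x : ℕ} (hx : x < k) : glue k m A B (x + 1) = A x + 1 := by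
  rw [glue, shiftAppend_of_le hx, head, if_neg x.succ_ne_zero, Nat.succ_sub_one]

theorem lt_glue {x : ℕ} (hx : k < x) (hxm : x ≤ k + m) : k < glue k m A B x := by
  rw [glue, shiftAppend, if_neg hx.not_ge, if_pos hxm]
  omega

theorem glue_mem (hA : IsNoncrossingCode k A) (hB : IsNoncrossingCode m B) :
    IsNoncrossingCode (k + m + 1) (glue k m A B) := by
  refine ⟨IsCode.shiftAppend (fun i => lt_head_and_head_le hA.1) hB.1, fun x y hxy hy => ?_⟩
  have hhead : x ≤ k → head k A x ≤ k + 1 := fun hx => (lt_head_and_head_le hA.1 hx).2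
  have hleft : x ≤ k → y ≤ k → y < head k A x → head k A y ≤ head k A x := by
    have := hA.2 (x - 1) (y - 1)
    have := fun hy => (lt_head_and_head_le hA.1 (i := y) hy).2
    simp only [head] at this ⊢
    split_ifs at this ⊢ <;> omega
  have hright := hB.2 (x - (k + 1)) (y - (k + 1))
  simp only [glue, shiftAppend] at hy ⊢
  split_ifs at hy ⊢ <;> omega

theorem bottomCount_glue (hA : IsNoncrossingCode k A) (hB : IsNoncrossingCode m B) :
    bottomCount (k + m + 1) (glue k m A B) = bottomCount k A + 1 := by
  refine card_eq_card_add_one (a := 0) (b := 1) one_pos fun x => ?_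
  simp only [Finset.mem_filter, Finset.mem_range]
  constructor
  · rintro ⟨-, hx⟩
    refine or_iff_not_imp_left.2 fun hx0 => ?_
    have hxk := hx 0 (by omega)
    rw [glue_zero] at hxk
    refine ⟨x - 1, ⟨by omega, fun y hy => ?_⟩, by omega⟩
    have := hx (y + 1) (by omega)
    rw [glue_add_one hy] at this
    omega
  · rintro (rfl | ⟨z, ⟨hz, hbottom⟩, rfl⟩)
    · exact ⟨by omega, fun y hy => y.zero_le.trans_lt ((glue_mem hA hB).1.1 y hy).1⟩
    refine ⟨by omega, fun y hy => ?_⟩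
    rcases le_or_gt y k with hyk | hyk
    · cases y with
      | zero => rw [glue_zero]; omega
      | succ y => rw [glue_add_one hyk]; exact Nat.add_lt_add_right (hbottom y hyk) 1
    · exact (Nat.succ_le_of_lt hz).trans_lt (lt_glue hyk (by omega))

theorem cutCount_glue (hA : IsNoncrossingCode k A) :
    cutCount (k + m + 1) (glue k m A B) = cutCount m B + 1 := by
  refine cutCount_shiftAppend (fun i hi => (lt_head_and_head_le hA.1 hi).2) fun x hx hxk => ?_
  exact ⟨0, hx, by rw [head, if_pos rfl]; omega⟩

theorem eq_of_glue_eq_glue {k' m' : ℕ} (h : glue k m A B = glue k' m' A' B') : k = k' := by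
  have := congrFun h 0
  rw [glue_zero, glue_zero] at this
  exact Nat.add_right_cancel this

theorem glue_inj (hA : IsCode k A) (hB : IsCode m B) (hA' : IsCode k A') (hB' : IsCode m B')
    (h : glue k m A B = glue k m A' B') : A = A' ∧ B = B' := by
  refine ⟨funext fun x => ?_, shiftAppend_right_inj hB.2 hB'.2 h⟩
  rcases lt_or_ge x k with hx | hx
  · have := congrFun h (x + 1)
    rw [glue_add_one hx, glue_add_one hx] at this
    exact Nat.add_right_cancel this
  · rw [hA.2 x hx, hA'.2 x hx]

theorem exists_eq_glue (he : IsNoncrossingCode (n + 1) e) : ∃ k m A B,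
    k + m = n ∧ IsNoncrossingCode k A ∧ IsNoncrossingCode m B ∧ glue k m A B = e := by
  have h0 := he.1.1 0 n.succ_pos
  obtain ⟨k, hk⟩ : ∃ k, e 0 = k + 1 := ⟨e 0 - 1, by omega⟩
  obtain ⟨m, rfl⟩ : ∃ m, n = k + m := ⟨n - k, by omega⟩
  refine ⟨k, m, fun i => if i < k then e (i + 1) - 1 else 0, shiftDrop k m (k + 1) e, rfl,
    ⟨⟨fun x hx => ?_, fun x hx => if_neg hx.not_gt⟩, fun x y hxy hy => ?_⟩,
    ⟨IsCode.shiftDrop he.1, fun x y hxy hy => ?_⟩,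
    shiftAppend_shiftDrop (fun i hi => ?_) (fun i hi him => ?_) fun i hi => he.1.2 i hi⟩
  · have := he.1.1 (x + 1)
    have := he.2 0 (x + 1)
    simp only [if_pos hx]
    omega
  · have := he.2 (x + 1) (y + 1)
    beta_reduce at hy ⊢
    split_ifs at hy ⊢ <;> omega
  · have := he.2 (x + (k + 1)) (y + (k + 1))
    simp only [shiftDrop] at hy ⊢
    split_ifs at hy ⊢ <;> omega
  · rcases i.eq_zero_or_pos with rfl | hi0
    · rw [head, if_pos rfl, hk]
    · have := he.1.1 i
      rw [head, if_neg hi0.ne', if_pos (by omega), Nat.sub_add_cancel hi0]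
      omega
  · have := he.1.1 i
    omega

theorem isCatalanPair :
    IsCatalanPair (fun n => {e // IsNoncrossingCode n e}) (fun n e => bottomCount n e.1)
      (fun n e => cutCount n e.1) :=
  isCatalanPair_of_glue glue (fun _ => zero_iff) rfl rfl (fun _ _ _ _ => glue_mem)
    (fun _ _ _ _ => bottomCount_glue) (fun _ _ _ _ hA _ => cutCount_glue hA)
    (fun _ _ _ _ _ _ _ _ _ _ _ _ _ => eq_of_glue_eq_glue)
    (fun _ _ _ _ _ _ hA hB hA' hB' => glue_inj hA.1 hB.1 hA'.1 hB'.1) fun _ _ => exists_eq_glue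

end IsNoncrossingCode

/-! ### Restricted growth functions -/

namespace IsRGFAvoiding101

variable {n k m : ℕ} {α A B A' B' : ℕ → ℕ}

theorem apply_le (h : IsRGFAvoiding101 n α) : ∀ x < n, α x ≤ x := by
  intro x
  induction x using Nat.strong_induction_on with
  | _ x ih =>
    intro hx
    by_contra! hlt
    obtain ⟨y, hy, hxy⟩ := h.1 x hx x hlt
    have := ih y hy (hy.trans hx)
    omega

instance finite (n : ℕ) : Finite {α // IsRGFAvoiding101 n α} :=
  finite_subtype_of_bounded n fun _ h => ⟨fun x hx => (h.apply_le x hx).trans hx.le, h.2.2⟩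

theorem zero_iff : IsRGFAvoiding101 0 α ↔ α = 0 :=
  ⟨fun h => funext fun x => h.2.2 x x.zero_le, by rintro rfl; simp [IsRGFAvoiding101]⟩

/-- The least positive number that exceeds the first `k` values of `A`. -/
def bound (k : ℕ) (A : ℕ → ℕ) : ℕ := (Finset.range k).sup A + 1

theorem lt_bound {x : ℕ} (hx : x < k) : A x < bound k A :=
  Nat.lt_succ_of_le (Finset.le_sup (f := A) (Finset.mem_range.2 hx))

theorem exists_eq_of_lt_bound (hA : IsRGFAvoiding101 k A) {v : ℕ} (hv : v ≠ 0)
    (hlt : v < bound k A) : ∃ x < k, A x = v := by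
  have hne : (Finset.range k).Nonempty := by
    rw [Finset.nonempty_range_iff]
    rintro rfl
    exact hv (Nat.lt_one_iff.1 hlt)
  obtain ⟨x, hx, hsup⟩ := Finset.exists_mem_eq_sup (Finset.range k) hne A
  rw [Finset.mem_range] at hx
  rw [bound, hsup] at hlt
  rcases (Nat.lt_succ_iff.1 hlt).lt_or_eq with hlt | rfl
  · obtain ⟨y, hy, hyv⟩ := hA.1 x hx v hlt
    exact ⟨y, hy.trans hx, hyv⟩
  · exact ⟨x, hx, rfl⟩

/-- The sequence with last zero at `k` that continues `A` by a zero and then by `B`, raised above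
the values of `A`. -/
def glue (k m : ℕ) (A B : ℕ → ℕ) : ℕ → ℕ := shiftAppend k m (bound k A) A B

theorem glue_self (hA : IsRGFAvoiding101 k A) : glue k m A B k = 0 :=
  (shiftAppend_of_le le_rfl).trans (hA.2.2 k le_rfl)

theorem glue_pos {x : ℕ} (hx : k < x) (hxm : x ≤ k + m) : 0 < glue k m A B x := by
  rw [glue, shiftAppend, if_neg hx.not_ge, if_pos hxm]
  exact Nat.add_pos_right _ (Nat.succ_pos _)

theorem exists_glue_eq (hA : IsRGFAvoiding101 k A) (hB : IsRGFAvoiding101 m B) {x v : ℕ}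
    (hx : x < k + m + 1) (hv : v < glue k m A B x) : ∃ y < x, glue k m A B y = v := by
  have hleft : ∀ {y}, y ≤ k → glue k m A B y = A y := shiftAppend_of_le
  have hright : ∀ {y}, y < m → glue k m A B (y + (k + 1)) = B y + bound k A := shiftAppend_add
  rcases lt_trichotomy x k with hxk | rfl | hxk
  · rw [hleft hxk.le] at hv
    obtain ⟨y, hy, hyv⟩ := hA.1 x hxk v hv
    exact ⟨y, hy, by rw [hleft (hy.trans hxk).le, hyv]⟩
  · rw [glue_self hA] at hv
    exact absurd hv v.not_lt_zero
  obtain ⟨z, rfl⟩ : ∃ z, x = z + (k + 1) := ⟨x - (k + 1), by omega⟩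
  have hz : z < m := by omega
  rw [hright hz] at hv
  rcases v.eq_zero_or_pos with rfl | hv0
  · exact ⟨k, hxk, glue_self hA⟩
  rcases lt_or_ge v (bound k A) with hvA | hvA
  · obtain ⟨y, hy, hyv⟩ := hA.exists_eq_of_lt_bound hv0.ne' hvA
    exact ⟨y, hy.trans hxk, by rw [hleft hy.le, hyv]⟩
  · obtain ⟨y, hy, hyv⟩ := hB.1 z hz (v - bound k A) (by omega)
    exact ⟨y + (k + 1), by omega, by rw [hright (hy.trans hz), hyv, Nat.sub_add_cancel hvA]⟩

theorem glue_mem (hA : IsRGFAvoiding101 k A) (hB : IsRGFAvoiding101 m B) :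
    IsRGFAvoiding101 (k + m + 1) (glue k m A B) := by
  refine ⟨fun x hx v => exists_glue_eq hA hB hx, fun x y z hxy hyz hz h => ?_,
    fun x hx => shiftAppend_of_lt hx⟩
  have hAk := hA.2.2 k le_rfl
  have hbound := fun hx => lt_bound (k := k) (A := A) (x := x) hx
  have hleft := hA.2.1 x y z hxy hyz
  have hright := hB.2.1 (x - (k + 1)) (y - (k + 1)) (z - (k + 1))
  have hk : z = k → A z = 0 := by rintro rfl; exact hAk
  have hk' : x = k → A x = 0 := by rintro rfl; exact hAk
  simp only [glue, shiftAppend] at h ⊢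
  split_ifs at h ⊢ <;> omega

theorem zeroNumber_glue (hA : IsRGFAvoiding101 k A) :
    zeroNumber (k + m + 1) (glue k m A B) = zeroNumber k A + 1 := by
  have hzeros : ((Finset.range (k + m + 1)).filter fun x => glue k m A B x = 0) =
      insert k ((Finset.range k).filter fun x => A x = 0) := by
    ext x
    simp only [Finset.mem_filter, Finset.mem_range, Finset.mem_insert]
    rcases lt_trichotomy x k with hx | rfl | hx
    · rw [glue, shiftAppend_of_le hx.le]
      omega
    · exact iff_of_true ⟨by omega, glue_self hA⟩ (Or.inl rfl)
    · have := fun hxm => (glue_pos (A := A) (B := B) (m := m) hx hxm).ne'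
      omega
  rw [zeroNumber, hzeros, Finset.card_insert_of_notMem (by simp)]
  rfl

theorem rminNumber_glue (hA : IsRGFAvoiding101 k A) :
    rminNumber (k + m + 1) (glue k m A B) = rminNumber m B + 1 := by
  have hright : ∀ {y}, y < m → glue k m A B (y + (k + 1)) = B y + bound k A := shiftAppend_add
  refine card_eq_card_add_one (a := k) (b := k + 1) k.lt_succ_self fun x => ?_
  simp only [Finset.mem_filter, Finset.mem_range]
  constructor
  · rintro ⟨hx, hmin⟩
    refine or_iff_not_imp_left.2 fun hxk => ?_
    have hkx : k < x := by
      by_contra hkx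
      have := hmin k (by omega) (by omega)
      rw [glue_self hA] at this
      exact absurd this (Nat.not_lt_zero _)
    obtain ⟨z, rfl⟩ : ∃ z, x = z + (k + 1) := ⟨x - (k + 1), by omega⟩
    refine ⟨z, ⟨by omega, fun y hy hzy => ?_⟩, rfl⟩
    have := hmin (y + (k + 1)) (by omega) (by omega)
    rw [hright (by omega), hright hy] at this
    exact Nat.lt_of_add_lt_add_right this
  · rintro (rfl | ⟨z, ⟨hz, hmin⟩, rfl⟩)
    · refine ⟨by omega, fun y hy hxy => ?_⟩
      rw [glue_self hA]
      exact glue_pos hxy (by omega)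
    refine ⟨by omega, fun y hy hzy => ?_⟩
    obtain ⟨w, rfl⟩ : ∃ w, y = w + (k + 1) := ⟨y - (k + 1), by omega⟩
    rw [hright hz, hright (by omega)]
    exact Nat.add_lt_add_right (hmin w (by omega) (by omega)) _

theorem eq_of_glue_eq_glue {k' m' : ℕ} (hA : IsRGFAvoiding101 k A) (hA' : IsRGFAvoiding101 k' A')
    (hkm : k + m = k' + m') (h : glue k m A B = glue k' m' A' B') : k = k' := by
  refine le_antisymm (not_lt.1 fun hlt => ?_) (not_lt.1 fun hlt => ?_)
  · have := glue_pos (A := A') (B := B') hlt (hkm ▸ Nat.le_add_right k m)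
    rw [← h, glue_self hA] at this
    exact lt_irrefl 0 this
  · have := glue_pos (A := A) (B := B) hlt (hkm ▸ Nat.le_add_right k' m')
    rw [h, glue_self hA'] at this
    exact lt_irrefl 0 this

theorem glue_inj (hA : IsRGFAvoiding101 k A) (hB : IsRGFAvoiding101 m B)
    (hA' : IsRGFAvoiding101 k A') (hB' : IsRGFAvoiding101 m B')
    (h : glue k m A B = glue k m A' B') : A = A' ∧ B = B' := by
  have hAA' : A = A' := by
    funext x
    rcases lt_or_ge x k with hx | hx
    · have := congrFun h x
      rwa [glue, glue, shiftAppend_of_le hx.le, shiftAppend_of_le hx.le] at this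
    · rw [hA.2.2 x hx, hA'.2.2 x hx]
  subst hAA'
  exact ⟨rfl, shiftAppend_right_inj hB.2.2 hB'.2.2 h⟩

theorem exists_last_zero (hα : IsRGFAvoiding101 (n + 1) α) :
    ∃ k ≤ n, α k = 0 ∧ ∀ y, k < y → y ≤ n → α y ≠ 0 := by
  have h0 : α 0 = 0 := Nat.le_zero.1 (hα.apply_le 0 n.succ_pos)
  exact ⟨Nat.findGreatest (fun k => α k = 0) n, Nat.findGreatest_le n,
    Nat.findGreatest_spec (P := fun k => α k = 0) n.zero_le h0,
    fun y hlt hy => Nat.findGreatest_is_greatest (P := fun k => α k = 0) hlt hy⟩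

theorem restrict (hα : IsRGFAvoiding101 n α) (hkn : k ≤ n) :
    IsRGFAvoiding101 k fun i => if i < k then α i else 0 := by
  refine ⟨fun x hx v hv => ?_, fun x y z hxy hyz hz h => ?_, fun x hx => if_neg hx.not_gt⟩
  · simp only [if_pos hx] at hv
    obtain ⟨y, hy, hyv⟩ := hα.1 x (hx.trans_le hkn) v hv
    exact ⟨y, hy, (if_pos (hy.trans hx)).trans hyv⟩
  · simp only [if_pos hz, if_pos (hyz.trans hz), if_pos (hxy.trans (hyz.trans hz))] at h ⊢
    exact hα.2.1 x y z hxy hyz (hz.trans_le hkn) h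

/-- A positive value that occurs both before and after a zero is excluded by avoidance of `101`, and
the values before the zero are all those below their bound. -/
theorem bound_le_apply (hα : IsRGFAvoiding101 n α) (hk : α k = 0) {y : ℕ} (hky : k < y)
    (hy : y < n) (hy0 : α y ≠ 0) : bound k (fun i => if i < k then α i else 0) ≤ α y := by
  by_contra! hlt
  obtain ⟨x, hx, hxy⟩ := (hα.restrict (hky.trans hy).le).exists_eq_of_lt_bound hy0 hlt
  rw [if_pos hx] at hxy
  have := hα.2.1 x k y hx hky hy hxy
  omega

theorem shiftDrop {s : ℕ} (hα : IsRGFAvoiding101 (k + m + 1) α) (hlow : ∀ y ≤ k, α y < s)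
    (hhigh : ∀ y, k < y → y ≤ k + m → s ≤ α y) :
    IsRGFAvoiding101 m (shiftDrop k m s α) := by
  refine ⟨fun x hx v hv => ?_, fun x y z hxy hyz hz h => ?_, fun x hx => if_neg hx.not_gt⟩
  · rw [Fishburn.shiftDrop, if_pos hx] at hv
    obtain ⟨y, hy, hyv⟩ := hα.1 (x + (k + 1)) (by omega) (v + s) (by omega)
    have hky : k < y := by
      by_contra! hyk
      have := hlow y hyk
      omega
    refine ⟨y - (k + 1), by omega, ?_⟩
    rw [Fishburn.shiftDrop, if_pos (by omega), Nat.sub_add_cancel hky, hyv, Nat.add_sub_cancel]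
  · have h101 := hα.2.1 (x + (k + 1)) (y + (k + 1)) (z + (k + 1)) (by omega) (by omega) (by omega)
    have := hhigh (x + (k + 1)) (by omega) (by omega)
    have := hhigh (z + (k + 1)) (by omega) (by omega)
    rw [Fishburn.shiftDrop, Fishburn.shiftDrop, if_pos (by omega), if_pos hz] at h
    rw [Fishburn.shiftDrop, Fishburn.shiftDrop, if_pos (by omega), if_pos (hyz.trans hz)]
    omega

theorem exists_eq_glue (hα : IsRGFAvoiding101 (n + 1) α) : ∃ k m A B,
    k + m = n ∧ IsRGFAvoiding101 k A ∧ IsRGFAvoiding101 m B ∧ glue k m A B = α := by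
  obtain ⟨k, hkn, hk, hlast⟩ := hα.exists_last_zero
  obtain ⟨m, rfl⟩ := Nat.exists_eq_add_of_le hkn
  let A : ℕ → ℕ := fun i => if i < k then α i else 0
  have hAα : ∀ i ≤ k, A i = α i := by
    intro i hi
    rcases hi.lt_or_eq with hi | rfl
    · exact if_pos hi
    · exact (if_neg (lt_irrefl i)).trans hk.symm
  have hlow : ∀ y ≤ k, α y < bound k A := by
    intro y hy
    rcases hy.lt_or_eq with hy | rfl
    · exact hAα y hy.le ▸ lt_bound hy
    · exact hk ▸ Nat.succ_pos _
  have hhigh : ∀ y, k < y → y ≤ k + m → bound k A ≤ α y := fun y hky hy =>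
    hα.bound_le_apply hk hky (Nat.lt_succ_of_le hy) (hlast y hky hy)
  exact ⟨k, m, A, Fishburn.shiftDrop k m (bound k A) α, rfl, hα.restrict (by omega),
    hα.shiftDrop hlow hhigh, shiftAppend_shiftDrop hAα hhigh fun i hi => hα.2.2 i hi⟩

theorem isCatalanPair :
    IsCatalanPair (fun n => {α // IsRGFAvoiding101 n α}) (fun n α => zeroNumber n α.1)
      (fun n α => rminNumber n α.1) :=
  isCatalanPair_of_glue glue (fun _ => zero_iff) rfl rfl (fun _ _ _ _ => glue_mem)
    (fun _ _ _ _ hA _ => zeroNumber_glue hA) (fun _ _ _ _ hA _ => rminNumber_glue hA)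
    (fun _ _ _ _ _ _ _ _ hA _ hA' _ => eq_of_glue_eq_glue hA hA')
    (fun _ _ _ _ _ _ => glue_inj) fun _ _ => exists_eq_glue

end IsRGFAvoiding101

/-! ### Posets encoded by functions -/

section Poset

variable {α β : Type} [PartialOrder α] [PartialOrder β] {n : ℕ} {v : α ≃ Fin n} {e : ℕ → ℕ}

/-- In the labelling `v` of its elements by `0, …, n - 1`, the elements above `x` are the last ones,
beginning with the label `e (v x)`. Such a labelling exists exactly for the interval orders. -/
structure EncodesPoset (v : α ≃ Fin n) (e : ℕ → ℕ) : Prop where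
  isCode : IsCode n e
  lt_iff : ∀ x y, x < y ↔ e (v x) ≤ v y

/-- The code `e` encodes a poset that contains **3+1**, with chain `a < b < c` and point `d`. -/
def HasThreePlusOne (n : ℕ) (e : ℕ → ℕ) : Prop :=
  ∃ a b c d, b < n ∧ c < n ∧ d < e a ∧ e a ≤ b ∧ e b ≤ c ∧ c < e d ∧ d < n

/-- The code `e` encodes a poset that contains **N**. -/
def HasN (n : ℕ) (e : ℕ → ℕ) : Prop :=
  ∃ a b c d, d < n ∧ b < e a ∧ e a ≤ c ∧ c < e b ∧ e b ≤ d ∧ d < e c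

theorem IsCode.lt_of_lt_apply {x y : ℕ} (he : IsCode n e) (h : y < e x) : x < n := by
  by_contra! hx
  rw [he.2 x hx] at h
  omega

theorem card_subtype_eq_card_filter {γ : Type} (v : γ ≃ Fin n) (p : ℕ → Prop) [DecidablePred p] :
    Nat.card {x : γ // p (v x)} = ((Finset.range n).filter p).card := by
  rw [← Fintype.card_coe, ← Nat.card_eq_fintype_card]
  refine Nat.card_congr
    { toFun := fun x => ⟨v x.1, Finset.mem_filter.2 ⟨Finset.mem_range.2 (v x.1).2, x.2⟩⟩
      invFun := fun y => ⟨v.symm ⟨y.1, Finset.mem_range.1 (Finset.mem_filter.1 y.2).1⟩, ?_⟩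
      left_inv := fun x => by simp
      right_inv := fun y => by simp }
  simpa using (Finset.mem_filter.1 y.2).2

theorem PosetN.le_iff (p q : PosetN) :
    p ≤ q ↔ p = q ∨ (p = .a ∧ q = .c) ∨ (p = .a ∧ q = .d) ∨ (p = .b ∧ q = .d) := by
  constructor
  · intro h
    cases (h : PosetN.Rel p q) <;> simp
  · rintro (rfl | ⟨rfl, rfl⟩ | ⟨rfl, rfl⟩ | ⟨rfl, rfl⟩)
    exacts [le_rfl, PosetN.Rel.ac, PosetN.Rel.ad, PosetN.Rel.bd]

namespace EncodesPoset

theorem le_iff (h : EncodesPoset v e) (x y : α) : x ≤ y ↔ (v x : ℕ) = v y ∨ e (v x) ≤ v y := by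
  rw [le_iff_eq_or_lt, h.lt_iff, ← Fin.ext_iff, v.injective.eq_iff]

theorem congr (h : EncodesPoset v e) (f : β ≃o α) : EncodesPoset (f.toEquiv.trans v) e where
  isCode := h.isCode
  lt_iff x y := by
    rw [← f.lt_iff_lt, h.lt_iff]
    rfl

theorem minCount_eq (h : EncodesPoset v e) : minCount α = bottomCount n e := by
  rw [bottomCount, ← card_subtype_eq_card_filter v]
  refine Nat.card_congr (Equiv.subtypeEquivRight fun x => ?_)
  rw [isMin_iff_forall_not_lt]
  constructor
  · intro hx z hz
    have := hx (v.symm ⟨z, hz⟩)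
    rwa [h.lt_iff, Equiv.apply_symm_apply, not_le] at this
  · intro hx z
    rw [h.lt_iff, not_le]
    exact hx _ (v z).2

theorem isFreeOf_twoPlusTwo (h : EncodesPoset v e) : IsFreeOf α TwoPlusTwo := by
  refine ⟨fun f => ?_⟩
  have left_lt : f (Sum.inl 0) < f (Sum.inl 1) := by simp
  have right_lt : f (Sum.inr 0) < f (Sum.inr 1) := by simp
  have left_not_lt_right : ¬ f (Sum.inl 0) < f (Sum.inr 1) := by simp
  have right_not_lt_left : ¬ f (Sum.inr 0) < f (Sum.inl 1) := by simp
  rw [h.lt_iff] at left_lt right_lt left_not_lt_right right_not_lt_left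
  omega

theorem isFreeOf_threePlusOne_iff (h : EncodesPoset v e) :
    IsFreeOf α ThreePlusOne ↔ ¬ HasThreePlusOne n e := by
  constructor
  · rintro ⟨hfree⟩ ⟨a, b, c, d, hb, hc, hda, hab, hbc, hcd, hd⟩
    have ha : a < n := h.isCode.lt_of_lt_apply hda
    have ha' := h.isCode.1 a ha
    have hb' := h.isCode.1 b hb
    have hc' := h.isCode.1 c hc
    have hd' := h.isCode.1 d hd
    have hne : a ≠ d := by rintro rfl; omega
    refine hfree (OrderEmbedding.ofMapLEIff (fun q : ThreePlusOne =>
      v.symm (Sum.elim ![⟨a, ha⟩, ⟨b, hb⟩, ⟨c, hc⟩] ![⟨d, hd⟩] q)) ?_)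
    intro p q
    rw [h.le_iff, Equiv.apply_symm_apply, Equiv.apply_symm_apply]
    rcases p with p | p <;> rcases q with q | q <;> fin_cases p <;> fin_cases q <;> simp <;> omega
  · refine fun hno => ⟨fun f => hno ?_⟩
    have hab : f (Sum.inl 0) < f (Sum.inl 1) := by simp
    have hbc : f (Sum.inl 1) < f (Sum.inl 2) := by simp
    have had : ¬ f (Sum.inl 0) < f (Sum.inr 0) := by simp
    have hdc : ¬ f (Sum.inr 0) < f (Sum.inl 2) := by simp
    rw [h.lt_iff] at hab hbc had hdc
    exact ⟨_, _, _, _, (v (f (Sum.inl 1))).2, (v (f (Sum.inl 2))).2, not_le.1 had, hab, hbc,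
      not_le.1 hdc, (v (f (Sum.inr 0))).2⟩

theorem isFreeOf_posetN_iff (h : EncodesPoset v e) : IsFreeOf α PosetN ↔ ¬ HasN n e := by
  constructor
  · rintro ⟨hfree⟩ ⟨a, b, c, d, hd, hba, hac, hcb, hbd, hdc⟩
    have ha : a < n := h.isCode.lt_of_lt_apply hba
    have hb : b < n := h.isCode.lt_of_lt_apply hcb
    have hc : c < n := h.isCode.lt_of_lt_apply hdc
    have ha' := h.isCode.1 a ha
    have hb' := h.isCode.1 b hb
    have hd' := h.isCode.1 d hd
    have hne : a ≠ b := by rintro rfl; omega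
    refine hfree (OrderEmbedding.ofMapLEIff (fun q : PosetN =>
      v.symm (PosetN.rec ⟨a, ha⟩ ⟨b, hb⟩ ⟨c, hc⟩ ⟨d, hd⟩ q)) ?_)
    intro p q
    rw [h.le_iff, Equiv.apply_symm_apply, Equiv.apply_symm_apply, PosetN.le_iff]
    cases p <;> cases q <;> simp <;> omega
  · refine fun hno => ⟨fun f => hno ?_⟩
    have map_lt_iff : ∀ p q : PosetN, p ≠ q → (f p < f q ↔ p ≤ q) := fun p q hpq => by
      rw [f.lt_iff_lt, lt_iff_le_and_ne, and_iff_left hpq]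
    have hac : f .a < f .c := by rw [map_lt_iff _ _ (by simp), PosetN.le_iff]; simp
    have hbd : f .b < f .d := by rw [map_lt_iff _ _ (by simp), PosetN.le_iff]; simp
    have hab : ¬ f .a < f .b := by rw [map_lt_iff _ _ (by simp), PosetN.le_iff]; simp
    have hbc : ¬ f .b < f .c := by rw [map_lt_iff _ _ (by simp), PosetN.le_iff]; simp
    have hcd : ¬ f .c < f .d := by rw [map_lt_iff _ _ (by simp), PosetN.le_iff]; simp
    rw [h.lt_iff] at hac hbd hab hbc hcd
    exact ⟨_, _, _, _, (v (f .d)).2, not_le.1 hab, hac, not_le.1 hbc, hbd, not_le.1 hcd⟩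

theorem ncard_Ioi (h : EncodesPoset v e) (x : α) : (Set.Ioi x).ncard = n - e (v x) := by
  have hfilter : ((Finset.range n).filter fun y => e (v x) ≤ y) = Finset.Ico (e (v x)) n := by
    ext y
    simp only [Finset.mem_filter, Finset.mem_range, Finset.mem_Ico]
    exact and_comm
  rw [← Nat.card_Ico, ← hfilter, ← card_subtype_eq_card_filter v, ← Nat.card_coe_set_eq]
  exact Nat.card_congr (Equiv.subtypeEquivRight fun y => h.lt_iff x y)

end EncodesPoset

/-! ### Canonical labellings -/

/-- The sizes of the down-set and of the up-set of an element, the latter transformed by `g`.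
Sorting by it gives a labelling by which an interval order is encoded. -/
noncomputable def levelKey (g : ℕ → ℤ) (x : α) : ℕ ×ₗ ℤ :=
  toLex ((Set.Iio x).ncard, g (Set.Ioi x).ncard)

/-- Points of a code with the same down-set are sorted by `g` of the size of the up-set, which makes
the code of a poset unique if `g` is injective. -/
def TieSorted (g : ℕ → ℤ) (n : ℕ) (e : ℕ → ℕ) : Prop :=
  ∀ x y, x < y → y < n → (∀ z < n, x < e z → y < e z) → g (n - e x) ≤ g (n - e y)

namespace EncodesPoset

theorem Iio_subset (h : EncodesPoset v e) {x y : α} (hxy : v x ≤ v y) : Set.Iio x ⊆ Set.Iio y :=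
  fun z hz => (h.lt_iff z y).2 (((h.lt_iff z x).1 hz).trans hxy)

theorem Iio_eq_iff (h : EncodesPoset v e) {x y : α} (hxy : v x ≤ v y) :
    Set.Iio x = Set.Iio y ↔ ∀ z < n, (v x : ℕ) < e z → (v y : ℕ) < e z := by
  rw [Set.Subset.antisymm_iff, and_iff_right (h.Iio_subset hxy)]
  constructor
  · intro hsub z hz hxz
    by_contra! hzy
    have := hsub ((h.lt_iff (v.symm ⟨z, hz⟩) y).2 (by simpa using hzy))
    rw [Set.mem_Iio, h.lt_iff, Equiv.apply_symm_apply] at this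
    exact absurd hxz this.not_gt
  · intro hz z hzy
    rw [Set.mem_Iio, h.lt_iff] at hzy ⊢
    by_contra! hxz
    exact absurd (hz _ (v z).2 hxz) hzy.not_gt

theorem levelKey_le_iff (h : EncodesPoset v e) (g : ℕ → ℤ) {x y : α} (hxy : v x ≤ v y) :
    levelKey g x ≤ levelKey g y ↔
      ((∀ z < n, (v x : ℕ) < e z → (v y : ℕ) < e z) → g (n - e (v x)) ≤ g (n - e (v y))) := by
  have : Finite α := Finite.of_equiv _ v.symm
  have hsub := h.Iio_subset hxy
  rw [← h.Iio_eq_iff hxy, levelKey, levelKey, Prod.Lex.toLex_le_toLex, h.ncard_Ioi, h.ncard_Ioi]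
  constructor
  · rintro (hlt | ⟨-, hle⟩) heq
    · rw [heq] at hlt
      exact absurd hlt (lt_irrefl _)
    · exact hle
  · intro hle
    rcases (Set.ncard_le_ncard hsub).lt_or_eq with hlt | heq
    · exact Or.inl hlt
    · exact Or.inr ⟨heq, hle (Set.eq_of_subset_of_ncard_le hsub heq.ge)⟩

theorem monotone_levelKey_iff (h : EncodesPoset v e) (g : ℕ → ℤ) :
    Monotone (levelKey g ∘ v.symm) ↔ TieSorted g n e := by
  have key : ∀ {x y : Fin n}, x ≤ y → (levelKey g (v.symm x) ≤ levelKey g (v.symm y) ↔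
      ((∀ z < n, (x : ℕ) < e z → (y : ℕ) < e z) → g (n - e x) ≤ g (n - e y))) := fun {x y} hxy => by
    simpa using h.levelKey_le_iff g (x := v.symm x) (y := v.symm y) (by simpa using hxy)
  constructor
  · intro hm x y hxy hy
    exact (key (x := ⟨x, hxy.trans hy⟩) (y := ⟨y, hy⟩) hxy.le).1 (hm (Fin.mk_le_mk.2 hxy.le))
  · intro ht x y hxy
    rcases hxy.eq_or_lt with rfl | hlt
    · exact le_rfl
    · exact (key hxy).2 (ht x y hlt y.2)

theorem eq_of_tieSorted {g : ℕ → ℤ} (hg : Function.Injective g) {v' : α ≃ Fin n} {e' : ℕ → ℕ}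
    (h : EncodesPoset v e) (h' : EncodesPoset v' e') (ht : TieSorted g n e)
    (ht' : TieSorted g n e') : e = e' := by
  have hm := (h.monotone_levelKey_iff g).2 ht
  have hm' := (h'.monotone_levelKey_iff g).2 ht'
  have hcomp : (levelKey g ∘ v.symm) ∘ (v'.symm.trans v : Equiv.Perm (Fin n)) =
      levelKey g ∘ v'.symm := by
    funext x
    simp
  have hkeys := Tuple.unique_monotone (f := levelKey g ∘ v.symm) (σ := 1) (τ := v'.symm.trans v)
    hm (by rwa [hcomp])
  rw [hcomp] at hkeys
  funext x
  rcases lt_or_ge x n with hx | hx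
  · have hkey := congrArg (fun p => (ofLex p).2) (congrFun hkeys ⟨x, hx⟩)
    simp only [Function.comp_apply, levelKey, ofLex_toLex, Equiv.Perm.coe_one, id_eq] at hkey
    rw [h.ncard_Ioi, h'.ncard_Ioi, Equiv.apply_symm_apply, Equiv.apply_symm_apply] at hkey
    have hsub : n - e x = n - e' x := hg hkey
    have := h.isCode.apply_le (x := x)
    have := h'.isCode.apply_le (x := x)
    omega
  · rw [h.isCode.2 x hx, h'.isCode.2 x hx]

end EncodesPoset

theorem mem_iff_of_isUpperSet {S : Finset (Fin n)} (hS : IsUpperSet (S : Set (Fin n)))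
    (y : Fin n) : y ∈ S ↔ n - S.card ≤ y := by
  constructor
  · intro hy
    have hsub : Finset.Ici y ⊆ S := fun z hz => hS (Finset.mem_Ici.1 hz) hy
    have := Finset.card_le_card hsub
    rw [Fin.card_Ici] at this
    omega
  · intro hy
    by_contra hmem
    have hsub : S ⊆ Finset.Ioi y := fun z hz => by
      rw [Finset.mem_Ioi]
      by_contra! hzy
      exact hmem (hS hzy hz)
    have := Finset.card_le_card hsub
    rw [Fin.card_Ioi] at this
    omega

theorem IsFreeOf.Iio_total (h : IsFreeOf α TwoPlusTwo) (a b : α) :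
    Set.Iio a ⊆ Set.Iio b ∨ Set.Iio b ⊆ Set.Iio a := by
  by_contra! hcon
  obtain ⟨p, hpa, hpb⟩ := Set.not_subset.1 hcon.1
  obtain ⟨q, hqb, hqa⟩ := Set.not_subset.1 hcon.2
  rw [Set.mem_Iio] at hpa hpb hqb hqa
  have hpq : ¬ p ≤ q := fun h => hpb (h.trans_lt hqb)
  have hqp : ¬ q ≤ p := fun h => hqa (h.trans_lt hpa)
  have hab : ¬ a ≤ b := fun h => hpb (hpa.trans_le h)
  have hba : ¬ b ≤ a := fun h => hqa (hqb.trans_le h)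
  have hpb' : ¬ p ≤ b := fun h => h.lt_or_eq.elim hpb fun h => hba (h ▸ hpa.le)
  have hqa' : ¬ q ≤ a := fun h => h.lt_or_eq.elim hqa fun h => hab (h ▸ hqb.le)
  have haq : ¬ a ≤ q := fun h => hpq (hpa.le.trans h)
  have hbp : ¬ b ≤ p := fun h => hqp (hqb.le.trans h)
  refine h.false (OrderEmbedding.ofMapLEIff (Sum.elim ![p, a] ![q, b]) ?_)
  intro x y
  rcases x with x | x <;> rcases y with y | y <;> fin_cases x <;> fin_cases y <;>
    simp [*, hpa.le, hqb.le, hpa.not_ge, hqb.not_ge]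

theorem IsFreeOf.Iio_subset_of_levelKey_le [Finite α] (h : IsFreeOf α TwoPlusTwo) {g : ℕ → ℤ}
    {a b : α} (hab : levelKey g a ≤ levelKey g b) : Set.Iio a ⊆ Set.Iio b := by
  have hcard : (Set.Iio a).ncard ≤ (Set.Iio b).ncard := by
    rcases Prod.Lex.toLex_le_toLex.1 hab with hlt | heq
    exacts [hlt.le, heq.1.le]
  rcases h.Iio_total a b with hsub | hsub
  · exact hsub
  · exact (Set.eq_of_subset_of_ncard_le hsub hcard).ge

theorem exists_encodesPoset_of_Iio_subset (v : α ≃ Fin n)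
    (hv : ∀ a b : α, v a ≤ v b → Set.Iio a ⊆ Set.Iio b) : ∃ e, EncodesPoset v e := by
  have : Finite α := Finite.of_equiv _ v.symm
  let e : ℕ → ℕ := fun x => if hx : x < n then n - (Set.Ioi (v.symm ⟨x, hx⟩)).ncard else 0
  have hlt : ∀ z y : α, z < y ↔ e (v z) ≤ v y := by
    intro z y
    have hfin : (v '' Set.Ioi z).Finite := Set.toFinite _
    have hupper : IsUpperSet (hfin.toFinset : Set (Fin n)) := by
      rw [Set.Finite.coe_toFinset]
      rintro a b hab ⟨c, hc, rfl⟩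
      exact ⟨v.symm b, hv c _ (by simpa using hab) hc, by simp⟩
    have hez : e (v z) = n - (Set.Ioi z).ncard := by simp [e]
    have hmem := mem_iff_of_isUpperSet hupper (v y)
    rw [← Set.ncard_eq_toFinset_card _ hfin, Set.ncard_image_of_injective _ v.injective,
      ← hez] at hmem
    rw [← hmem]
    simp
  refine ⟨e, ⟨fun x hx => ⟨?_, ?_⟩, fun x hx => ?_⟩, hlt⟩
  · simpa using hlt (v.symm ⟨x, hx⟩) (v.symm ⟨x, hx⟩)
  · simp [e, hx]
  · simp [e, not_lt.2 hx]

theorem exists_encodesPoset_tieSorted (g : ℕ → ℤ) (w : α ≃ Fin n) (h : IsFreeOf α TwoPlusTwo) :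
    ∃ (v : α ≃ Fin n) (e : ℕ → ℕ), EncodesPoset v e ∧ TieSorted g n e := by
  have : Finite α := Finite.of_equiv _ w.symm
  let v : α ≃ Fin n := w.trans (Tuple.sort (levelKey g ∘ w.symm)).symm
  have hm : Monotone (levelKey g ∘ v.symm) := Tuple.monotone_sort (levelKey g ∘ w.symm)
  obtain ⟨e, he⟩ := exists_encodesPoset_of_Iio_subset v fun a b hab =>
    h.Iio_subset_of_levelKey_le (g := g) (by simpa using hm hab)
  exact ⟨v, e, he, (he.monotone_levelKey_iff g).1 hm⟩

end Poset

/-! ### Ordinal sums -/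

section OrdinalSum

variable {α : Type} [PartialOrder α]

variable (α) in
/-- The nonempty lower parts of the decompositions of a poset as an ordinal sum of two posets, the
upper of which may be empty. There is one for each irreducible summand. -/
def ordinalCuts : Set (Set α) := {D | D.Nonempty ∧ ∀ x ∈ D, ∀ y ∉ D, x < y}

/-- The number of the ordinal summands below that of `x`. -/
noncomputable def cutRank (x : α) : ℕ := {D ∈ ordinalCuts α | x ∉ D}.ncard

theorem cutRank_lt_iff [Finite α] {x y : α} :
    cutRank x < cutRank y ↔ ∃ D ∈ ordinalCuts α, x ∈ D ∧ y ∉ D := by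
  constructor
  · contrapose!
    exact fun h => Set.ncard_le_ncard fun D hD => ⟨hD.1, fun hx => hD.2 (h D hD.1 hx)⟩
  · rintro ⟨D, hD, hx, hy⟩
    refine Set.ncard_lt_ncard ⟨fun E hE => ⟨hE.1, fun hyE => ?_⟩, fun hsub => (hsub ⟨hD, hy⟩).2 hx⟩
    exact lt_asymm (hD.2 x hx y hy) (hE.1.2 y hyE x hE.2)

theorem IsOrdinalSumDecomposition.ordinalCuts_eq {k : ℕ} {f : α → Fin k}
    (hf : IsOrdinalSumDecomposition f) : ordinalCuts α = Set.range fun i => {x | f x ≤ i} := by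
  ext D
  constructor
  · rintro ⟨hne, hD⟩
    obtain ⟨_, ⟨x, hx, rfl⟩, hmax⟩ := Set.exists_max_image (f '' D) id (Set.toFinite _)
      (hne.image f)
    refine ⟨f x, Set.ext fun y => ⟨fun hy => ?_, fun hy => hmax _ ⟨y, hy, rfl⟩⟩⟩
    by_contra hyD
    rcases (show f y ≤ f x from hy).lt_or_eq with hlt | heq
    · exact lt_asymm (hf.1 _ _ hlt) (hD x hx y hyD)
    · exact (hf.2 (f x)).2 ⟨{z | z.1 ∈ D}, ⟨⟨x, rfl⟩, hx⟩, ⟨⟨y, heq⟩, hyD⟩,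
        fun u hu w hw => hD u.1 hu w.1 hw⟩
  · rintro ⟨i, rfl⟩
    obtain ⟨x, hx⟩ := (hf.2 i).1
    exact ⟨⟨x, hx.le⟩, fun u hu w hw => hf.1 _ _ (lt_of_le_of_lt hu (not_le.1 hw))⟩

theorem IsOrdinalSumDecomposition.ncard_ordinalCuts {k : ℕ} {f : α → Fin k}
    (hf : IsOrdinalSumDecomposition f) : (ordinalCuts α).ncard = k := by
  have hle : ∀ i j, {x | f x ≤ i} = {x | f x ≤ j} → i ≤ j := fun i j hij => by
    obtain ⟨x, rfl⟩ := (hf.2 i).1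
    exact hij.le (le_refl (f x))
  have hinj : Function.Injective fun i : Fin k => {x | f x ≤ i} :=
    fun i j hij => (hle i j hij).antisymm (hle j i hij.symm)
  rw [hf.ordinalCuts_eq, ← Set.image_univ, Set.ncard_image_of_injective _ hinj, Set.ncard_univ,
    Nat.card_fin]

variable (α) in
theorem exists_isOrdinalSumDecomposition [Finite α] :
    ∃ (k : ℕ) (f : α → Fin k), IsOrdinalSumDecomposition f := by
  classical
  have := Fintype.ofFinite α
  let ranks := Finset.univ.image (cutRank (α := α))
  let iso := ranks.orderIsoOfFin rfl
  let f : α → Fin ranks.card := fun x =>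
    iso.symm ⟨cutRank x, Finset.mem_image_of_mem _ (Finset.mem_univ x)⟩
  have hf : ∀ x y, f x < f y ↔ ∃ D ∈ ordinalCuts α, x ∈ D ∧ y ∉ D := fun x y => by
    simp only [f, OrderIso.lt_iff_lt, Subtype.mk_lt_mk, cutRank_lt_iff]
  have hlt : ∀ x y, f x < f y → x < y := fun x y h => by
    obtain ⟨D, hD, hx, hy⟩ := (hf x y).1 h
    exact hD.2 x hx y hy
  refine ⟨ranks.card, f, hlt, fun i => ⟨?_, ?_⟩⟩
  · obtain ⟨x, -, hx⟩ := Finset.mem_image.1 (iso i).2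
    exact ⟨⟨x, iso.symm_apply_eq.2 (Subtype.ext hx)⟩⟩
  · -- A lower part `E` of the summand `i` would give a new cut, the union of `E` and all lower
    -- summands.
    rintro ⟨E, ⟨u, hu⟩, ⟨w, hw⟩, hE⟩
    refine ((hf u w).2 ⟨{x | f x < i ∨ ∃ hx : f x = i, ⟨x, hx⟩ ∈ E},
      ⟨⟨u, Or.inr ⟨u.2, hu⟩⟩, fun x hx y hy => ?_⟩, Or.inr ⟨u.2, hu⟩, ?_⟩).ne (u.2.trans w.2.symm)
    · simp only [Set.mem_ofPred_eq, not_or, not_lt, not_exists] at hx hy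
      rcases hy.1.eq_or_lt with rfl | hiy
      · rcases hx with hx | ⟨hx, hxE⟩
        exacts [hlt _ _ hx, hE ⟨x, hx⟩ hxE ⟨y, rfl⟩ (hy.2 rfl)]
      · exact hlt _ _ (lt_of_le_of_lt (hx.elim le_of_lt fun hx => hx.1.le) hiy)
    · rintro (hlt | ⟨_, hwE⟩)
      exacts [hlt.ne w.2, hw hwE]

theorem ssd_eq_ncard_ordinalCuts [Finite α] : ssd α = (ordinalCuts α).ncard := by
  obtain ⟨k, f, hf⟩ := exists_isOrdinalSumDecomposition α
  have hset : {k | ∃ f : α → Fin k, IsOrdinalSumDecomposition f} = {(ordinalCuts α).ncard} := by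
    ext j
    constructor
    · rintro ⟨f, hf⟩
      exact hf.ncard_ordinalCuts.symm
    · rintro rfl
      exact hf.ncard_ordinalCuts ▸ ⟨f, hf⟩
  rw [ssd, hset, csSup_singleton]

end OrdinalSum

section Poset

variable {α : Type} [PartialOrder α] {n : ℕ} {v : α ≃ Fin n} {e : ℕ → ℕ}

theorem card_filter_Icc_one {n : ℕ} (p : ℕ → Prop) [DecidablePred p] (h0 : p 0) (hn : p n) :
    ((Finset.Icc 1 n).filter p).card = ((Finset.range n).filter p).card := by
  have hinsert_zero : (Finset.range (n + 1)).filter p = insert 0 ((Finset.Icc 1 n).filter p) := by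
    have : Finset.range (n + 1) = insert 0 (Finset.Icc 1 n) := by
      ext x
      simp only [Finset.mem_range, Finset.mem_insert, Finset.mem_Icc]
      omega
    rw [this, Finset.filter_insert, if_pos h0]
  have hinsert_last : (Finset.range (n + 1)).filter p = insert n ((Finset.range n).filter p) := by
    rw [Finset.range_add_one, Finset.filter_insert, if_pos hn]
  have hcard := congrArg Finset.card (hinsert_zero.symm.trans hinsert_last)
  rw [Finset.card_insert_of_notMem (by simp), Finset.card_insert_of_notMem (by simp)] at hcard
  exact Nat.succ_injective hcard

theorem IsCode.cutCount_eq_card_Icc (he : IsCode n e) :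
    cutCount n e = ((Finset.Icc 1 n).filter fun i => ∀ y < i, e y ≤ i).card :=
  (card_filter_Icc_one _ (by simp) fun _ _ => he.apply_le).symm

namespace EncodesPoset

theorem setOf_lt_mem_ordinalCuts_iff (h : EncodesPoset v e) {i : ℕ} (hi : 1 ≤ i) (hin : i ≤ n) :
    {x | (v x : ℕ) < i} ∈ ordinalCuts α ↔ ∀ y < i, e y ≤ i := by
  constructor
  · rintro ⟨-, hD⟩ y hy
    rcases hin.lt_or_eq with hlt | rfl
    · have := hD (v.symm ⟨y, hy.trans hlt⟩) (by simpa) (v.symm ⟨i, hlt⟩) (by simp)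
      simpa [h.lt_iff] using this
    · exact h.isCode.apply_le
  · intro hcut
    exact ⟨⟨v.symm ⟨0, by omega⟩, by simpa⟩,
      fun x hx y hy => (h.lt_iff x y).2 ((hcut _ hx).trans (not_lt.1 hy))⟩

theorem exists_eq_setOf_lt (h : EncodesPoset v e) {D : Set α} (hD : D ∈ ordinalCuts α) :
    ∃ i, 1 ≤ i ∧ i ≤ n ∧ {x | (v x : ℕ) < i} = D := by
  have : Finite α := Finite.of_equiv _ v.symm
  obtain ⟨x, hx, hmax⟩ := Set.exists_max_image D v (Set.toFinite D) hD.1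
  refine ⟨v x + 1, by omega, (v x).2, Set.ext fun y =>
    ⟨fun hy => ?_, fun hy => Nat.lt_succ_of_le (hmax y hy)⟩⟩
  by_contra hyD
  have hxy := (h.lt_iff _ _).1 (hD.2 x hx y hyD)
  have hlt := (h.isCode.1 _ (v x).2).1
  have hyx : (v y : ℕ) ≤ v x := Nat.lt_succ_iff.1 hy
  omega

theorem ncard_ordinalCuts (h : EncodesPoset v e) : (ordinalCuts α).ncard = cutCount n e := by
  have himage : ordinalCuts α = (fun i : ℕ => {x : α | (v x : ℕ) < i}) ''
      ((Finset.Icc 1 n).filter fun i => ∀ y < i, e y ≤ i : Finset ℕ) := by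
    ext D
    simp only [Finset.coe_filter, Finset.mem_Icc, Set.mem_image, Set.mem_ofPred_eq]
    constructor
    · intro hD
      obtain ⟨i, hi, hin, rfl⟩ := h.exists_eq_setOf_lt hD
      exact ⟨i, ⟨⟨hi, hin⟩, (h.setOf_lt_mem_ordinalCuts_iff hi hin).1 hD⟩, rfl⟩
    · rintro ⟨i, ⟨⟨hi, hin⟩, hcut⟩, rfl⟩
      exact (h.setOf_lt_mem_ordinalCuts_iff hi hin).2 hcut
  have hle : ∀ i j, 1 ≤ i → i ≤ n → {x : α | (v x : ℕ) < i} = {x | (v x : ℕ) < j} → i ≤ j := by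
    intro i j hi hin hij
    have : v.symm ⟨i - 1, by omega⟩ ∈ {x : α | (v x : ℕ) < j} := by
      rw [← hij, Set.mem_ofPred_eq, Equiv.apply_symm_apply]
      exact Nat.sub_lt hi one_pos
    rw [Set.mem_ofPred_eq, Equiv.apply_symm_apply] at this
    exact Nat.le_of_pred_lt this
  rw [himage, Set.InjOn.ncard_image, Set.ncard_coe_finset, h.isCode.cutCount_eq_card_Icc]
  intro i hi j hj hij
  simp only [Finset.coe_filter, Finset.mem_Icc, Set.mem_ofPred_eq] at hi hj
  exact (hle i j hi.1.1 hi.1.2 hij).antisymm (hle j i hj.1.1 hj.1.2 hij.symm)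

theorem ssd_eq (h : EncodesPoset v e) : ssd α = cutCount n e := by
  have : Finite α := Finite.of_equiv _ v.symm
  rw [ssd_eq_ncard_ordinalCuts, h.ncard_ordinalCuts]

end EncodesPoset

/-! ### Shortest maximal chains of **N**-free posets -/

/-- The elements of an encoded poset whose label lies in no interval `[y, e y)` with a smaller `y`:
in the forest encoded by a noncrossing code, these are the roots. -/
def cutPoints {γ : Type} (v : γ ≃ Fin n) (e : ℕ → ℕ) : Set γ := {x | ∀ y < (v x : ℕ), e y ≤ v x}

theorem ncard_cutPoints {γ : Type} {v : γ ≃ Fin n} : (cutPoints v e).ncard = cutCount n e := by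
  rw [cutCount, ← card_subtype_eq_card_filter v]
  rfl

theorem IsNoncrossingCode.exists_cut_le (he : IsNoncrossingCode n e) {z : ℕ} (hz : z < n) :
    ∃ r ≤ z, (∀ y < r, e y ≤ r) ∧ z < e r := by
  classical
  let r := Nat.findGreatest (fun r => ∀ y < r, e y ≤ r) z
  have hrz : r ≤ z := Nat.findGreatest_le _
  have hr : ∀ y < r, e y ≤ r :=
    Nat.findGreatest_spec (P := fun r => ∀ y < r, e y ≤ r) (Nat.zero_le _) (by simp)
  have hlt : r < e r := (he.1.1 r (hrz.trans_lt hz)).1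
  refine ⟨r, hrz, hr, ?_⟩
  by_contra! hle
  refine Nat.findGreatest_is_greatest (P := fun r => ∀ y < r, e y ≤ r) hlt hle fun y hy => ?_
  rcases lt_trichotomy y r with hyr | rfl | hyr
  · exact (hr y hyr).trans hlt.le
  · exact le_rfl
  · exact he.2 r y hyr hy

namespace EncodesPoset

theorem lt_of_mem_cutPoints (h : EncodesPoset v e) {x y : α} (hx : x ∈ cutPoints v e)
    (hy : v y < v x) : y < x :=
  (h.lt_iff y x).2 (hx _ hy)

theorem isChain_cutPoints (h : EncodesPoset v e) : IsChain (· ≤ ·) (cutPoints v e) := by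
  intro x hx y hy hxy
  rcases lt_or_gt_of_ne (v.injective.ne hxy) with hlt | hlt
  · exact Or.inl (h.lt_of_mem_cutPoints hy hlt).le
  · exact Or.inr (h.lt_of_mem_cutPoints hx hlt).le

theorem isMaxChain_cutPoints (h : EncodesPoset v e) (he : IsNoncrossingCode n e) :
    IsMaxChain (· ≤ ·) (cutPoints v e) := by
  refine ⟨h.isChain_cutPoints, fun t ht hsub => hsub.antisymm fun z hz => ?_⟩
  obtain ⟨r, hrz, hr, hzr⟩ := he.exists_cut_le (v z).2
  have hrn := hrz.trans_lt (v z).2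
  have hmem : v.symm ⟨r, hrn⟩ ∈ cutPoints v e := by simpa [cutPoints] using hr
  have hle := ht.total (hsub hmem) hz
  simp only [h.le_iff, Equiv.apply_symm_apply] at hle
  have := (h.isCode.1 _ (v z).2).1
  have heq : v.symm ⟨r, hrn⟩ = z := v.symm_apply_eq.2 (Fin.ext (by dsimp only; omega))
  exact heq ▸ hmem

theorem exists_mem_layer (h : EncodesPoset v e) {s : Set α} (hs : IsMaxChain (· ≤ ·) s) {x : α}
    (hx : x ∈ cutPoints v e) : ∃ z ∈ s, (v x : ℕ) ≤ v z ∧ (v z : ℕ) < e (v x) := by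
  by_contra! hcon
  have hins : IsChain (· ≤ ·) (insert x s) := by
    refine hs.1.insert fun z hz _ => ?_
    rcases lt_or_ge (v z : ℕ) (v x) with hlt | hge
    · exact Or.inr (h.lt_of_mem_cutPoints hx hlt).le
    · exact Or.inl ((h.lt_iff _ _).2 (hcon z hz hge)).le
  have hxs : x ∈ s := by
    rw [hs.2 hins (Set.subset_insert _ _)]
    exact Set.mem_insert _ _
  exact absurd (h.isCode.1 _ (v x).2).1 (hcon x hxs le_rfl).not_gt

theorem ncard_cutPoints_le (h : EncodesPoset v e) {s : Set α} (hs : IsMaxChain (· ≤ ·) s) :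
    (cutPoints v e).ncard ≤ s.ncard := by
  have : Finite α := Finite.of_equiv _ v.symm
  choose! φ hφs hφ using fun x (hx : x ∈ cutPoints v e) => h.exists_mem_layer hs hx
  refine Set.ncard_le_ncard_of_injOn φ hφs ?_
  have hle : ∀ x ∈ cutPoints v e, ∀ y ∈ cutPoints v e, φ x = φ y → v x ≤ v y := by
    intro x hx y hy hxy
    by_contra! hlt
    have hlayer := (hφ x hx).1
    rw [hxy] at hlayer
    exact absurd ((hφ y hy).2.trans_le ((hx _ hlt).trans hlayer)) (lt_irrefl _)
  exact fun x hx y hy hxy => v.injective ((hle x hx y hy hxy).antisymm (hle y hy x hx hxy.symm))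

theorem smc_eq (h : EncodesPoset v e) (he : IsNoncrossingCode n e) : smc α = cutCount n e := by
  rw [← ncard_cutPoints (v := v)]
  refine le_antisymm (Nat.sInf_le ⟨_, h.isMaxChain_cutPoints he, rfl⟩) ?_
  refine le_csInf ⟨_, _, h.isMaxChain_cutPoints he, rfl⟩ ?_
  rintro k ⟨s, hs, rfl⟩
  exact h.ncard_cutPoints_le hs

end EncodesPoset

end Poset

/-! ### The two classes of posets -/

section PosetClass

variable {n : ℕ} {e e' : ℕ → ℕ}

/-- The function `u ↦ -u`: sorting by it puts points with large up-sets first. -/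
def negCast (u : ℕ) : ℤ := -(u : ℤ)

theorem negCast_injective : Function.Injective negCast := fun a b h => by
  simpa [negCast] using h

theorem IsCode.negCast_le_iff (he : IsCode n e) (x y : ℕ) :
    negCast (n - e x) ≤ negCast (n - e y) ↔ e x ≤ e y := by
  have := he.apply_le (x := x)
  have := he.apply_le (x := y)
  simp only [negCast]
  omega

theorem IsCode.natCast_le_iff (he : IsCode n e) (x y : ℕ) :
    ((n - e x : ℕ) : ℤ) ≤ (n - e y : ℕ) ↔ e y ≤ e x := by
  have := he.apply_le (x := x)
  have := he.apply_le (x := y)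
  omega

theorem isMonotoneCode_iff :
    IsMonotoneCode n e ↔ IsCode n e ∧ TieSorted negCast n e ∧ ¬ HasThreePlusOne n e := by
  constructor
  · refine fun h => ⟨h.1, fun x y hxy hy _ => (h.1.negCast_le_iff x y).2 (h.2 x y hxy hy), ?_⟩
    rintro ⟨a, b, c, d, hb, _, hda, hab, hbc, hcd, _⟩
    exact absurd (hbc.trans_lt hcd) (h.2 d b (hda.trans_le hab) hb).not_gt
  · refine fun ⟨he, hsorted, hfree⟩ => ⟨he, fun x y hxy hy => ?_⟩
    by_contra! hlt
    obtain ⟨z, _, hxz, hzy⟩ : ∃ z < n, x < e z ∧ e z ≤ y := by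
      by_contra!
      exact hlt.not_ge ((he.negCast_le_iff x y).1 (hsorted x y hxy hy this))
    exact hfree ⟨z, y, e y, x, hy, hlt.trans_le he.apply_le, hxz, hzy, le_rfl, hlt, hxy.trans hy⟩

theorem isNoncrossingCode_iff :
    IsNoncrossingCode n e ↔ IsCode n e ∧ TieSorted Nat.cast n e ∧ ¬ HasN n e := by
  constructor
  · refine fun h => ⟨h.1, fun x y hxy hy hz => (h.1.natCast_le_iff x y).2 (h.2 x y hxy ?_), ?_⟩
    · exact hz x (hxy.trans hy) (h.1.1 x (hxy.trans hy)).1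
    · rintro ⟨a, b, c, d, _, hba, hac, hcb, hbd, hdc⟩
      exact absurd (hbd.trans_lt hdc) (h.2 b c (hba.trans_le hac) hcb).not_gt
  · refine fun ⟨he, hsorted, hfree⟩ => ⟨he, fun x y hxy hy => ?_⟩
    by_contra! hlt
    obtain ⟨z, _, hxz, hzy⟩ : ∃ z < n, x < e z ∧ e z ≤ y := by
      by_contra!
      exact hlt.not_ge ((he.natCast_le_iff x y).1 (hsorted x y hxy (hy.trans_le he.apply_le) this))
    exact hfree ⟨z, x, y, e x, hlt.trans_le he.apply_le, hxz, hzy, hy, le_rfl, hlt⟩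

/-- The type `{0, …, n - 1}`, ordered as the poset encoded by `e`. -/
def IsCode.Poset (_ : IsCode n e) : Type := Fin n

instance IsCode.partialOrder (he : IsCode n e) : PartialOrder he.Poset where
  le := fun x y : Fin n => x = y ∨ e x ≤ y
  lt := fun x y : Fin n => e x ≤ y
  le_refl _ := Or.inl rfl
  le_trans := by
    rintro (x y z : Fin n) (rfl | hxy) (rfl | hyz)
    exacts [Or.inl rfl, Or.inr hyz, Or.inr hxy, Or.inr (hxy.trans ((he.1 y y.2).1.le.trans hyz))]
  lt_iff_le_not_ge := fun (x y : Fin n) => by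
    have hx := (he.1 x x.2).1
    have hy := (he.1 y y.2).1
    constructor
    · refine fun hxy => ⟨Or.inr hxy, ?_⟩
      rintro (rfl | hyx) <;> omega
    · rintro ⟨rfl | hxy, hyx⟩
      exacts [absurd (Or.inl rfl) hyx, hxy]
  le_antisymm := fun (x y : Fin n) => by
    have hx := (he.1 x x.2).1
    have hy := (he.1 y y.2).1
    rintro (rfl | hxy) (hyx | hyx)
    exacts [rfl, rfl, hyx.symm, by omega]

theorem IsCode.encodesPoset (he : IsCode n e) :
    EncodesPoset (α := he.Poset) (Equiv.refl (Fin n)) e where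
  isCode := he
  lt_iff _ _ := Iff.rfl

/-- The isomorphism class of the poset encoded by `e`. -/
def IsCode.posetClass (he : IsCode n e) : PosetClass n :=
  Quotient.mk (posetSetoid n) he.partialOrder

theorem IsCode.minCount_posetClass (he : IsCode n e) : he.posetClass.minCount = bottomCount n e :=
  he.encodesPoset.minCount_eq

theorem IsCode.ssd_posetClass (he : IsCode n e) : he.posetClass.ssd = cutCount n e :=
  he.encodesPoset.ssd_eq

theorem IsNoncrossingCode.smc_posetClass (he : IsNoncrossingCode n e) :
    he.1.posetClass.smc = cutCount n e :=
  he.1.encodesPoset.smc_eq he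

theorem IsCode.eq_of_posetClass_eq {g : ℕ → ℤ} (hg : Function.Injective g) (he : IsCode n e)
    (he' : IsCode n e') (ht : TieSorted g n e) (ht' : TieSorted g n e')
    (h : he.posetClass = he'.posetClass) : e = e' := by
  obtain ⟨f⟩ : Nonempty (he.Poset ≃o he'.Poset) := Quotient.exact h
  exact he.encodesPoset.eq_of_tieSorted hg (he'.encodesPoset.congr f) ht ht'

theorem exists_poset_orderIso {α : Type} [PartialOrder α] (g : ℕ → ℤ) (w : α ≃ Fin n)
    (h : IsFreeOf α TwoPlusTwo) :
    ∃ e, ∃ he : IsCode n e, TieSorted g n e ∧ Nonempty (he.Poset ≃o α) := by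
  obtain ⟨v, e, hv, ht⟩ := exists_encodesPoset_tieSorted g w h
  let f : α ≃o hv.isCode.Poset :=
    { toEquiv := v
      map_rel_iff' := fun {x y} => (or_congr Fin.ext_iff Iff.rfl).trans (hv.le_iff x y).symm }
  exact ⟨e, hv.isCode, ht, ⟨f.symm⟩⟩

theorem PosetClass.exists_posetClass_eq (g : ℕ → ℤ) (p : PosetClass n)
    (hp : p.IsFreeOf TwoPlusTwo) :
    ∃ e, ∃ he : IsCode n e, TieSorted g n e ∧ he.posetClass = p := by
  obtain ⟨R, rfl⟩ := Quotient.exists_rep p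
  obtain ⟨e, he, ht, hiso⟩ := @exists_poset_orderIso n (Fin n) R g (Equiv.refl _) hp
  exact ⟨e, he, ht, Quotient.sound hiso⟩

theorem genFun_posetAvoiding {Q : Type} [PartialOrder Q] {g : ℕ → ℤ} (hg : Function.Injective g)
    {H : ℕ → (ℕ → ℕ) → Prop} {P : ℕ → (ℕ → ℕ) → Prop} [∀ n, Finite {e // P n e}]
    (hP : ∀ n e, P n e ↔ IsCode n e ∧ TieSorted g n e ∧ ¬ H n e)
    (hH : ∀ n e (he : IsCode n e), IsFreeOf he.Poset Q ↔ ¬ H n e) (stat : ∀ n, PosetClass n → ℕ)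
    (hstat : ∀ n e (he : IsCode n e), P n e → stat n he.posetClass = cutCount n e) :
    genFun (PosetAvoiding Q) (fun _ p => p.1.minCount) (fun n p => stat n p.1) =
      genFun (fun n => {e // P n e}) (fun n e => bottomCount n e.1)
        (fun n e => cutCount n e.1) := by
  have isCode {n e} (he : P n e) : IsCode n e := ((hP n e).1 he).1
  refine (genFun_congr (T := fun n => {e // P n e}) (S := PosetAvoiding Q)
    (fun n e => ⟨(isCode e.2).posetClass, (isCode e.2).encodesPoset.isFreeOf_twoPlusTwo,
      (hH n e.1 (isCode e.2)).2 ((hP n e.1).1 e.2).2.2⟩) (fun n => ⟨?_, ?_⟩)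
    (fun n e => (isCode e.2).minCount_posetClass)
    fun n e => hstat n e.1 (isCode e.2) e.2).symm
  · rintro ⟨e, he⟩ ⟨e', he'⟩ h
    exact Subtype.ext ((isCode he).eq_of_posetClass_eq hg (isCode he') ((hP n e).1 he).2.1
      ((hP n e').1 he').2.1 (congrArg Subtype.val h))
  · rintro ⟨p, hp⟩
    obtain ⟨e, he, ht, rfl⟩ := p.exists_posetClass_eq g hp.1
    exact ⟨⟨e, (hP n e).2 ⟨he, ht, (hH n e he).1 hp.2⟩⟩, rfl⟩

theorem genPosetThreePlusOne_eq : genPosetThreePlusOne =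
    genFun (fun n => {e // IsMonotoneCode n e}) (fun n e => bottomCount n e.1)
      (fun n e => cutCount n e.1) :=
  genFun_posetAvoiding negCast_injective (fun _ _ => isMonotoneCode_iff)
    (fun _ _ he => he.encodesPoset.isFreeOf_threePlusOne_iff) (fun _ p => p.ssd)
    fun _ _ he _ => he.ssd_posetClass

theorem genPosetN_eq : genPosetN =
    genFun (fun n => {e // IsNoncrossingCode n e}) (fun n e => bottomCount n e.1)
      (fun n e => cutCount n e.1) :=
  genFun_posetAvoiding Nat.cast_injective (fun _ _ => isNoncrossingCode_iff)
    (fun _ _ he => he.encodesPoset.isFreeOf_posetN_iff) (fun _ p => p.smc)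
    fun _ _ _ h => h.smc_posetClass

/-- The codes of **N**-free posets that are sorted as the monotone codes are. They describe the
Stoimenow matchings without the second pattern. -/
def IsSortedNFree (n : ℕ) (e : ℕ → ℕ) : Prop :=
  IsCode n e ∧ TieSorted negCast n e ∧ ¬ HasN n e

instance (n : ℕ) : Finite {e // IsSortedNFree n e} :=
  finite_subtype_of_bounded n fun _ h => ⟨fun _ _ => h.1.apply_le, h.1.2⟩

theorem genFun_isSortedNFree :
    genFun (fun n => {e // IsSortedNFree n e}) (fun n e => bottomCount n e.1)
        (fun n e => cutCount n e.1) =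
      genFun (fun n => {e // IsNoncrossingCode n e}) (fun n e => bottomCount n e.1)
        (fun n e => cutCount n e.1) := by
  have hfree := fun n e (he : IsCode n e) => he.encodesPoset.isFreeOf_posetN_iff
  -- Both families are transversals of the same isomorphism classes, for different orders of ties.
  exact (genFun_posetAvoiding negCast_injective (P := IsSortedNFree) (fun _ _ => Iff.rfl) hfree
    (fun _ p => p.ssd) fun _ _ he _ => he.ssd_posetClass).symm.trans
    (genFun_posetAvoiding Nat.cast_injective (fun _ _ => isNoncrossingCode_iff) hfree
    (fun _ p => p.ssd) fun _ _ he _ => he.ssd_posetClass)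

end PosetClass

/-! ### Ascent sequences that avoid `101` -/

theorem containsPattern_101_iff {n : ℕ} (w : Fin n → ℕ) :
    ContainsPattern w ![1, 0, 1] ↔ ∃ i j k, i < j ∧ j < k ∧ w i = w k ∧ w j < w i := by
  constructor
  · rintro ⟨f, hf⟩
    have hle : ¬ w (f 0) < w (f 2) := fun h => by simpa using (hf 0 2).2 h
    have hge : ¬ w (f 2) < w (f 0) := fun h => by simpa using (hf 2 0).2 h
    exact ⟨f 0, f 1, f 2, by simp, by simp, by omega, by simpa using hf 1 0⟩
  · rintro ⟨i, j, k, hij, hjk, heq, hlt⟩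
    have hmono : StrictMono ![i, j, k] := by
      refine Fin.strictMono_iff_lt_succ.2 fun a => ?_
      fin_cases a <;> simpa
    refine ⟨OrderEmbedding.ofStrictMono _ hmono, fun a b => ?_⟩
    fin_cases a <;> fin_cases b <;> simp <;> omega

theorem not_containsPattern_101_iff {n : ℕ} {α : ℕ → ℕ} :
    ¬ ContainsPattern (fun i : Fin n => α i) ![1, 0, 1] ↔
      ∀ x y z, x < y → y < z → z < n → α x = α z → α x ≤ α y := by
  rw [containsPattern_101_iff]
  constructor
  · intro h x y z hxy hyz hz heq
    by_contra! hlt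
    exact h ⟨⟨x, by omega⟩, ⟨y, by omega⟩, ⟨z, hz⟩, hxy, hyz, heq, hlt⟩
  · rintro h ⟨i, j, k, hij, hjk, heq, hlt⟩
    exact hlt.not_ge (h i j k hij hjk k.2 heq)

/-- The positions before `x` of the ascent tops of `α`, that is, the `k < x` with
`α (k - 1) < α k`. -/
def ascentTops (α : ℕ → ℕ) (x : ℕ) : Finset ℕ :=
  (Finset.range x).filter fun k => 0 < k ∧ α (k - 1) < α k

theorem mem_ascentTops {α : ℕ → ℕ} {x k : ℕ} :
    k ∈ ascentTops α x ↔ k < x ∧ 0 < k ∧ α (k - 1) < α k := by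
  simp only [ascentTops, Finset.mem_filter, Finset.mem_range]

theorem ascBefore_eq {n : ℕ} (α : ℕ → ℕ) (i : Fin n) :
    ascBefore (fun j : Fin n => α j) i = (ascentTops α i).card := by
  have hfilter : ascentTops α i =
      (Finset.range n).filter fun k => k < (i : ℕ) ∧ 0 < k ∧ α (k - 1) < α k := by
    ext k
    rw [mem_ascentTops, Finset.mem_filter, Finset.mem_range]
    exact ⟨fun h => ⟨h.1.trans i.2, h⟩, fun h => h.2⟩
  rw [hfilter, ← card_subtype_eq_card_filter (Equiv.refl (Fin n))]
  refine Nat.card_congr (Equiv.subtypeEquivRight fun k => and_congr Iff.rfl ?_)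
  rw [Equiv.refl_apply]
  constructor
  · rintro ⟨j, hj, hlt⟩
    rw [hj, Nat.add_sub_cancel, ← hj]
    exact ⟨by omega, hlt⟩
  · rintro ⟨hpos, hlt⟩
    exact ⟨⟨k - 1, by omega⟩, by simp only; omega, hlt⟩

theorem injOn_ascentTops {n x : ℕ} {α : ℕ → ℕ} (hx : x ≤ n)
    (havoid : ∀ x y z, x < y → y < z → z < n → α x = α z → α x ≤ α y) :
    Set.InjOn α (ascentTops α x) := by
  have hnot_lt : ∀ k ∈ ascentTops α x, ∀ l ∈ ascentTops α x, α k = α l → ¬ k < l := by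
    intro k _ l hl heq hlt
    obtain ⟨hlx, -, hasc⟩ := mem_ascentTops.1 hl
    rcases (Nat.le_sub_one_of_lt hlt).lt_or_eq with hlt' | rfl
    · have := havoid k (l - 1) l hlt' (by omega) (by omega) heq
      omega
    · omega
  exact fun k hk l hl heq =>
    le_antisymm (not_lt.1 (hnot_lt l hl k hk heq.symm)) (not_lt.1 (hnot_lt k hk l hl heq))

theorem card_ascentTops_lt {n x v : ℕ} {α : ℕ → ℕ} (hx : x ≤ n) (hx0 : x ≠ 0) (hα0 : α 0 = 0)
    (hrgf : ∀ y < x, ∀ v < α y, ∃ z < y, α z = v)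
    (havoid : ∀ x y z, x < y → y < z → z < n → α x = α z → α x ≤ α y)
    (hv : ∀ y < x, α y ≠ v) : (ascentTops α x).card < v := by
  have hv0 : v ≠ 0 := fun h => hv 0 (by omega) (hα0.trans h.symm)
  have hmaps : ∀ k ∈ ascentTops α x, α k ∈ Finset.Ico 1 v := by
    intro k hk
    obtain ⟨hkx, -, hasc⟩ := mem_ascentTops.1 hk
    refine Finset.mem_Ico.2 ⟨by omega, ?_⟩
    by_contra! hle
    rcases hle.lt_or_eq with hlt | heq
    · obtain ⟨z, hz, hzv⟩ := hrgf k hkx v hlt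
      exact hv z (hz.trans hkx) hzv
    · exact hv k hkx heq.symm
  have hcard := Finset.card_le_card_of_injOn α hmaps (injOn_ascentTops hx havoid)
  rw [Nat.card_Ico] at hcard
  omega

theorem IsRGFAvoiding101.le_card_ascentTops {n x : ℕ} {α : ℕ → ℕ} (h : IsRGFAvoiding101 n α)
    (hx : x < n) : α x ≤ 1 + (ascentTops α x).card := by
  classical
  -- The first occurrence of every positive value is an ascent top.
  have hsub : Finset.Ico 1 (α x) ⊆ (ascentTops α x).image α := by
    intro v hv
    rw [Finset.mem_Ico] at hv
    have hex := h.1 x hx v hv.2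
    obtain ⟨hy, hyv⟩ := Nat.find_spec hex
    have hmin := fun z => Nat.find_min (m := z) hex
    set y := Nat.find hex
    have hy0 : y ≠ 0 := by
      intro hy0
      have := h.apply_le y (by omega)
      omega
    refine Finset.mem_image.2 ⟨y, mem_ascentTops.2 ⟨hy, by omega, ?_⟩, hyv⟩
    by_contra! hle
    rcases hle.lt_or_eq with hlt | heq
    · obtain ⟨z, hz, hzv⟩ := h.1 (y - 1) (by omega) (α y) hlt
      exact hmin z (by omega) ⟨by omega, hzv.trans hyv⟩
    · exact hmin (y - 1) (by omega) ⟨by omega, heq.symm.trans hyv⟩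
  have hcard := (Finset.card_le_card hsub).trans Finset.card_image_le
  rw [Nat.card_Ico] at hcard
  omega

theorem isRGFAvoiding101_iff {n : ℕ} {α : ℕ → ℕ} (hα : ∀ x, n ≤ x → α x = 0) :
    IsRGFAvoiding101 n α ↔ IsAscentSequence (fun i : Fin n => α i) ∧
      ¬ ContainsPattern (fun i : Fin n => α i) ![1, 0, 1] := by
  rw [not_containsPattern_101_iff]
  constructor
  · refine fun h => ⟨fun i => ⟨fun hi => ?_, fun _ => ?_⟩, h.2.1⟩
    · exact Nat.le_zero.1 ((h.apply_le i i.2).trans_eq hi)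
    · rw [ascBefore_eq]
      exact h.le_card_ascentTops i.2
  · rintro ⟨hasc, havoid⟩
    refine ⟨fun x => ?_, havoid, hα⟩
    induction x using Nat.strong_induction_on with
    | _ x ih =>
      intro hx v hv
      by_contra! hno
      have hα0 : α 0 = 0 := (hasc ⟨0, by omega⟩).1 rfl
      have hx0 : x ≠ 0 := by
        rintro rfl
        omega
      have hbound : α x ≤ 1 + (ascentTops α x).card :=
        (ascBefore_eq α ⟨x, hx⟩) ▸ (hasc ⟨x, hx⟩).2 hx0
      have := card_ascentTops_lt hx.le hx0 hα0 (fun y hy => ih y hy (hy.trans hx)) havoid hno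
      omega

theorem genAscent_eq : genAscent = genFun (fun n => {α // IsRGFAvoiding101 n α})
    (fun n α => zeroNumber n α.1) (fun n α => rminNumber n α.1) := by
  refine (genFun_congr (T := fun n => {α // IsRGFAvoiding101 n α})
    (S := AscentAvoiding ![1, 0, 1])
    (fun n α => ⟨fun i => α.1 i, (isRGFAvoiding101_iff α.2.2.2).1 α.2⟩) (fun n => ⟨?_, ?_⟩)
    (fun n α => ?_) fun n α => ?_).symm
  · rintro ⟨α, hα⟩ ⟨β, hβ⟩ h
    refine Subtype.ext (funext fun x => ?_)
    by_cases hx : x < n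
    · exact congrFun (congrArg Subtype.val h) ⟨x, hx⟩
    · exact (hα.2.2 x (not_lt.1 hx)).trans (hβ.2.2 x (not_lt.1 hx)).symm
  · rintro ⟨w, hw⟩
    let α : ℕ → ℕ := fun x => if hx : x < n then w ⟨x, hx⟩ else 0
    have hα : (fun i : Fin n => α i) = w := by
      funext i
      exact dif_pos i.2
    refine ⟨⟨α, (isRGFAvoiding101_iff fun x hx => dif_neg hx.not_gt).2 ?_⟩, Subtype.ext hα⟩
    rwa [hα]
  · exact card_subtype_eq_card_filter (Equiv.refl (Fin n)) fun x => α.1 x = 0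
  · rw [rminNumber, ← card_subtype_eq_card_filter (Equiv.refl (Fin n))]
    refine Nat.card_congr (Equiv.subtypeEquivRight fun i => ?_)
    exact ⟨fun h y hy hiy => h ⟨y, hy⟩ hiy, fun h j hj => h j j.2 hj⟩

/-! ### Fishburn permutations that avoid `3142` -/

/-- The permutation has no subsequence order-isomorphic to `231`. -/
def Avoids231 {n : ℕ} (π : Equiv.Perm (Fin n)) : Prop :=
  ∀ i j k, i < j → j < k → π k < π i → π j < π i

theorem exists_consecutive_values_of_231 {n : ℕ} {π : Equiv.Perm (Fin n)} {i j k : Fin n}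
    (hij : i < j) (hjk : j < k) (hki : π k < π i) (hlt : π i < π j) :
    ∃ p q, p < j ∧ j < q ∧ (π q : ℕ) + 1 = π p ∧ π p < π j := by
  -- `π p` is the least value before position `j` that exceeds `π k`.
  obtain ⟨p, hp, hmin⟩ := (Finset.univ.filter fun p => p < j ∧ π k < π p).exists_min_image π
    ⟨i, by simp [hij, hki]⟩
  simp only [Finset.mem_filter, Finset.mem_univ, true_and, and_imp, Fin.lt_def, Fin.le_def]
    at hp hmin hij hjk hki hlt ⊢
  obtain ⟨hpj, hkp⟩ := hp
  obtain ⟨q, hq⟩ : ∃ q, (π q : ℕ) = π p - 1 := ⟨π.symm ⟨π p - 1, by omega⟩, by simp⟩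
  have hpi := hmin i hij hki
  have hqj : (j : ℕ) ≠ q := by
    intro h
    rw [← Fin.ext h] at hq
    omega
  refine ⟨p, q, hpj, lt_of_le_of_ne (not_lt.1 fun hlt => ?_) hqj, by omega, by omega⟩
  have hqk : (π q : ℕ) ≠ π k := fun h => by
    rw [π.injective (Fin.ext h)] at hlt
    omega
  have := hmin q hlt (by omega)
  omega

theorem avoids231_of_isFishburn {n : ℕ} {π : Equiv.Perm (Fin n)} (hF : IsFishburn π)
    (havoid : ¬ ContainsPattern π ![3, 1, 4, 2]) : Avoids231 π := by
  intro i j k hij hjk hki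
  refine lt_of_le_of_ne (not_lt.1 fun hlt => ?_) (π.injective.ne hij.ne')
  obtain ⟨p, q, hpj, hjq, hqp, hpv⟩ := exists_consecutive_values_of_231 hij hjk hki hlt
  let p' : Fin n := ⟨p + 1, by omega⟩
  have hpp' : p < p' := Nat.lt_succ_self p
  have hp'j : p' ≤ j := hpj
  have hp'q : p' < q := hp'j.trans_lt hjq
  have hdesc : π p' < π p := lt_of_le_of_ne
    (not_lt.1 fun hasc => hF ⟨p, p', q, rfl, hp'q, hqp, hasc⟩) (π.injective.ne hpp'.ne')
  have hp'ne : (π p' : ℕ) ≠ π q := fun h => hp'q.ne (π.injective (Fin.ext h))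
  have hp'lt : p' < j := lt_of_le_of_ne hp'j fun h => hpv.not_gt (h ▸ hdesc)
  have hmono : StrictMono ![p, p', j, q] := by
    refine Fin.strictMono_iff_lt_succ.2 fun a => ?_
    fin_cases a <;> simpa
  refine havoid ⟨OrderEmbedding.ofStrictMono _ hmono, fun a b => ?_⟩
  rw [Fin.lt_def] at hpv hdesc ⊢
  fin_cases a <;> fin_cases b <;> simp [-Fin.val_fin_lt] <;> omega

theorem isFishburn_and_not_containsPattern_iff {n : ℕ} (π : Equiv.Perm (Fin n)) :
    IsFishburn π ∧ ¬ ContainsPattern π ![3, 1, 4, 2] ↔ Avoids231 π := by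
  refine ⟨fun h => avoids231_of_isFishburn h.1 h.2, fun h => ⟨?_, ?_⟩⟩
  · rintro ⟨i, i', j, hi, hij, hv, hlt⟩
    refine hlt.not_gt (h i i' j (by rw [Fin.lt_def]; omega) hij ?_)
    rw [Fin.lt_def]
    omega
  · rintro ⟨f, hf⟩
    have hlast : π (f 3) < π (f 0) := (hf 3 0).1 (by simp)
    have hmid : π (f 0) < π (f 2) := (hf 0 2).1 (by simp)
    exact hmid.not_gt (h (f 0) (f 2) (f 3) (by simp) (by simp) hlast)

/-- The code `e` records the inversions of `π`: the elements after position `x` that are smaller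
than `π x` are those before position `e x`. -/
structure EncodesPerm {n : ℕ} (π : Equiv.Perm (Fin n)) (e : ℕ → ℕ) : Prop where
  isCode : IsCode n e
  lt_iff : ∀ x y : Fin n, x < y → (π y < π x ↔ (y : ℕ) < e x)

theorem Avoids231.exists_lt_iff {n : ℕ} {π : Equiv.Perm (Fin n)} (h : Avoids231 π) (x : Fin n) :
    ∃ m : ℕ, (x < m ∧ m ≤ n) ∧ ∀ y : Fin n, x < y → (π y < π x ↔ (y : ℕ) < m) := by
  classical
  have hn : (x : ℕ) < n ∧ ∀ hm : n < n, π x < π ⟨n, hm⟩ := ⟨x.2, fun hm => absurd hm n.lt_irrefl⟩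
  have hex : ∃ m : ℕ, x < m ∧ ∀ hm : m < n, π x < π ⟨m, hm⟩ := ⟨n, hn⟩
  have hle : Nat.find hex ≤ n := Nat.find_min' hex hn
  obtain ⟨hxm, hm⟩ := Nat.find_spec hex
  have hmin := fun z => Nat.find_min (m := z) hex
  set m := Nat.find hex
  refine ⟨m, ⟨hxm, hle⟩, fun y hxy => ⟨fun hy => ?_, fun hy => ?_⟩⟩
  · by_contra! hmy
    have hmn : m < n := hmy.trans_lt y.2
    rcases hmy.lt_or_eq with hlt | heq
    · exact (hm hmn).not_gt (h x ⟨m, hmn⟩ y hxm hlt hy)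
    · exact (hm hmn).not_gt ((Fin.ext heq : (⟨m, hmn⟩ : Fin n) = y) ▸ hy)
  · have hnot := hmin y hy
    push Not at hnot
    exact lt_of_le_of_ne (hnot hxy).2 (π.injective.ne hxy.ne')

theorem Avoids231.exists_encodesPerm {n : ℕ} {π : Equiv.Perm (Fin n)} (h : Avoids231 π) :
    ∃ e, EncodesPerm π e := by
  choose e hcode hlt using h.exists_lt_iff
  refine ⟨fun x => if hx : x < n then e ⟨x, hx⟩ else 0, ⟨fun x hx => ?_, fun x hx => ?_⟩,
    fun x y hxy => ?_⟩
  · simpa only [dif_pos hx] using hcode ⟨x, hx⟩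
  · exact dif_neg hx.not_gt
  · simpa only [dif_pos x.2] using hlt x y hxy

theorem EncodesPerm.avoids231 {n : ℕ} {π : Equiv.Perm (Fin n)} {e : ℕ → ℕ}
    (h : EncodesPerm π e) : Avoids231 π := fun i j k hij hjk hki =>
  (h.lt_iff i j hij).2 (lt_trans hjk ((h.lt_iff i k (hij.trans hjk)).1 hki))

theorem EncodesPerm.isNoncrossingCode {n : ℕ} {π : Equiv.Perm (Fin n)} {e : ℕ → ℕ}
    (h : EncodesPerm π e) : IsNoncrossingCode n e := by
  refine ⟨h.isCode, fun x y hxy hy => ?_⟩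
  by_contra! hlt
  have hm : e x < n := hlt.trans_le h.isCode.apply_le
  have hyn : y < n := hy.trans hm
  have hyx := (h.lt_iff ⟨x, hxy.trans hyn⟩ ⟨y, hyn⟩ hxy).2 hy
  have hey := (h.lt_iff ⟨y, hyn⟩ ⟨e x, hm⟩ hy).2 hlt
  exact lt_irrefl _
    ((h.lt_iff ⟨x, hxy.trans hyn⟩ ⟨e x, hm⟩ (hxy.trans hy)).1 (hey.trans hyx))

theorem IsCode.eq_of_lt_iff {n : ℕ} {e e' : ℕ → ℕ} (he : IsCode n e) (he' : IsCode n e')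
    (h : ∀ x y : Fin n, x < y → ((y : ℕ) < e x ↔ (y : ℕ) < e' x)) : e = e' := by
  have hle : ∀ {e e' : ℕ → ℕ}, IsCode n e → IsCode n e' →
      (∀ x y : Fin n, x < y → ((y : ℕ) < e x → (y : ℕ) < e' x)) → ∀ x, e x ≤ e' x := by
    intro e e' he he' h x
    rcases lt_or_ge x n with hx | hx
    · by_contra! hlt
      exact lt_irrefl _ (h ⟨x, hx⟩ ⟨e' x, hlt.trans_le he.apply_le⟩ (he'.1 x hx).1 hlt)
    · exact (he.2 x hx).trans_le (Nat.zero_le _)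
  exact funext fun x => le_antisymm (hle he he' (fun x y hxy => (h x y hxy).1) x)
    (hle he' he (fun x y hxy => (h x y hxy).2) x)

theorem equiv_fin_eq_of_lt_iff {γ : Type*} {m : ℕ} {p q : γ ≃ Fin m}
    (h : ∀ x y, p x < p y ↔ q x < q y) : p = q := by
  have hmono : StrictMono (p.symm.trans q) := fun a b hab => (h _ _).1 (by simpa using hab)
  have hid := (hmono.range_inj strictMono_id).1
    ((p.symm.trans q).surjective.range_eq.trans Set.range_id.symm)
  exact Equiv.ext fun x => by simpa using (congrFun hid (p x)).symm

theorem exists_equiv_fin_lt_iff {γ : Type*} [Fintype γ] {m : ℕ} (hm : Fintype.card γ = m)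
    (r : γ → γ → Prop) [IsStrictTotalOrder γ r] : ∃ p : γ ≃ Fin m, ∀ x y, p x < p y ↔ r x y := by
  classical
  let := linearOrderOfSTO r
  let p := (Fintype.orderIsoFinOfCardEq γ hm).symm
  exact ⟨p.toEquiv, fun _ _ => p.lt_iff_lt⟩

theorem IsNoncrossingCode.isStrictTotalOrder {n : ℕ} {e : ℕ → ℕ} (h : IsNoncrossingCode n e) :
    IsStrictTotalOrder (Fin n) fun x y => (x < y ∧ e x ≤ y) ∨ (y < x ∧ (x : ℕ) < e y) where
  trichotomous x y hxy hyx := by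
    rw [Fin.ext_iff]
    simp only [Fin.lt_def] at hxy hyx
    omega
  irrefl x := by
    simp only [lt_irrefl, false_and, or_self, not_false_eq_true]
  trans x y z hxy hyz := by
    have := (h.1.1 x x.2).1
    have := (h.1.1 y y.2).1
    have := (h.1.1 z z.2).1
    have := h.2 x y
    have := h.2 x z
    have := h.2 y x
    have := h.2 y z
    have := h.2 z x
    have := h.2 z y
    have : (x : ℕ) = z → e x = e z := congrArg e
    simp only [Fin.lt_def] at hxy hyz ⊢
    omega

theorem IsNoncrossingCode.exists_encodesPerm {n : ℕ} {e : ℕ → ℕ} (h : IsNoncrossingCode n e) :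
    ∃ π : Equiv.Perm (Fin n), EncodesPerm π e := by
  have := h.isStrictTotalOrder
  obtain ⟨π, hπ⟩ := exists_equiv_fin_lt_iff (Fintype.card_fin n)
    fun x y : Fin n => (x < y ∧ e x ≤ y) ∨ (y < x ∧ (x : ℕ) < e y)
  refine ⟨π, h.1, fun x y hxy => ?_⟩
  rw [hπ]
  simp only [hxy, hxy.not_gt, false_and, true_and, false_or]

theorem EncodesPerm.gt_iff {n : ℕ} {π : Equiv.Perm (Fin n)} {e : ℕ → ℕ} (h : EncodesPerm π e)
    {x y : Fin n} (hxy : x < y) : π x < π y ↔ e x ≤ y := by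
  rw [← not_iff_not, not_lt, not_le, (π.injective.ne hxy.ne').le_iff_lt]
  exact h.lt_iff x y hxy

theorem EncodesPerm.unique {n : ℕ} {π π' : Equiv.Perm (Fin n)} {e : ℕ → ℕ} (h : EncodesPerm π e)
    (h' : EncodesPerm π' e) : π = π' := by
  refine equiv_fin_eq_of_lt_iff fun x y => ?_
  rcases lt_trichotomy x y with hxy | rfl | hxy
  · exact (h.gt_iff hxy).trans (h'.gt_iff hxy).symm
  · simp only [lt_irrefl]
  · exact (h.lt_iff y x hxy).trans (h'.lt_iff y x hxy).symm

theorem EncodesPerm.idr_eq {n : ℕ} {π : Equiv.Perm (Fin n)} {e : ℕ → ℕ} (h : EncodesPerm π e) :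
    idr π = bottomCount n e := by
  rw [bottomCount, ← card_subtype_eq_card_filter (Equiv.refl (Fin n))]
  refine Nat.card_congr (Equiv.subtypeEquivRight fun i => ⟨fun hi x hx => ?_, fun hi => ?_⟩)
  · rcases lt_or_ge x (i : ℕ) with hxi | hxi
    · exact (h.lt_iff ⟨x, hx⟩ i hxi).1 (hi (Fin.lt_def.2 hxi).le (Set.mem_Iic.2 le_rfl) hxi)
    · exact hxi.trans_lt (h.isCode.1 x hx).1
  · intro a _ b hb hab
    exact (h.lt_iff a b hab).2 (lt_of_le_of_lt (Fin.le_def.1 hb) (hi a a.2))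

theorem EncodesPerm.lmax_eq {n : ℕ} {π : Equiv.Perm (Fin n)} {e : ℕ → ℕ} (h : EncodesPerm π e) :
    lmax π = cutCount n e := by
  rw [cutCount, ← card_subtype_eq_card_filter (Equiv.refl (Fin n))]
  refine Nat.card_congr (Equiv.subtypeEquivRight fun i => ⟨fun hi y hy => ?_, fun hi j hj => ?_⟩)
  · exact (h.gt_iff (x := ⟨y, hy.trans i.2⟩) hy).1 (hi ⟨y, hy.trans i.2⟩ hy)
  · exact (h.gt_iff hj).2 (hi j hj)

theorem genFishburn_eq : genFishburn = genFun (fun n => {e // IsNoncrossingCode n e})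
    (fun n e => bottomCount n e.1) (fun n e => cutCount n e.1) := by
  choose φ hφ using fun n (e : {e // IsNoncrossingCode n e}) => e.2.exists_encodesPerm
  refine (genFun_congr (T := fun n => {e // IsNoncrossingCode n e})
    (S := FishburnAvoiding ![3, 1, 4, 2])
    (fun n e => ⟨φ n e, (isFishburn_and_not_containsPattern_iff _).2 (hφ n e).avoids231⟩)
    (fun n => ⟨?_, ?_⟩) (fun n e => (hφ n e).idr_eq) fun n e => (hφ n e).lmax_eq).symm
  · intro e e' h
    have hφe : EncodesPerm (φ n e') e.1 := by
      rw [show φ n e' = φ n e from (congrArg Subtype.val h).symm]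
      exact hφ n e
    exact Subtype.ext (hφe.isCode.eq_of_lt_iff (hφ n e').isCode fun x y hxy =>
      (hφe.lt_iff x y hxy).symm.trans ((hφ n e').lt_iff x y hxy))
  · rintro ⟨π, hπ⟩
    obtain ⟨e, he⟩ := ((isFishburn_and_not_containsPattern_iff π).1 hπ).exists_encodesPerm
    exact ⟨⟨e, he.isNoncrossingCode⟩, Subtype.ext ((hφ n _).unique he)⟩

/-! ### Codes of matchings -/

theorem mem_iff_of_isLowerSet {n : ℕ} {S : Finset (Fin n)} (hS : IsLowerSet (S : Set (Fin n)))
    (y : Fin n) : y ∈ S ↔ (y : ℕ) < S.card := by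
  have hcompl : IsUpperSet ((Sᶜ : Finset (Fin n)) : Set (Fin n)) := by
    simpa only [Finset.coe_compl] using hS.compl
  have hle := S.card_le_univ
  rw [Fintype.card_fin] at hle
  rw [← not_iff_not, ← Finset.mem_compl, mem_iff_of_isUpperSet hcompl, Finset.card_compl,
    Fintype.card_fin, Nat.sub_sub_self hle, not_lt]

theorem le_of_forall_step {m : ℕ} {β : Type*} [Preorder β] {f : Fin m → β} {a b : Fin m}
    (hab : a ≤ b) (h : ∀ i j, a ≤ i → j ≤ b → (j : ℕ) = i + 1 → f i ≤ f j) : f a ≤ f b :=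
  monotoneOn_of_le_succ Set.ordConnected_Icc
    (fun i hmax hi hj => h i _ hi.1 hj.2
      (Nat.covBy_iff_add_one_eq.1 (Fin.covBy_iff.1 (Order.covBy_succ_of_not_isMax hmax))).symm)
    (Set.left_mem_Icc.2 hab) (Set.right_mem_Icc.2 hab) hab

theorem TieSorted.apply_le_apply {n x y : ℕ} {e : ℕ → ℕ} (ht : TieSorted negCast n e)
    (he : IsCode n e) (hxy : x < y) (hy : y < n) (hz : ∀ z < n, x < e z → y < e z) : e x ≤ e y :=
  (he.negCast_le_iff x y).1 (ht x y hxy hy hz)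

theorem TieSorted.apply_zero_le {n x : ℕ} {e : ℕ → ℕ} (ht : TieSorted negCast n e)
    (he : IsCode n e) (hx : x < n) : e 0 ≤ e x := by
  obtain ⟨z, hz, hmin⟩ := (Finset.range n).exists_min_image e ⟨x, Finset.mem_range.2 hx⟩
  simp only [Finset.mem_range] at hz hmin
  refine le_trans ?_ (hmin x hx)
  rcases z.eq_zero_or_pos with rfl | hz0
  · exact le_rfl
  · exact ht.apply_le_apply he hz0 hz fun w hw _ => (he.1 z hz).1.trans_le (hmin w hw)

/-- The function `e` encodes the matching `M`: the openers are `o 0 < o 1 < ⋯`, the arc of `o x` is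
`[o x, c x]`, and the openers before the closer `c x` are those with an index smaller than `e x`. -/
structure EncodesMatching {n : ℕ} (M : Matching n) (o c : Fin n → Fin (2 * n)) (e : ℕ → ℕ) :
    Prop where
  isCode : IsCode n e
  strictMono : StrictMono o
  partner_opener : ∀ x, M.partner (o x) = c x
  opener_lt_closer_iff : ∀ x y, o y < c x ↔ (y : ℕ) < e x

/-- The closers that have the same openers before them are in the order of their openers. -/
def ClosersSorted {n : ℕ} (c : Fin n → Fin (2 * n)) (e : ℕ → ℕ) : Prop :=
  ∀ x y : Fin n, x < y → e x = e y → c x < c y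

namespace EncodesMatching

variable {n : ℕ} {M M' : Matching n} {o c o' c' : Fin n → Fin (2 * n)} {e e' : ℕ → ℕ}

theorem opener_lt_closer (h : EncodesMatching M o c e) (x : Fin n) : o x < c x :=
  (h.opener_lt_closer_iff x x).2 (h.isCode.1 x x.2).1

theorem partner_closer (h : EncodesMatching M o c e) (x : Fin n) : M.partner (c x) = o x := by
  rw [← h.partner_opener, M.partner_partner]

theorem isArc (h : EncodesMatching M o c e) (x : Fin n) : M.IsArc (o x) (c x) :=
  ⟨h.opener_lt_closer x, h.partner_opener x⟩

theorem opener_ne_closer (h : EncodesMatching M o c e) (x y : Fin n) : o x ≠ c y := fun heq => by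
  have hx := h.opener_lt_closer x
  rw [← h.partner_opener x, heq, h.partner_closer] at hx
  exact lt_asymm hx (h.opener_lt_closer y)

theorem closer_injective (h : EncodesMatching M o c e) : Function.Injective c := fun x y hxy =>
  h.strictMono.injective (by rw [← h.partner_closer, hxy, h.partner_closer])

theorem bijective (h : EncodesMatching M o c e) : Function.Bijective (Sum.elim o c) :=
  (Fintype.bijective_iff_injective_and_card _).2
    ⟨h.strictMono.injective.sumElim h.closer_injective h.opener_ne_closer, by simp [two_mul]⟩

theorem exists_eq (h : EncodesMatching M o c e) (p : Fin (2 * n)) :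
    (∃ x, o x = p) ∨ ∃ x, c x = p := by
  obtain ⟨x | x, hx⟩ := h.bijective.2 p
  exacts [Or.inl ⟨x, hx⟩, Or.inr ⟨x, hx⟩]

theorem exists_arc (h : EncodesMatching M o c e) {a b : Fin (2 * n)} (hab : M.IsArc a b) :
    ∃ x, o x = a ∧ c x = b := by
  rcases h.exists_eq a with ⟨x, rfl⟩ | ⟨x, rfl⟩
  · exact ⟨x, rfl, by rw [← hab.2, h.partner_opener]⟩
  · have hlt := hab.1
    rw [← hab.2, h.partner_closer] at hlt
    exact absurd hlt (h.opener_lt_closer x).not_gt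

theorem isOpener_iff (h : EncodesMatching M o c e) (p : Fin (2 * n)) :
    M.IsOpener p ↔ ∃ x, o x = p := by
  constructor
  · intro hp
    obtain ⟨x, hx, -⟩ := h.exists_arc ⟨hp, rfl⟩
    exact ⟨x, hx⟩
  · rintro ⟨x, rfl⟩
    rw [Matching.IsOpener, h.partner_opener]
    exact h.opener_lt_closer x

theorem isCloser_iff (h : EncodesMatching M o c e) (p : Fin (2 * n)) :
    M.IsCloser p ↔ ∃ x, c x = p := by
  constructor
  · intro hp
    obtain ⟨x, -, hx⟩ := h.exists_arc ⟨hp, M.partner_partner p⟩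
    exact ⟨x, hx⟩
  · rintro ⟨x, rfl⟩
    rw [Matching.IsCloser, h.partner_closer]
    exact h.opener_lt_closer x

theorem closer_lt_opener_iff (h : EncodesMatching M o c e) (x y : Fin n) :
    c x < o y ↔ e x ≤ y := by
  rw [← not_iff_not, not_lt, not_le, ← h.opener_lt_closer_iff, (h.opener_ne_closer y x).le_iff_lt]

theorem closer_lt_closer (h : EncodesMatching M o c e) {x y : Fin n} (hxy : e x < e y) :
    c x < c y := by
  let z : Fin n := ⟨e x, hxy.trans_le h.isCode.apply_le⟩
  exact ((h.closer_lt_opener_iff x z).2 le_rfl).trans ((h.opener_lt_closer_iff y z).2 hxy)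

theorem closer_lt_closer_iff (h : EncodesMatching M o c e) (hc : ClosersSorted c e) (x y : Fin n) :
    c x < c y ↔ e x < e y ∨ (e x = e y ∧ x < y) := by
  constructor
  · intro hxy
    rcases lt_trichotomy (e x) (e y) with hlt | heq | hgt
    · exact Or.inl hlt
    · refine Or.inr ⟨heq, lt_of_le_of_ne (not_lt.1 fun hyx => ?_) ?_⟩
      · exact lt_asymm hxy (hc y x hyx heq.symm)
      · rintro rfl
        exact lt_irrefl _ hxy
    · exact absurd hxy (h.closer_lt_closer hgt).not_gt
  · rintro (hlt | ⟨heq, hxy⟩)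
    exacts [h.closer_lt_closer hlt, hc x y hxy heq]

theorem code_eq (h : EncodesMatching M o c e) (h' : EncodesMatching M o' c' e') : e = e' := by
  obtain rfl : o = o' := (h.strictMono.range_inj h'.strictMono).1 <| Set.ext fun p =>
    (h.isOpener_iff p).symm.trans (h'.isOpener_iff p)
  refine h.isCode.eq_of_lt_iff h'.isCode fun x y _ => ?_
  rw [← h.opener_lt_closer_iff, ← h'.opener_lt_closer_iff, ← h.partner_opener,
    ← h'.partner_opener]

theorem matching_eq (h : EncodesMatching M o c e) (hc : ClosersSorted c e)
    (h' : EncodesMatching M' o' c' e) (hc' : ClosersSorted c' e) : M = M' := by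
  have heq : Equiv.ofBijective _ h.bijective = Equiv.ofBijective _ h'.bijective := by
    refine equiv_fin_eq_of_lt_iff fun x y => ?_
    rcases x with x | x <;> rcases y with y | y <;>
      simp only [Equiv.ofBijective_apply, Sum.elim_inl, Sum.elim_inr]
    · rw [h.strictMono.lt_iff_lt, h'.strictMono.lt_iff_lt]
    · rw [h.opener_lt_closer_iff, h'.opener_lt_closer_iff]
    · rw [h.closer_lt_opener_iff, h'.closer_lt_opener_iff]
    · rw [h.closer_lt_closer_iff hc, h'.closer_lt_closer_iff hc']
  obtain rfl : o = o' := funext fun x => DFunLike.congr_fun heq (Sum.inl x)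
  obtain rfl : c = c' := funext fun x => DFunLike.congr_fun heq (Sum.inr x)
  refine Matching.ext (funext fun p => ?_)
  rcases h.exists_eq p with ⟨x, rfl⟩ | ⟨x, rfl⟩
  · rw [h.partner_opener, h'.partner_opener]
  · rw [h.partner_closer, h'.partner_closer]

theorem closersSorted (h : EncodesMatching M o c e) (hM : M.IsStoimenow) : ClosersSorted c e := by
  intro x y hxy he
  by_contra! hle
  have is_closer (p) (hyp : c y ≤ p) (hpx : p ≤ c x) : ∃ z, c z = p := by
    refine (h.exists_eq p).resolve_left ?_
    rintro ⟨z, rfl⟩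
    have := (h.opener_lt_closer_iff x z).1 (lt_of_le_of_ne hpx (h.opener_ne_closer z x))
    have := (h.opener_lt_closer_iff y z).not.1 (not_lt.2 hyp)
    omega
  have hpartner : M.partner (c y) ≤ M.partner (c x) := by
    refine le_of_forall_step hle fun i j hi hj hij => ?_
    have hlt : i ≤ j := Fin.le_def.2 (by omega)
    obtain ⟨u, rfl⟩ := is_closer i hi (hlt.trans hj)
    obtain ⟨w, rfl⟩ := is_closer j (hi.trans hlt) hj
    rw [h.partner_closer, h.partner_closer]
    by_contra! hwu
    exact hM.2 ⟨o w, o u, c u, c w, h.isArc w, h.isArc u, hij, hwu⟩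
  rw [h.partner_closer, h.partner_closer] at hpartner
  exact hpartner.not_gt (h.strictMono hxy)

theorem tieSorted (h : EncodesMatching M o c e) (hM : M.IsStoimenow) : TieSorted negCast n e := by
  intro x y hxy hy hz
  rw [h.isCode.negCast_le_iff]
  by_contra! hlt
  lift y to Fin n using hy
  lift x to Fin n using hxy.trans y.2
  have is_opener (p) (hxp : o x ≤ p) (hpy : p ≤ o y) : ∃ z, o z = p := by
    refine (h.exists_eq p).resolve_right ?_
    rintro ⟨z, rfl⟩
    have hxz := (h.opener_lt_closer_iff z x).1 (lt_of_le_of_ne hxp (h.opener_ne_closer x z))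
    have hzy := (h.closer_lt_opener_iff z y).1 (lt_of_le_of_ne hpy (h.opener_ne_closer y z).symm)
    exact (hz z z.2 hxz).not_ge hzy
  have hpartner : M.partner (o x) ≤ M.partner (o y) := by
    refine le_of_forall_step (h.strictMono hxy).le fun i j hi hj hij => ?_
    have hlt : i ≤ j := Fin.le_def.2 (by omega)
    obtain ⟨u, rfl⟩ := is_opener i hi (hlt.trans hj)
    obtain ⟨w, rfl⟩ := is_opener j (hi.trans hlt) hj
    rw [h.partner_opener, h.partner_opener]
    by_contra! hwu
    exact hM.1 ⟨o u, o w, c w, c u, h.isArc u, h.isArc w, hij, hwu⟩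
  rw [h.partner_opener, h.partner_opener] at hpartner
  exact hpartner.not_gt (h.closer_lt_closer hlt)

theorem isStoimenow (h : EncodesMatching M o c e) (hc : ClosersSorted c e)
    (ht : TieSorted negCast n e) : M.IsStoimenow := by
  constructor
  · rintro ⟨i, j, k, l, hil, hjk, hij, hkl⟩
    obtain ⟨x, rfl, rfl⟩ := h.exists_arc hil
    obtain ⟨y, rfl, rfl⟩ := h.exists_arc hjk
    have hxy : x < y := h.strictMono.lt_iff_lt.1 (Fin.lt_def.2 (by omega))
    have hle : e x ≤ e y := ht.apply_le_apply h.isCode hxy y.2 fun z hz hxz => by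
      by_contra! hzy
      have hxz := (h.opener_lt_closer_iff ⟨z, hz⟩ x).2 hxz
      have hzy := (h.closer_lt_opener_iff ⟨z, hz⟩ y).2 hzy
      rw [Fin.lt_def] at hxz hzy
      omega
    exact hkl.not_gt ((h.closer_lt_closer_iff hc x y).2 (hle.lt_or_eq.imp_right (⟨·, hxy⟩)))
  · rintro ⟨k, l, i, j, hkj, hli, hij, hkl⟩
    obtain ⟨x, rfl, rfl⟩ := h.exists_arc hkj
    obtain ⟨y, rfl, rfl⟩ := h.exists_arc hli
    have hxy : x < y := h.strictMono.lt_iff_lt.1 hkl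
    rcases (h.closer_lt_closer_iff hc y x).1 (Fin.lt_def.2 (by omega)) with hlt | ⟨-, hyx⟩
    · let z : Fin n := ⟨e y, hlt.trans_le h.isCode.apply_le⟩
      have hyz := (h.closer_lt_opener_iff y z).2 le_rfl
      have hzx := (h.opener_lt_closer_iff x z).2 hlt
      rw [Fin.lt_def] at hyz hzx
      omega
    · exact lt_asymm hxy hyx

theorem isStoimenow_iff (h : EncodesMatching M o c e) :
    M.IsStoimenow ↔ ClosersSorted c e ∧ TieSorted negCast n e :=
  ⟨fun hM => ⟨h.closersSorted hM, h.tieSorted hM⟩, fun hM => h.isStoimenow hM.1 hM.2⟩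

end EncodesMatching

/-! ### Existence of encodings -/

section Existence

variable {n : ℕ} {e : ℕ → ℕ}

/-- The set of the openers of a matching. -/
def Matching.openers (M : Matching n) : Finset (Fin (2 * n)) :=
  Finset.univ.filter fun a => a < M.partner a

theorem Matching.card_openers (M : Matching n) : M.openers.card = n := by
  have hinvol : Function.Involutive M.partner := M.partner_partner
  have hcompl : M.openersᶜ = M.openers.image M.partner := by
    ext p
    simp only [openers, Finset.compl_filter, Finset.mem_filter, Finset.mem_univ, true_and,
      Finset.mem_image, not_lt]
    constructor
    · refine fun hp => ⟨M.partner p, ?_, M.partner_partner p⟩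
      rw [M.partner_partner]
      exact lt_of_le_of_ne hp (M.partner_ne p)
    · rintro ⟨q, hq, rfl⟩
      rw [M.partner_partner]
      exact hq.le
  have hcard := M.openers.card_add_card_compl
  rw [hcompl, Finset.card_image_of_injective _ hinvol.injective, Fintype.card_fin] at hcard
  omega

theorem exists_isCode_of_strictMono {o c : Fin n → Fin (2 * n)} (ho : StrictMono o)
    (hlt : ∀ x, o x < c x) : ∃ e, IsCode n e ∧ ∀ x y, o y < c x ↔ (y : ℕ) < e x := by
  let e : ℕ → ℕ := fun x => if hx : x < n then
    (Finset.univ.filter fun y => o y < c ⟨x, hx⟩).card else 0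
  have he : ∀ x y : Fin n, o y < c x ↔ (y : ℕ) < e x := by
    intro x y
    have hlower : IsLowerSet ((Finset.univ.filter fun y => o y < c x : Finset _) : Set (Fin n)) :=
      fun a b hba ha => by
        simp only [Finset.coe_filter, Finset.mem_univ, true_and, Set.mem_ofPred_eq] at ha ⊢
        exact (ho.monotone hba).trans_lt ha
    simpa [e] using mem_iff_of_isLowerSet hlower y
  refine ⟨e, ⟨fun x hx => ⟨(he ⟨x, hx⟩ ⟨x, hx⟩).1 (hlt _), ?_⟩, fun x hx => ?_⟩, he⟩
  · simp only [e, dif_pos hx]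
    exact (Finset.card_le_univ _).trans_eq (Fintype.card_fin n)
  · simp only [e, dif_neg hx.not_gt]

theorem exists_encodesMatching (M : Matching n) : ∃ o c e, EncodesMatching M o c e := by
  let o := M.openers.orderEmbOfFin M.card_openers
  have hlt (x) : o x < M.partner (o x) :=
    (Finset.mem_filter.1 (M.openers.orderEmbOfFin_mem M.card_openers x)).2
  obtain ⟨e, he, hiff⟩ := exists_isCode_of_strictMono o.strictMono hlt
  exact ⟨o, fun x => M.partner (o x), e, he, o.strictMono, fun _ => rfl, hiff⟩

/-- The matching whose arcs join the points `p (inl x)` and `p (inr x)`. -/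
def Matching.ofEquiv (p : Fin n ⊕ Fin n ≃ Fin (2 * n)) : Matching n where
  partner i := p (p.symm i).swap
  partner_partner i := by simp
  partner_ne i h := by
    have hswap : (p.symm i).swap = p.symm i := p.injective (by simpa using h)
    cases hi : p.symm i <;> simp [hi] at hswap

theorem IsCode.exists_encodesMatching (he : IsCode n e) :
    ∃ (M : Matching n) (o c : _), EncodesMatching M o c e ∧ ClosersSorted c e := by
  -- The closer of `x` goes just before the opener of `e x`.
  let key : Fin n ⊕ Fin n → ℕ ×ₗ ℕ :=
    Sum.elim (fun y => toLex ((y : ℕ), n)) fun x => toLex (e x, (x : ℕ))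
  have key_injective : Function.Injective key := by
    refine Function.Injective.sumElim (fun x y hxy => ?_) (fun x y hxy => ?_) fun x y hxy => ?_
    all_goals simp only [EmbeddingLike.apply_eq_iff_eq, Prod.mk.injEq] at hxy
    · exact Fin.ext hxy.1
    · exact Fin.ext hxy.2
    · exact y.2.ne hxy.2.symm
  have : IsStrictTotalOrder (Fin n ⊕ Fin n) (key ⁻¹'o (· < ·)) :=
    (RelEmbedding.preimage ⟨key, key_injective⟩ (· < ·)).isStrictTotalOrder
  obtain ⟨p, hp⟩ := exists_equiv_fin_lt_iff (m := 2 * n) (by simp [two_mul]) (key ⁻¹'o (· < ·))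
  refine ⟨.ofEquiv p, p ∘ Sum.inl, p ∘ Sum.inr, ⟨he, fun x y hxy => ?_, fun x => ?_,
    fun x y => ?_⟩, fun x y hxy hexy => ?_⟩
  · exact (hp _ _).2 (Prod.Lex.toLex_lt_toLex.2 (Or.inl hxy))
  · simp [Matching.ofEquiv]
  · refine (hp _ _).trans (Prod.Lex.toLex_lt_toLex.trans ?_)
    have := x.2
    simp only
    omega
  · exact (hp _ _).2 (Prod.Lex.toLex_lt_toLex.2 (Or.inr ⟨hexy, hxy⟩))

end Existence

/-! ### Statistics of Stoimenow matchings -/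

theorem card_subtype_and_eq_card_filter {α β : Type*} [Fintype α] {f : α → β}
    (hf : Function.Injective f) {p q : β → Prop} [DecidablePred p] (hq : ∀ b, q b ↔ ∃ x, f x = b) :
    Nat.card {b // p b ∧ q b} = (Finset.univ.filter fun x => p (f x)).card := by
  let g : {x // p (f x)} → {b // p b ∧ q b} := fun x => ⟨f x, x.2, (hq _).2 ⟨x, rfl⟩⟩
  have hg : Function.Bijective g := by
    refine ⟨fun x y hxy => Subtype.ext (hf (congrArg Subtype.val hxy)), ?_⟩
    rintro ⟨b, hpb, hqb⟩
    obtain ⟨x, rfl⟩ := (hq b).1 hqb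
    exact ⟨⟨x, hpb⟩, rfl⟩
  rw [← Nat.card_eq_of_bijective g hg, Nat.card_eq_fintype_card, Fintype.card_subtype]

namespace EncodesMatching

variable {n : ℕ} {M : Matching n} {o c : Fin n → Fin (2 * n)} {e : ℕ → ℕ}

theorem card_filter_opener_add_card_filter_closer (h : EncodesMatching M o c e) {m : ℕ}
    (hm : m ≤ 2 * n) : (Finset.univ.filter fun x => (o x : ℕ) < m).card +
      (Finset.univ.filter fun x => (c x : ℕ) < m).card = m := by
  have hsum := h.bijective.sum_comp fun p => if (p : ℕ) < m then (1 : ℕ) else 0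
  rw [Fintype.sum_sum_type, ← Finset.card_filter, ← Finset.card_filter, ← Finset.card_filter,
    Fin.card_filter_val_lt, min_eq_right hm] at hsum
  exact hsum

theorem opener_lt_iff_lt_card (h : EncodesMatching M o c e) (m : ℕ) (x : Fin n) :
    (o x : ℕ) < m ↔ (x : ℕ) < (Finset.univ.filter fun x => (o x : ℕ) < m).card := by
  rw [← mem_iff_of_isLowerSet]
  · simp only [Finset.mem_filter, Finset.mem_univ, true_and]
  · intro a b hba ha
    simp only [Finset.coe_filter, Finset.mem_univ, true_and, Set.mem_ofPred_eq] at ha ⊢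
    exact (Fin.le_def.1 (h.strictMono.monotone hba)).trans_lt ha

theorem filter_closer_subset_filter_opener (h : EncodesMatching M o c e) (m : ℕ) :
    (Finset.univ.filter fun x => (c x : ℕ) < m) ⊆ Finset.univ.filter fun x => (o x : ℕ) < m :=
  Finset.monotone_filter_right _ fun x _ hx => (Fin.lt_def.1 (h.opener_lt_closer x)).trans hx

theorem isBalancedAt_iff_card (h : EncodesMatching M o c e) {i : ℕ} (hi : i ≤ n) :
    M.IsBalancedAt i ↔ (Finset.univ.filter fun x => (o x : ℕ) < 2 * i).card = i := by
  have htotal := h.card_filter_opener_add_card_filter_closer (Nat.mul_le_mul_left 2 hi)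
  rw [Matching.IsBalancedAt,
    card_subtype_and_eq_card_filter h.strictMono.injective (p := fun a => (a : ℕ) < 2 * i)
      h.isOpener_iff,
    card_subtype_and_eq_card_filter h.closer_injective (p := fun a => (a : ℕ) < 2 * i)
      h.isCloser_iff]
  omega

theorem isBalancedAt_iff (h : EncodesMatching M o c e) {i : ℕ} (hi : i ≤ n) :
    M.IsBalancedAt i ↔ ∀ y < i, e y ≤ i := by
  have htotal := h.card_filter_opener_add_card_filter_closer (Nat.mul_le_mul_left 2 hi)
  have hsub := h.filter_closer_subset_filter_opener (2 * i)
  have hopener := h.opener_lt_iff_lt_card (2 * i)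
  rw [h.isBalancedAt_iff_card hi]
  constructor
  · intro hcard y hy
    by_contra! hlt
    have hin : i < n := hlt.trans_le h.isCode.apply_le
    have hclosers := Finset.eq_of_subset_of_card_le hsub (by omega)
    have hmem : ⟨y, hy.trans hin⟩ ∈ Finset.univ.filter fun x => (c x : ℕ) < 2 * i := by
      rw [hclosers, Finset.mem_filter, hopener, hcard]
      exact ⟨Finset.mem_univ _, hy⟩
    have := (Finset.mem_filter.1 hmem).2
    have := Fin.lt_def.1 ((h.opener_lt_closer_iff ⟨y, hy.trans hin⟩ ⟨i, hin⟩).2 hlt)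
    have := (hopener ⟨i, hin⟩).1 (by omega)
    simp only at this
    omega
  · intro hcut
    have hle := Finset.card_le_card hsub
    refine le_antisymm (not_lt.1 fun hlt => ?_) (by omega)
    have hin : i < n := hlt.trans_le ((Finset.card_le_univ _).trans_eq (Fintype.card_fin n))
    have hio := (hopener ⟨i, hin⟩).2 hlt
    have hclosers : Finset.Iio ⟨i, hin⟩ ⊆ Finset.univ.filter fun x => (c x : ℕ) < 2 * i := by
      intro x hx
      have hcx := (h.closer_lt_opener_iff x ⟨i, hin⟩).2
        (hcut x (Fin.lt_def.1 (Finset.mem_Iio.1 hx)))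
      exact Finset.mem_filter.2 ⟨Finset.mem_univ x, (Fin.lt_def.1 hcx).trans hio⟩
    have := Finset.card_le_card hclosers
    rw [Fin.card_Iio] at this
    simp only at this
    omega

theorem bl_eq (h : EncodesMatching M o c e) : M.bl = cutCount n e := by
  have hset : {i : ℕ | 1 ≤ i ∧ i ≤ n ∧ M.IsBalancedAt i} =
      ((Finset.Icc 1 n).filter fun i => ∀ y < i, e y ≤ i : Finset ℕ) := by
    ext i
    simp only [Finset.coe_filter, Finset.mem_Icc, Set.mem_ofPred_eq, and_assoc]
    exact and_congr_right fun _ => and_congr_right fun hi => h.isBalancedAt_iff hi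
  rw [Matching.bl, hset, Set.ncard_coe_finset, h.isCode.cutCount_eq_card_Icc]

end EncodesMatching

/-- The openers before the first closer of the matching encoded by `e`. -/
def firstCrossing {n : ℕ} (o : Fin n → Fin (2 * n)) (e : ℕ → ℕ) : Finset (Fin (2 * n)) :=
  (Finset.univ.filter fun y : Fin n => (y : ℕ) < e 0).image o

namespace EncodesMatching

variable {n : ℕ} {M : Matching n} {o c : Fin n → Fin (2 * n)} {e : ℕ → ℕ}

theorem opener_mem_firstCrossing_iff (h : EncodesMatching M o c e) (y : Fin n) :
    o y ∈ firstCrossing o e ↔ (y : ℕ) < e 0 := by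
  simp [firstCrossing, h.strictMono.injective.eq_iff]

theorem opener_eq_zero (h : EncodesMatching M o c e) (hn : 0 < n) : (o ⟨0, hn⟩ : ℕ) = 0 := by
  rcases h.exists_eq ⟨0, by omega⟩ with ⟨x, hx⟩ | ⟨x, hx⟩
  · have hle : o ⟨0, hn⟩ ≤ o x := h.strictMono.monotone (Fin.le_def.2 x.1.zero_le)
    rw [hx] at hle
    exact Nat.le_zero.1 hle
  · have hlt := h.opener_lt_closer x
    rw [hx] at hlt
    exact absurd hlt (Nat.not_lt_zero _)

theorem isCrossing_firstCrossing (h : EncodesMatching M o c e) (hM : M.IsStoimenow)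
    (hn : 0 < n) : M.IsCrossing (firstCrossing o e) := by
  obtain ⟨hc, ht⟩ := h.isStoimenow_iff.1 hM
  have hzero {x y : ℕ} (hx : x < e 0) (hy : y < n) : x < e y :=
    hx.trans_le (ht.apply_zero_le h.isCode hy)
  refine ⟨⟨o ⟨0, hn⟩, (h.opener_mem_firstCrossing_iff _).2 (h.isCode.1 0 hn).1⟩, ?_, ?_⟩
  · intro a ha
    obtain ⟨x, -, rfl⟩ := Finset.mem_image.1 ha
    exact (h.isOpener_iff _).2 ⟨x, rfl⟩
  · simp only [firstCrossing, Finset.mem_image, Finset.mem_filter, Finset.mem_univ, true_and]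
    rintro _ ⟨x, _, rfl⟩ _ ⟨y, hy, rfl⟩ hab
    have hxy : x < y := h.strictMono.lt_iff_lt.1 hab
    rw [h.partner_opener, h.partner_opener, h.opener_lt_closer_iff, h.closer_lt_closer_iff hc]
    have hle : e x ≤ e y := ht.apply_le_apply h.isCode hxy y.2 fun z hz _ => hzero hy hz
    exact ⟨hzero hy x.2, hle.lt_or_eq.imp_right (⟨·, hxy⟩)⟩

theorem subset_firstCrossing (h : EncodesMatching M o c e) {S : Finset (Fin (2 * n))}
    (hS : M.IsCrossing S) (hzero : ∃ a ∈ S, (a : ℕ) = 0) : S ⊆ firstCrossing o e := by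
  obtain ⟨a, haS, ha0⟩ := hzero
  have hn : 0 < n := by
    have := a.2
    omega
  obtain rfl : a = o ⟨0, hn⟩ := Fin.ext (ha0.trans (h.opener_eq_zero hn).symm)
  intro b hb
  obtain ⟨y, rfl⟩ := (h.isOpener_iff b).1 (hS.2.1 b hb)
  rw [h.opener_mem_firstCrossing_iff]
  rcases (y : ℕ).eq_zero_or_pos with hy0 | hy0
  · rw [hy0]
    exact (h.isCode.1 0 hn).1
  · have hlt := (hS.2.2 _ haS _ hb (h.strictMono hy0)).1
    rwa [h.partner_opener, h.opener_lt_closer_iff] at hlt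

theorem card_firstCrossing (h : EncodesMatching M o c e) (hM : M.IsStoimenow) (hn : 0 < n) :
    (firstCrossing o e).card = bottomCount n e := by
  have hle {x : ℕ} (hx : x < n) : e 0 ≤ e x := (h.tieSorted hM).apply_zero_le h.isCode hx
  rw [firstCrossing, Finset.card_image_of_injective _ h.strictMono.injective, bottomCount,
    Fin.card_filter_val_lt, min_eq_right h.isCode.apply_le, ← Finset.card_range (e 0)]
  congr 1
  ext y
  simp only [Finset.mem_filter, Finset.mem_range]
  exact ⟨fun hy => ⟨hy.trans_le h.isCode.apply_le, fun x hx => hy.trans_le (hle hx)⟩,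
    fun hy => hy.2 0 hn⟩

theorem fcr_eq (h : EncodesMatching M o c e) (hM : M.IsStoimenow) : M.fcr = bottomCount n e := by
  rcases n.eq_zero_or_pos with rfl | hn
  · simp [Matching.fcr, bottomCount]
  have hcross := h.isCrossing_firstCrossing hM hn
  have hzero : ∃ a ∈ firstCrossing o e, (a : ℕ) = 0 :=
    ⟨o ⟨0, hn⟩, (h.opener_mem_firstCrossing_iff _).2 (h.isCode.1 0 hn).1, h.opener_eq_zero hn⟩
  have hset : {k | ∃ S, M.IsMaximalCrossing S ∧ (∃ a ∈ S, (a : ℕ) = 0) ∧ S.card = k} =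
      {(firstCrossing o e).card} := by
    ext k
    constructor
    · rintro ⟨S, hS, hS0, rfl⟩
      have hsub := h.subset_firstCrossing hS.1 hS0
      rw [Set.mem_singleton_iff, hsub.antisymm (hS.2 hcross hsub)]
    · rintro rfl
      obtain ⟨a, ha, ha0⟩ := hzero
      exact ⟨_, ⟨hcross, fun T hT hle => h.subset_firstCrossing hT ⟨a, hle ha, ha0⟩⟩,
        ⟨a, ha, ha0⟩, rfl⟩
  rw [Matching.fcr, hset, csSup_singleton, h.card_firstCrossing hM hn]

/-! ### Pattern containment -/

theorem exists_arc_of_embedding (h : EncodesMatching M o c e) {k : ℕ} {P : Matching k}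
    {f : Fin (2 * k) ↪o Fin (2 * n)} (hf : ∀ i, M.partner (f i) = f (P.partner i))
    {i j : Fin (2 * k)} (hij : P.IsArc i j) : ∃ x, o x = f i ∧ c x = f j :=
  h.exists_arc ⟨f.lt_iff_lt.2 hij.1, (hf i).trans (congrArg f hij.2)⟩

theorem contains_patternOne_iff_exists (h : EncodesMatching M o c e) :
    M.Contains Matching.patternOne ↔ ∃ a d b s,
      o a < o d ∧ o d < c a ∧ c a < o b ∧ c b < o s ∧ o s < c d ∧ c d < c s := by
  constructor
  · rintro ⟨f, hf⟩
    obtain ⟨a, hoa, hca⟩ := h.exists_arc_of_embedding hf (i := 0) (j := 2) ⟨by decide, rfl⟩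
    obtain ⟨d, hod, hcd⟩ := h.exists_arc_of_embedding hf (i := 1) (j := 6) ⟨by decide, rfl⟩
    obtain ⟨b, hob, hcb⟩ := h.exists_arc_of_embedding hf (i := 3) (j := 4) ⟨by decide, rfl⟩
    obtain ⟨s, hos, hcs⟩ := h.exists_arc_of_embedding hf (i := 5) (j := 7) ⟨by decide, rfl⟩
    refine ⟨a, d, b, s, ?_⟩
    simp only [hoa, hca, hod, hcd, hob, hcb, hos, hcs, f.lt_iff_lt]
    decide
  · rintro ⟨a, d, b, s, had, hda, hab, hbs, hsd, hds⟩
    have hbb := h.opener_lt_closer b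
    have hmono : StrictMono ![o a, o d, c a, o b, c b, o s, c d, c s] := by
      refine Fin.strictMono_iff_lt_succ.2 fun i => ?_
      fin_cases i <;> assumption
    refine ⟨OrderEmbedding.ofStrictMono _ hmono, fun i => ?_⟩
    fin_cases i <;> first | exact h.partner_opener _ | exact h.partner_closer _

theorem contains_patternTwo_iff_exists (h : EncodesMatching M o c e) :
    M.Contains Matching.patternTwo ↔ ∃ a b s d,
      o a < o b ∧ o b < c a ∧ c a < o s ∧ o s < c b ∧ c b < o d ∧ o d < c s ∧ c s < c d := by
  constructor
  · rintro ⟨f, hf⟩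
    obtain ⟨a, hoa, hca⟩ := h.exists_arc_of_embedding hf (i := 0) (j := 2) ⟨by decide, rfl⟩
    obtain ⟨b, hob, hcb⟩ := h.exists_arc_of_embedding hf (i := 1) (j := 4) ⟨by decide, rfl⟩
    obtain ⟨s, hos, hcs⟩ := h.exists_arc_of_embedding hf (i := 3) (j := 6) ⟨by decide, rfl⟩
    obtain ⟨d, hod, hcd⟩ := h.exists_arc_of_embedding hf (i := 5) (j := 7) ⟨by decide, rfl⟩
    refine ⟨a, b, s, d, ?_⟩
    simp only [hoa, hca, hob, hcb, hos, hcs, hod, hcd, f.lt_iff_lt]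
    decide
  · rintro ⟨a, b, s, d, hab, hba, has, hsb, hbd, hds, hsd⟩
    have hmono : StrictMono ![o a, o b, c a, o s, c b, o d, c s, c d] := by
      refine Fin.strictMono_iff_lt_succ.2 fun i => ?_
      fin_cases i <;> assumption
    refine ⟨OrderEmbedding.ofStrictMono _ hmono, fun i => ?_⟩
    fin_cases i <;> first | exact h.partner_opener _ | exact h.partner_closer _

theorem exists_first_closer (h : EncodesMatching M o c e) (ht : TieSorted negCast n e)
    {a b d : Fin n} (hda : (d : ℕ) < e a) (hab : e a ≤ b) (hbd : (b : ℕ) < e d) :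
    ∃ x, o x < o d ∧ o d < c x ∧ c x < o b := by
  obtain ⟨x, hx, hmin⟩ := Finset.exists_min_image
    (Finset.univ.filter fun z : Fin n => (d : ℕ) < e z) (fun z => e z) ⟨a, by simpa⟩
  simp only [Finset.mem_filter, Finset.mem_univ, true_and] at hx hmin
  have hxb : e x ≤ b := (hmin a hda).trans hab
  refine ⟨x, h.strictMono ?_, (h.opener_lt_closer_iff x d).2 hx, (h.closer_lt_opener_iff x b).2 hxb⟩
  refine lt_of_le_of_ne (not_lt.1 fun hdx => ?_) fun hxd => ?_
  · have := ht.apply_le_apply h.isCode hdx x.2 fun z hz hdz =>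
      (h.isCode.1 x x.2).1.trans_le (hmin ⟨z, hz⟩ hdz)
    omega
  · rw [hxd] at hxb
    omega

theorem exists_last_opener (h : EncodesMatching M o c e) (hc : ClosersSorted c e)
    {a b d : Fin n} (hab : e a ≤ b) (hbd : (b : ℕ) < e d) (hdb : (d : ℕ) < b) :
    ∃ x, c a < o x ∧ o x < c d ∧ c d < c x := by
  have hed := h.isCode.apply_le (x := d)
  let x : Fin n := ⟨e d - 1, by omega⟩
  have hx : (x : ℕ) + 1 = e d := by
    simp only [x]
    omega
  have hlt := (h.isCode.1 x x.2).1
  refine ⟨x, (h.closer_lt_opener_iff a x).2 (by omega), (h.opener_lt_closer_iff d x).2 (by omega),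
    (h.closer_lt_closer_iff hc d x).2 ?_⟩
  rw [Fin.lt_def]
  omega

theorem contains_patternOne_iff (h : EncodesMatching M o c e) (hM : M.IsStoimenow) :
    M.Contains Matching.patternOne ↔ HasThreePlusOne n e := by
  obtain ⟨hc, ht⟩ := h.isStoimenow_iff.1 hM
  rw [h.contains_patternOne_iff_exists]
  constructor
  · rintro ⟨a, d, b, s, -, hda, hab, hbs, hsd, -⟩
    rw [h.opener_lt_closer_iff] at hda hsd
    rw [h.closer_lt_opener_iff] at hab hbs
    exact ⟨a, b, s, d, b.2, s.2, hda, hab, hbs, hsd, d.2⟩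
  · rintro ⟨a, b, s, d, hb, hs, hda, hab, hbs, hsd, hd⟩
    lift a to Fin n using h.isCode.lt_of_lt_apply hda
    lift b to Fin n using hb
    lift s to Fin n using hs
    lift d to Fin n using hd
    have hbb := (h.isCode.1 b b.2).1
    obtain ⟨a', had', hda', hab'⟩ := h.exists_first_closer ht hda hab (by omega)
    obtain ⟨s', hbs', hsd', hds'⟩ := h.exists_last_opener hc hbs hsd (by omega)
    exact ⟨a', d, b, s', had', hda', hab', hbs', hsd', hds'⟩

theorem contains_patternTwo_iff (h : EncodesMatching M o c e) (hM : M.IsStoimenow) :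
    M.Contains Matching.patternTwo ↔ HasN n e := by
  obtain ⟨hc, ht⟩ := h.isStoimenow_iff.1 hM
  rw [h.contains_patternTwo_iff_exists]
  constructor
  · rintro ⟨a, b, s, d, -, hba, has, hsb, hbd, hds, -⟩
    rw [h.opener_lt_closer_iff] at hba hsb hds
    rw [h.closer_lt_opener_iff] at has hbd
    exact ⟨a, b, s, d, d.2, hba, has, hsb, hbd, hds⟩
  · rintro ⟨a, b, s, d, hd, hba, has, hsb, hbd, hds⟩
    lift d to Fin n using hd
    lift s to Fin n using h.isCode.lt_of_lt_apply hds
    lift b to Fin n using h.isCode.lt_of_lt_apply hsb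
    lift a to Fin n using h.isCode.lt_of_lt_apply hba
    obtain ⟨a', hab', hba', has'⟩ := h.exists_first_closer ht hba has hsb
    obtain ⟨d', hbd', hds', hsd'⟩ := h.exists_last_opener hc hbd hds (by omega)
    exact ⟨a', b, s, d', hab', hba', has', (h.opener_lt_closer_iff b s).2 hsb, hbd', hds', hsd'⟩

end EncodesMatching

theorem genMatching_eq {k : ℕ} {Q : Matching k} {H P : ℕ → (ℕ → ℕ) → Prop}
    [∀ n, Finite {e // P n e}]
    (hP : ∀ n e, P n e ↔ IsCode n e ∧ TieSorted negCast n e ∧ ¬ H n e)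
    (hH : ∀ n (M : Matching n) o c e, EncodesMatching M o c e → M.IsStoimenow →
      (M.Contains Q ↔ H n e)) :
    genMatching Q = genFun (fun n => {e // P n e}) (fun n e => bottomCount n e.1)
      (fun n e => cutCount n e.1) := by
  choose M o c hM hc using fun n (e : {e // P n e}) => ((hP n e.1).1 e.2).1.exists_encodesMatching
  have hStoimenow n e : (M n e).IsStoimenow :=
    (hM n e).isStoimenow (hc n e) ((hP n e.1).1 e.2).2.1
  refine (genFun_congr (T := fun n => {e // P n e}) (S := StoimenowAvoiding Q)
    (fun n e => ⟨M n e, hStoimenow n e,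
      (hH n _ _ _ _ (hM n e) (hStoimenow n e)).not.2 ((hP n e.1).1 e.2).2.2⟩)
    (fun n => ⟨fun e e' h => ?_, ?_⟩) (fun n e => (hM n e).fcr_eq (hStoimenow n e))
    fun n e => (hM n e).bl_eq).symm
  · have hMe := hM n e
    rw [show M n e = M n e' from congrArg Subtype.val h] at hMe
    exact Subtype.ext (hMe.code_eq (hM n e'))
  · rintro ⟨M', hM', hQ⟩
    obtain ⟨o', c', e, he⟩ := exists_encodesMatching M'
    have hPe : P n e := (hP n e).2 ⟨he.isCode, he.tieSorted hM', (hH n _ _ _ _ he hM').not.1 hQ⟩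
    exact ⟨⟨e, hPe⟩, Subtype.ext ((hM n _).matching_eq (hc n _) he (he.closersSorted hM'))⟩

theorem genMatching_patternOne_eq : genMatching Matching.patternOne =
    genFun (fun n => {e // IsMonotoneCode n e}) (fun n e => bottomCount n e.1)
      (fun n e => cutCount n e.1) :=
  genMatching_eq (fun _ _ => isMonotoneCode_iff) fun _ _ _ _ _ h => h.contains_patternOne_iff

theorem genMatching_patternTwo_eq : genMatching Matching.patternTwo =
    genFun (fun n => {e // IsSortedNFree n e}) (fun n e => bottomCount n e.1)
      (fun n e => cutCount n e.1) :=
  genMatching_eq (fun _ _ => Iff.rfl) fun _ _ _ _ _ h => h.contains_patternTwo_iff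

end Fishburn

theorem mainTheorem5 :
    Fishburn.genMatching Fishburn.Matching.patternOne =
        Fishburn.genMatching Fishburn.Matching.patternTwo ∧
    Fishburn.genMatching Fishburn.Matching.patternTwo = Fishburn.genPosetThreePlusOne ∧
    Fishburn.genPosetThreePlusOne = Fishburn.genPosetN ∧
    Fishburn.genPosetN = Fishburn.genAscent ∧
    Fishburn.genAscent = Fishburn.genFishburn ∧
    -- the first closed form, as an identity in the field of fractions
    (let y := Fishburn.toFrac Fishburn.serY
     let z := Fishburn.toFrac Fishburn.serZ
     let t := Fishburn.toFrac Fishburn.serT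
     let s := Fishburn.toFrac Fishburn.sqrtSeries
     (2 * t - y * t * (1 - s)) * (2 * t - z * t * (1 - s)) ≠ 0 ∧
     Fishburn.toFrac Fishburn.genFishburn =
       1 + (4 * t ^ 2 * y * z * t) /
         ((2 * t - y * t * (1 - s)) * (2 * t - z * t * (1 - s)))) ∧
    -- the second closed form
    Fishburn.genFishburn =
      1 + Fishburn.serY * Fishburn.serZ * Fishburn.serT *
        Fishburn.ballotGF Fishburn.varY * Fishburn.ballotGF Fishburn.varZ ∧
    -- the coefficients of the two factors are the ballot numbers
    (∀ x : Fishburn.Coeffs,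
      Fishburn.ballotGF x =
        1 + Fishburn.serT * PowerSeries.mk fun n =>
          ∑ k ∈ Finset.range (n + 1),
            MvPolynomial.C (Fishburn.ballotNumber n k) * x ^ (n + 1 - k)) ∧
    -- the distribution is symmetric in `y` and `z`
    Fishburn.swapYZ (Fishburn.genMatching Fishburn.Matching.patternOne) =
        Fishburn.genMatching Fishburn.Matching.patternOne ∧
    Fishburn.swapYZ (Fishburn.genMatching Fishburn.Matching.patternTwo) =
        Fishburn.genMatching Fishburn.Matching.patternTwo := by
  have monotone := Fishburn.IsMonotoneCode.isCatalanPair.genFun_eq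
  have noncrossing := Fishburn.IsNoncrossingCode.isCatalanPair.genFun_eq
  have avoiding101 := Fishburn.IsRGFAvoiding101.isCatalanPair.genFun_eq
  have patternOne := Fishburn.genMatching_patternOne_eq.trans monotone
  have patternTwo := Fishburn.genMatching_patternTwo_eq.trans
    (Fishburn.genFun_isSortedNFree.trans noncrossing)
  have threePlusOne := Fishburn.genPosetThreePlusOne_eq.trans monotone
  have posetN := Fishburn.genPosetN_eq.trans noncrossing
  have ascent := Fishburn.genAscent_eq.trans avoiding101
  have fishburn := Fishburn.genFishburn_eq.trans noncrossing
  refine ⟨patternOne.trans patternTwo.symm, patternTwo.trans threePlusOne.symm,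
    threePlusOne.trans posetN.symm, posetN.trans ascent.symm, ascent.trans fishburn.symm, ?_,
    fishburn, Fishburn.ballotGF_eq, ?_, ?_⟩
  · rw [fishburn]
    exact Fishburn.toFrac_ballotGF_product_eq_div
  · rw [patternOne, Fishburn.swapYZ_ballotGF_product]
  · rw [patternTwo, Fishburn.swapYZ_ballotGF_product]
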